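/- Let $r,n\ge 1$, let $q$ be an indeterminate and $\mathcal R=\mathbb Z[\frac1r][q,q^{-1}]$. The affine Yokonuma–Hecke algebra $\widehat Y_{r,n}$ is the $\mathcal R$-algebra with generators $\bar t_1,\dots,\bar t_n,g_1,\dots,g_{n-1},X_1^{\pm1}$ and relations: $g_ig_j=g_jg_i$ if $|i-j|\ge2$; $g_ig_{i+1}g_i=g_{i+1}g_ig_{i+1}$; $\bar t_i\bar t_j=\bar t_j\bar t_i$; $g_i\bar t_j=\bar t_{s_i(j)}g_i$ with $s_i=(i,i+1)$; $\bar t_i^{\,r}=1$; $g_i^2=1+(q-q^{-1})\bar e_ig_i$ with $\bar e_i=\frac1r\sum_{s=0}^{r-1}\bar t_i^{\,s}\bar t_{i+1}^{\,-s}$; $X_1X_1^{-1}=X_1^{-1}X_1=1$; $g_1X_1g_1X_1=X_1g_1X_1g_1$; $g_iX_1=X_1g_i$ for $i\ge2$; $\bar t_jX_1=X_1\bar t_j$. Put $X_{i+1}=g_iX_ig_i$. Let $I$ be the set of residues $0,\dots,n-1$ modulo $n$ if $n\ge 2$, and $I=\emptyset$ if $n=1$. Let $\widehat W_{r,n}$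 be the group generated by $t_j$ ($j\in\mathbb Z/n$), $\rho$ and $s_i$ ($i\in I$), with relations $s_i^2=1$; $s_is_j=s_js_i$ if $i-j\not\equiv\pm1$; $s_is_{i+1}s_i=s_{i+1}s_is_{i+1}$ if $n\ge3$; $\rho s_i=s_{i-1}\rho$; $t_i^r=1$; $t_it_j=t_jt_i$; $s_it_j=t_{s_i(j)}s_i$ for $i\ne0$; $\rho t_j=t_{j-1}\rho$. Let $\mathcal T=\langle t_j\rangle$, and let $\widehat H^{\rm aff}_{r,n}$ be the $\mathcal R$-algebra generated by $t_j$, $T_{s_i}$, $T_\rho^{\pm1}$ with $T_\rho T_\rho^{-1}=T_\rho^{-1}T_\rho=1$ and the same relations (with $T_{s_i},T_\rho$ in place of $s_i,\rho$), except that $s_i^2=1$ is replaced by $T_{s_i}^2=1+(q-q^{-1})e_iT_{s_i}$, where $e_i=\frac1r\sum_{s=0}^{r-1}t_i^st_{i+1}^{-s}$. A pro-$p$-Iwahori–Hecke algebra in the sense of Vignéras over a commutative ring $R$ is attached to an extension $1\to Z\to W(1)\to W\to1$ with $Z$ finite commutative and $W$ an extended affine Weyl group, and to parameters. Here $W=W^{\rm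 aff}\rtimes\Omega=\Lambda\rtimes W_0$, where $(W^{\rm aff},S^{\rm aff})$ is an affine Coxeter system, $\Omega$ is finitely generated commutative and normalizes $S^{\rm aff}$, $\Lambda$ is finitely generated commutative, and $W_0$ is finite and generated by a part of $S^{\rm aff}$; the length $\ell$ is extended to $W$ by $\ell(wu)=\ell(w)$ ($w\in W^{\rm aff}$, $u\in\Omega$) and inflated to $W(1)$; and $S^{\rm aff}(1)$ is the inverse image of $S^{\rm aff}$ in $W(1)$. The parameters are $(q_s,c_s)\in R\times R[Z]$, $s\in S^{\rm aff}(1)$, such that (A) $q_{st}=q_s$ and $c_{st}=c_st$ for $t\in Z$, and $q_{wsw^{-1}}=q_s$, $c_{wsw^{-1}}=wc_sw^{-1}$ whenever $w\in W(1)$ and $s,wsw^{-1}\in S^{\rm aff}(1)$. The algebra is the $R$-algebra with an $R$-basis $(T_w)_{w\in W(1)}$ satisfying (B) $T_wT_{w'}=T_{ww'}$ if $\ell(ww')=\ell(w)+\ell(w')$, and $T_s^2=q_sT_{s^2}+c_sT_s$ for $s\in S^{\rm aff}(1)$, where $z\in Z$ is read as $T_z$ in $c_s$. **Corollary.** The affine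 Yokonuma–Hecke algebra $\widehat Y_{r,n}$ is a particular case of the pro-$p$-Iwahori–Hecke algebras. Precisely: 1. $W(1)=\widehat W_{r,n}$ and $Z=\mathcal T$ are data as above: in $W=\widehat W_{r,n}/\mathcal T$, the affine Coxeter system is the one of type $\widetilde A_{n-1}$ with $S^{\rm aff}=\{s_i : i\in I\}$, $\Omega=\langle\rho\rangle$, $W_0=\langle s_1,\dots,s_{n-1}\rangle$, and $\Lambda$ is the normal closure of $X_1:=s_1\cdots s_{n-1}\rho$. 2. There are parameters satisfying (A) over $\mathcal R$ with $q_{ts_i}=1$ and $c_{ts_i}=(q-q^{-1})\,te_i$ for all $t\in\mathcal T$, $i\in I$. 3. $\widehat H^{\rm aff}_{r,n}$ has an $\mathcal R$-basis $(T_w)_{w\in\widehat W_{r,n}}$ such that $T_{t\rho^ks_{i_1}\cdots s_{i_m}}=t\,T_\rho^k\,T_{s_{i_1}}\cdots T_{s_{i_m}}$ for all $t\in\mathcal T$, $k\in\mathbb Z$ and all reduced expressions $s_{i_1}\cdots s_{i_m}$, and this basis satisfies (B) for these parameters. 4. There is an $\mathcal R$-algebra isomorphism $\Phi:\widehat H^{\rm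 aff}_{r,n}\to\widehat Y_{r,n}$ with $\Phi(t_j)=\bar t_j$, $\Phi(T_{s_i})=g_i$ for $1\le i\le n-1$, $\Phi(T_{s_0})=X_1^{-1}X_n(g_{n-1}\cdots g_2g_1g_2\cdots g_{n-1})^{-1}$ if $n\ge2$, and $\Phi(T_\rho)=g_{n-1}\cdots g_1X_1$. Hence the basis $(\Phi(T_w))$ of $\widehat Y_{r,n}$ satisfies (B) for these parameters. -/

import Mathlib

noncomputable section

/-! ### Generic pro-p-Iwahori–Hecke algebras -/

namespace ProPIwahori

/-- The matrix of the canonical bilinear form of a Coxeter matrix, with entries `-cos (π / m i j)`.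
Mathlib encodes `m i j = ∞` by `0`, and then the entry is `-cos 0 = -1`, as it should be. -/
def coxeterForm {ι : Type} (M : CoxeterMatrix ι) : Matrix ι ι ℝ :=
  fun i j => -Real.cos (Real.pi / (M i j : ℝ))

/-- A Coxeter matrix is of affine type (all its irreducible components are affine) when its
canonical form is positive semidefinite and has a vector with positive coordinates in its radical,
i.e. when the form is positive semidefinite and degenerate on every irreducible component. -/
def IsAffine {ι : Type} [Fintype ι] (M : CoxeterMatrix ι) : Prop :=
  (coxeterForm M).PosSemidef ∧ ∃ δ : ι → ℝ, (∀ i, 0 < δ i) ∧ (coxeterForm M).mulVec δ = 0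

/-- The group-theoretic data underlying a pro-p-Iwahori–Hecke algebra: a group `G = W(1)` which is
an extension `1 → Z → W(1) → W → 1` of an extended affine Weyl group
`W = Λ ⋊ W₀ = Waff ⋊ Ω` by a finite commutative group `Z`.  Here `(Waff, Saff)` is an affine
Coxeter system of type `M`, the commutative finitely generated group `Ω` normalizes `Saff`, the
finite group `W₀` is generated by a part of `Saff` (indexed by `I₀`), and `Λ` is a commutative
finitely generated normal subgroup. -/
structure Datum (G : Type) [Group G] {ι : Type} [Fintype ι] (M : CoxeterMatrix ι) where
  affine : IsAffine M
  Z : Subgroup G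
  Z_normal : Z.Normal
  Z_finite : Finite Z
  Z_comm : ∀ x ∈ Z, ∀ y ∈ Z, x * y = y * x
  Waff : Subgroup (G ⧸ Z)
  Waff_normal : Waff.Normal
  cs : CoxeterSystem M Waff
  Ω : Subgroup (G ⧸ Z)
  Ω_comm : ∀ x ∈ Ω, ∀ y ∈ Ω, x * y = y * x
  Ω_fg : Ω.FG
  Waff_Ω : Subgroup.IsComplement' Waff Ω
  Ω_conj : ∀ u ∈ Ω, ∀ i, ∃ j,
    u * (cs.simple i : G ⧸ Z) * u⁻¹ = (cs.simple j : G ⧸ Z)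
  I₀ : Set ι
  Λ : Subgroup (G ⧸ Z)
  Λ_normal : Λ.Normal
  Λ_comm : ∀ x ∈ Λ, ∀ y ∈ Λ, x * y = y * x
  Λ_fg : Λ.FG
  W₀_finite : Finite (Subgroup.closure ((fun i => (cs.simple i : G ⧸ Z)) '' I₀))
  Λ_W₀ : Subgroup.IsComplement' Λ
    (Subgroup.closure ((fun i => (cs.simple i : G ⧸ Z)) '' I₀))

attribute [instance] Datum.Z_normal

namespace Datum

variable {G : Type} [Group G] {ι : Type} [Fintype ι] {M : CoxeterMatrix ι}

/-- The length on `W(1)`: the image of `g` in `W` is uniquely `w * u` with `w ∈ Waff`, `u ∈ Ω`,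
and the length of `g` is the Coxeter length of `w`. -/
def length (D : Datum G M) (g : G) : ℕ :=
  D.cs.length (Subgroup.IsComplement.equiv D.Waff_Ω (g : G ⧸ D.Z)).1

/-- `Saff(1)`, the inverse image of `Saff` in `W(1)`. -/
def Saff1 (D : Datum G M) : Set G :=
  {g | ∃ i, (g : G ⧸ D.Z) = (D.cs.simple i : G ⧸ D.Z)}

/-- The conditions on parameters `(q_s, c_s) ∈ R × R[Z]`, `s ∈ Saff(1)`.  The values of `q` and `c`
outside `Saff(1)` play no role. -/
structure IsParameter (D : Datum G M) {R : Type} [CommRing R]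
    (q : G → R) (c : G → MonoidAlgebra R D.Z) : Prop where
  q_mul : ∀ s ∈ D.Saff1, ∀ t : D.Z, q (s * t) = q s
  q_conj : ∀ s ∈ D.Saff1, ∀ w : G, w * s * w⁻¹ ∈ D.Saff1 → q (w * s * w⁻¹) = q s
  c_mul : ∀ s ∈ D.Saff1, ∀ t : D.Z, c (s * t) = c s * MonoidAlgebra.of R D.Z t
  c_conj : ∀ s ∈ D.Saff1, ∀ w : G, w * s * w⁻¹ ∈ D.Saff1 →
    c (w * s * w⁻¹) = MonoidAlgebra.mapDomain (MulAut.conjNormal w) (c s)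

/-- `A` is the pro-p-Iwahori–Hecke `R`-algebra attached to the datum `D` and the parameters
`(q_s, c_s)`, with Iwahori–Matsumoto basis `(T_w)`, `w ∈ W(1)`: the parameters satisfy the
conditions above, and `T` is an `R`-basis of `A` satisfying the braid and quadratic relations
`T_w T_w' = T_{ww'}` if `ℓ(ww') = ℓ(w) + ℓ(w')`, and `T_s² = q_s T_{s²} + c_s T_s` for
`s ∈ Saff(1)`, where `c_s = ∑ c_s(z) z` is read in `A` as `∑ c_s(z) T_z`. -/
structure IsHeckeAlgebra (D : Datum G M) {R : Type} [CommRing R]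
    (q : G → R) (c : G → MonoidAlgebra R D.Z)
    {A : Type} [Ring A] [Algebra R A] (T : Module.Basis G R A) : Prop where
  parameter : D.IsParameter q c
  braid : ∀ w w' : G, D.length (w * w') = D.length w + D.length w' → T w * T w' = T (w * w')
  quadratic : ∀ s ∈ D.Saff1,
    T s * T s = q s • T (s * s) + ((c s).coeff.sum fun z a => a • T (z : G)) * T s

end Datum

end ProPIwahori

/-! ### Affine Yokonuma–Hecke algebras -/

namespace AffineYokonuma

/-- The ground ring `ℤ[1/r][q, q⁻¹]`. -/
def Ground (r : ℕ) : Type := LaurentPolynomial (Localization.Away (r : ℤ))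

instance (r : ℕ) : CommRing (Ground r) :=
  inferInstanceAs (CommRing (LaurentPolynomial (Localization.Away (r : ℤ))))

/-- The indeterminate `q`. -/
def q (r : ℕ) : Ground r :=
  (LaurentPolynomial.T 1 : LaurentPolynomial (Localization.Away (r : ℤ)))

/-- The inverse `q⁻¹`. -/
def qInv (r : ℕ) : Ground r :=
  (LaurentPolynomial.T (-1) : LaurentPolynomial (Localization.Away (r : ℤ)))

/-- The scalar `1/r`. -/
def rInv (r : ℕ) : Ground r :=
  (LaurentPolynomial.C (IsLocalization.Away.invSelf (r : ℤ)) :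
    LaurentPolynomial (Localization.Away (r : ℤ)))

/-- Indices `1, …, n-1` of the finite simple reflections, as the nonzero residues modulo `n`.
The indices `1, …, n` of the `t_j` are the residues modulo `n`, so that `t_0 = t_n`. -/
abbrev FinIdx (n : ℕ) : Type := {i : ZMod n // i ≠ 0}

/-- Indices `0, …, n-1` of the affine simple reflections: all residues modulo `n` if `n ≥ 2`,
and none if `n = 1`. -/
abbrev AffIdx (n : ℕ) : Type := {_i : ZMod n // 2 ≤ n}

/-- The index `i - 1` (modulo `n`). -/
def AffIdx.pred {n : ℕ} (i : AffIdx n) : AffIdx n := ⟨i.1 - 1, i.2⟩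

/-- The index `i + 1` (modulo `n`). -/
def AffIdx.succ {n : ℕ} (i : AffIdx n) : AffIdx n := ⟨i.1 + 1, i.2⟩

/-- Generators `t_1, …, t_n, g_1, …, g_{n-1}, X_1, X_1⁻¹`. -/
inductive YGen (n : ℕ) : Type
  | t (j : ZMod n)
  | g (i : FinIdx n)
  | X
  | Xinv

/-- The free algebra on the generators. -/
abbrev YFree (r n : ℕ) : Type := FreeAlgebra (Ground r) (YGen n)

/-- A generator, in the free algebra. -/
abbrev yf (r : ℕ) {n : ℕ} (x : YGen n) : YFree r n := FreeAlgebra.ι (Ground r) x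

/-- `e_i = (1/r) ∑_{s=0}^{r-1} t_i^s t_{i+1}^{-s}`, with `t^{-s}` written as `t^{r-s}`
(recall `t^r = 1`). -/
def yE (r : ℕ) {n : ℕ} (i : FinIdx n) : YFree r n :=
  rInv r • ∑ s ∈ Finset.range r, yf r (YGen.t i.1) ^ s * yf r (YGen.t (i.1 + 1)) ^ (r - s)

/-- The defining relations of the affine Yokonuma–Hecke algebra. -/
inductive YRel (r n : ℕ) : YFree r n → YFree r n → Prop
  | g_comm (i j : FinIdx n) (h : 2 ≤ |((i.1.val : ℤ) - (j.1.val : ℤ))|) :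
      YRel r n (yf r (.g i) * yf r (.g j)) (yf r (.g j) * yf r (.g i))
  | g_braid (i j : FinIdx n) (h : j.1 = i.1 + 1) :
      YRel r n (yf r (.g i) * yf r (.g j) * yf r (.g i)) (yf r (.g j) * yf r (.g i) * yf r (.g j))
  | t_comm (i j : ZMod n) :
      YRel r n (yf r (.t i) * yf r (.t j)) (yf r (.t j) * yf r (.t i))
  | g_t (i : FinIdx n) (j : ZMod n) :
      YRel r n (yf r (.g i) * yf r (.t j)) (yf r (.t (Equiv.swap i.1 (i.1 + 1) j)) * yf r (.g i))
  | t_pow (i : ZMod n) : YRel r n (yf r (.t i) ^ r) 1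
  | g_sq (i : FinIdx n) :
      YRel r n (yf r (.g i) ^ 2) (1 + (q r - qInv r) • (yE r i * yf r (.g i)))
  | X_Xinv : YRel r n (yf r .X * yf r .Xinv) 1
  | Xinv_X : YRel r n (yf r .Xinv * yf r .X) 1
  | g_X_g_X (i : FinIdx n) (h : i.1 = 1) :
      YRel r n (yf r (.g i) * yf r .X * yf r (.g i) * yf r .X)
        (yf r .X * yf r (.g i) * yf r .X * yf r (.g i))
  | g_X (i : FinIdx n) (h : i.1 ≠ 1) :
      YRel r n (yf r (.g i) * yf r .X) (yf r .X * yf r (.g i))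
  | t_X (j : ZMod n) : YRel r n (yf r (.t j) * yf r .X) (yf r .X * yf r (.t j))

/-- The affine Yokonuma–Hecke algebra `Ŷ_{r,n}(q)`. -/
abbrev YAlg (r n : ℕ) : Type := RingQuot (YRel r n)

/-- A generator of `Ŷ_{r,n}`. -/
def y (r : ℕ) {n : ℕ} (x : YGen n) : YAlg r n := RingQuot.mkAlgHom (Ground r) (YRel r n) (yf r x)

/-- `g_k`, for a natural number `1 ≤ k ≤ n-1`. -/
def yg (r n k : ℕ) : YAlg r n :=
  if h : (k : ZMod n) ≠ 0 then y r (.g ⟨k, h⟩) else 1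

/-- `g_1 g_2 ⋯ g_{n-1}`. -/
def gUp (r n : ℕ) : YAlg r n := ((List.range' 1 (n - 1)).map (yg r n)).prod

/-- `g_2 g_3 ⋯ g_{n-1}`. -/
def gUp₂ (r n : ℕ) : YAlg r n := ((List.range' 2 (n - 2)).map (yg r n)).prod

/-- `g_{n-1} ⋯ g_2 g_1`. -/
def gDown (r n : ℕ) : YAlg r n := ((List.range' 1 (n - 1)).reverse.map (yg r n)).prod

/-- `X_n = g_{n-1} ⋯ g_1 X_1 g_1 ⋯ g_{n-1}`, as given by `X_{i+1} = g_i X_i g_i`. -/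
def Xn (r n : ℕ) : YAlg r n := gDown r n * y r .X * gUp r n

/-! ### The extended affine group and the Iwahori–Matsumoto presentation -/

/-- Generators `t_1, …, t_n, ρ, s_0, …, s_{n-1}` of the group `Ŵ_{r,n}`. -/
inductive WGen (n : ℕ) : Type
  | t (j : ZMod n)
  | rho
  | s (i : AffIdx n)

/-- A generator, in the free group. -/
abbrev wf {n : ℕ} (x : WGen n) : FreeGroup (WGen n) := FreeGroup.of x

/-- The defining relations `a = b` of `Ŵ_{r,n}`, as the elements `a b⁻¹`. -/
inductive WRel (r n : ℕ) : FreeGroup (WGen n) → Prop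
  | s_sq (i : AffIdx n) : WRel r n (wf (.s i) ^ 2)
  | s_comm (i j : AffIdx n) (h : i.1 - j.1 ≠ 1) (h' : i.1 - j.1 ≠ -1) :
      WRel r n (wf (.s i) * wf (.s j) * (wf (.s j) * wf (.s i))⁻¹)
  | rho_s (i : AffIdx n) : WRel r n (wf .rho * wf (.s i) * (wf (.s i.pred) * wf .rho)⁻¹)
  | s_braid (h : 3 ≤ n) (i : AffIdx n) :
      WRel r n (wf (.s i) * wf (.s i.succ) * wf (.s i) *
        (wf (.s i.succ) * wf (.s i) * wf (.s i.succ))⁻¹)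
  | t_pow (i : ZMod n) : WRel r n (wf (.t i) ^ r)
  | t_comm (i j : ZMod n) : WRel r n (wf (.t i) * wf (.t j) * (wf (.t j) * wf (.t i))⁻¹)
  | s_t (i : AffIdx n) (hi : i.1 ≠ 0) (j : ZMod n) :
      WRel r n (wf (.s i) * wf (.t j) * (wf (.t (Equiv.swap i.1 (i.1 + 1) j)) * wf (.s i))⁻¹)
  | rho_t (j : ZMod n) : WRel r n (wf .rho * wf (.t j) * (wf (.t (j - 1)) * wf .rho)⁻¹)

/-- The group `Ŵ_{r,n}`. -/
abbrev WGroup (r n : ℕ) : Type := PresentedGroup {x | WRel r n x}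

/-- A generator of `Ŵ_{r,n}`. -/
def w (r : ℕ) {n : ℕ} (x : WGen n) : WGroup r n := PresentedGroup.of x

/-- `s_k ∈ Ŵ_{r,n}` for a natural number `k` (if `n ≥ 2`). -/
def ws (r n k : ℕ) : WGroup r n :=
  if h : 2 ≤ n then w r (.s ⟨(k : ZMod n), h⟩) else 1

/-- The element `X_1 = s_1 ⋯ s_{n-1} ρ` of `Ŵ_{r,n}`. -/
def wX (r n : ℕ) : WGroup r n := ((List.range' 1 (n - 1)).map (ws r n)).prod * w r .rho

/-- The subgroup `𝒯` of `Ŵ_{r,n}` generated by `t_1, …, t_n`. -/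
def torus (r n : ℕ) : Subgroup (WGroup r n) :=
  Subgroup.closure (Set.range fun j : ZMod n => w r (.t j))

/-- `e_i = (1/r) ∑_{s=0}^{r-1} t_i^s t_{i+1}^{-s}` in the group algebra of `Ŵ_{r,n}`. -/
def wE (r : ℕ) {n : ℕ} (i : AffIdx n) : MonoidAlgebra (Ground r) (WGroup r n) :=
  rInv r • ∑ s ∈ Finset.range r,
    MonoidAlgebra.of (Ground r) (WGroup r n) (w r (.t i.1) ^ s * (w r (.t (i.1 + 1)) ^ s)⁻¹)

/-- Generators `t_1, …, t_n, T_{s_0}, …, T_{s_{n-1}}, T_ρ, T_ρ⁻¹`. -/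
inductive HGen (n : ℕ) : Type
  | t (j : ZMod n)
  | s (i : AffIdx n)
  | rho
  | rhoInv

/-- The free algebra on the generators. -/
abbrev HFree (r n : ℕ) : Type := FreeAlgebra (Ground r) (HGen n)

/-- A generator, in the free algebra. -/
abbrev hf (r : ℕ) {n : ℕ} (x : HGen n) : HFree r n := FreeAlgebra.ι (Ground r) x

/-- `e_i = (1/r) ∑_{s=0}^{r-1} t_i^s t_{i+1}^{-s}`, with `t^{-s}` written as `t^{r-s}`. -/
def hE (r : ℕ) {n : ℕ} (i : AffIdx n) : HFree r n :=
  rInv r • ∑ s ∈ Finset.range r, hf r (HGen.t i.1) ^ s * hf r (HGen.t (i.1 + 1)) ^ (r - s)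

/-- The defining relations of `Ĥ_{r,n}^{aff}`. -/
inductive HRel (r n : ℕ) : HFree r n → HFree r n → Prop
  | t_pow (i : ZMod n) : HRel r n (hf r (.t i) ^ r) 1
  | t_comm (i j : ZMod n) : HRel r n (hf r (.t i) * hf r (.t j)) (hf r (.t j) * hf r (.t i))
  | s_t (i : AffIdx n) (hi : i.1 ≠ 0) (j : ZMod n) :
      HRel r n (hf r (.s i) * hf r (.t j)) (hf r (.t (Equiv.swap i.1 (i.1 + 1) j)) * hf r (.s i))
  | rho_t (j : ZMod n) : HRel r n (hf r .rho * hf r (.t j)) (hf r (.t (j - 1)) * hf r .rho)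
  | rho_s (i : AffIdx n) : HRel r n (hf r .rho * hf r (.s i)) (hf r (.s i.pred) * hf r .rho)
  | s_comm (i j : AffIdx n) (h : i.1 - j.1 ≠ 1) (h' : i.1 - j.1 ≠ -1) :
      HRel r n (hf r (.s i) * hf r (.s j)) (hf r (.s j) * hf r (.s i))
  | s_braid (h : 3 ≤ n) (i : AffIdx n) :
      HRel r n (hf r (.s i) * hf r (.s i.succ) * hf r (.s i))
        (hf r (.s i.succ) * hf r (.s i) * hf r (.s i.succ))
  | s_sq (i : AffIdx n) :
      HRel r n (hf r (.s i) ^ 2) (1 + (q r - qInv r) • (hE r i * hf r (.s i)))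
  | rho_rhoInv : HRel r n (hf r .rho * hf r .rhoInv) 1
  | rhoInv_rho : HRel r n (hf r .rhoInv * hf r .rho) 1

/-- The algebra `Ĥ_{r,n}^{aff}`. -/
abbrev HAlg (r n : ℕ) : Type := RingQuot (HRel r n)

/-- A generator of `Ĥ_{r,n}^{aff}`. -/
def h (r : ℕ) {n : ℕ} (x : HGen n) : HAlg r n := RingQuot.mkAlgHom (Ground r) (HRel r n) (hf r x)

/-- The invertible element `T_ρ`, with inverse `T_ρ⁻¹`. -/
def hRho (r n : ℕ) : (HAlg r n)ˣ where
  val := h r .rho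
  inv := h r .rhoInv
  val_inv := by
    simpa [h] using RingQuot.mkAlgHom_rel (Ground r) (HRel.rho_rhoInv (r := r) (n := n))
  inv_val := by
    simpa [h] using RingQuot.mkAlgHom_rel (Ground r) (HRel.rhoInv_rho (r := r) (n := n))

/-- The Coxeter matrix of affine type `A_{n-1}` on the indices `0, …, n-1` modulo `n`.
For `n = 2` the off-diagonal entry is `∞` (encoded as `0`); for `n = 1` the matrix is empty. -/
def affineA (n : ℕ) : CoxeterMatrix (AffIdx n) where
  M := Matrix.of fun i j =>
    if i = j then 1
    else if n = 2 then 0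
    else if i.1 - j.1 = 1 ∨ i.1 - j.1 = -1 then 3 else 2
  isSymm := by
    ext i j
    have e : (j.1 - i.1 = 1 ∨ j.1 - i.1 = -1) ↔ (i.1 - j.1 = 1 ∨ i.1 - j.1 = -1) := by
      rw [← neg_sub i.1 j.1, neg_eq_iff_eq_neg, neg_inj, or_comm]
    simp only [Matrix.transpose_apply, Matrix.of_apply, e, eq_comm (a := j) (b := i)]
  diagonal := by simp
  off_diagonal := by
    intro i j hij
    simp only [Matrix.of_apply, hij, if_false]
    split_ifs <;> decide

end AffineYokonuma

end

/-! The proof has three ingredients: a basis for the Iwahori–Matsumoto algebra, the structure of the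
extended affine group, and a change of generators that identifies the two presentations.

Basis. On the group algebra of `WGroup r n` let `leftOp` be what left multiplication by `T_{s_i}`
has to be: `g ↦ s_i g`, plus `(q - q⁻¹) e_i g` when `s_i g` is shorter than `g`. Let `rightOp` be
its mirror image. The main point is that left and right operators commute (`leftOp_rightOp_comm`).
If `s_i g` and `g s_j` differ modulo the torus, the two length comparisons are independent, by the
exchange property. If they agree modulo the torus, then `e_i` absorbs the discrepancy
(`δ_mul_wE_of_wproj_eq`), because `e_i t_i = e_i t_{i+1}`. An operator that commutes with the right
operators and with right multiplication by elements of length zero is determined by its value at `1`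
(`CommutesRight.ext`). The braid relations for the left operators therefore only need to be checked
at `1`, where they are identities in the group, and the algebra acts (`act`). In the other
direction, Matsumoto's theorem makes the product over a reduced word well defined, and `g ↦ T_g`
extends to a map `hSection` linear over the algebra (`hSection_act`). It is inverse to `a ↦ a • 1`,
which gives the basis, and products in the basis are read off from the action.

Group. The torus is the kernel of the projection onto the semidirect product of the affine Weyl
group with `⟨ρ⟩`. The action on residues modulo `n` is faithful on `W₀` and trivial on `X_1`, so
`W₀` is finite and meets `Λ` trivially. The conjugates of `X_1` by `s_k ⋯ s_1` commute and generate
`Λ`. The canonical form is half the sum of the squares of cyclic differences, hence of affine type.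

Isomorphism. Put `D = g_{n-1} ⋯ g_1` and `ρ = D X_1`. Sliding generators through `D` shows that `ρ`
shifts the indices of the braid generators, and that the relation `g_1 X_1 g_1 X_1 = X_1 g_1 X_1
g_1` is equivalent, given the others, to `ρ² g_1 = g_{n-1} ρ²` (`IsBraidSeq.isBraidX`,
`IsBraidX.sq_mul`). Setting `g_0 = ρ g_1 ρ⁻¹`, every relation involving the index `0` is a conjugate
of one that does not. Both directions of the isomorphism are then defined on generators. -/

namespace CoxeterSystem

/-! ### Inversion parity and descents in a Coxeter system -/

open List

variable {B W : Type*} [Group W] {M : CoxeterMatrix B} (cs : CoxeterSystem M W)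

local prefix:100 "s" => cs.simple
local prefix:100 "π" => cs.wordProd
local prefix:100 "ℓ" => cs.length

open Classical in
/-- The action of a simple reflection on pairs (element, sign) that records inversions. -/
noncomputable def signedConj (i : B) : Equiv.Perm (W × ZMod 2) :=
  Function.Involutive.toPerm
    (fun p => (s i * p.1 * s i, p.2 + if p.1 = s i then 1 else 0)) <| by
    rintro ⟨t, ε⟩
    have : s i * t * s i = s i ↔ t = s i := by
      constructor
      · intro h
        have := congrArg (fun x => s i * x * s i) h
        simpa [mul_assoc] using this
      · rintro rfl
        simp
    ext
    · simp [mul_assoc]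
    · simp only [this, add_assoc]
      split_ifs <;> simp [show (1 : ZMod 2) + 1 = 0 from rfl]

open Classical in
theorem signedConj_apply (i : B) (t : W) (ε : ZMod 2) :
    cs.signedConj i (t, ε) = (s i * t * s i, ε + if t = s i then 1 else 0) := rfl

theorem simple_mul_pow_comm (i j : B) (k : ℕ) :
    s j * (s i * s j) ^ k = ((s i * s j) ^ k)⁻¹ * s j := by
  induction k with
  | zero => simp
  | succ k ih =>
    rw [pow_succ, ← mul_assoc, ih, ← pow_succ, pow_succ' _ k]
    simp [mul_assoc]

-- The alternating word meets the reflections `s_j (s_i s_j)^l` for `l < 2k` in turn, and each of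
-- them toggles the sign exactly at its own position.
open Classical in
theorem signedConj_mul_pow_apply (i j : B) (k : ℕ) (t : W) (ε : ZMod 2) :
    ((cs.signedConj i * cs.signedConj j) ^ k) (t, ε) =
      ((s i * s j) ^ k * t * ((s i * s j) ^ k)⁻¹,
        ε + ∑ l ∈ Finset.range (2 * k), if t = s j * (s i * s j) ^ l then 1 else 0) := by
  induction k with
  | zero => simp
  | succ k ih =>
    have key := cs.simple_mul_pow_comm i j k
    set g := s i * s j with hg
    have h1 : g ^ k * t * (g ^ k)⁻¹ = s j ↔ t = s j * g ^ (2 * k) := by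
      rw [mul_inv_eq_iff_eq_mul, ← eq_inv_mul_iff_mul_eq, two_mul, pow_add, ← mul_assoc,
        ← mul_assoc,
        key]
    have h2 : s j * (g ^ k * t * (g ^ k)⁻¹) * s j = s i ↔ t = s j * g ^ (2 * k + 1) := by
      have : s j * (g ^ k * t * (g ^ k)⁻¹) * s j = s i ↔ g ^ k * t * (g ^ k)⁻¹ = s j * g := by
        generalize g ^ k * t * (g ^ k)⁻¹ = x
        rw [hg]
        constructor
        · intro h
          rw [← h]
          simp [mul_assoc]
        · rintro rfl
          simp [mul_assoc]
      rw [this, mul_inv_eq_iff_eq_mul, ← eq_inv_mul_iff_mul_eq,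
        show 2 * k + 1 = k + (1 + k) by ring,
        pow_add, pow_add, pow_one, ← mul_assoc (s j) (g ^ k), key]
      simp only [mul_assoc]
    rw [pow_succ', Equiv.Perm.mul_apply, ih, Equiv.Perm.mul_apply, signedConj_apply,
      signedConj_apply]
    simp only [h1, h2]
    rw [show 2 * (k + 1) = 2 * k + 1 + 1 by ring, Finset.sum_range_succ, Finset.sum_range_succ]
    ext
    · simp [hg, pow_succ', mul_assoc]
    · simp only [add_assoc]

/-- For `k = M i j` the list of `2k` reflections runs twice through the same `k` elements, so all
sign changes cancel modulo 2. -/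
theorem isLiftable_signedConj : M.IsLiftable cs.signedConj := by
  classical
  intro i j
  ext1 ⟨t, ε⟩
  rw [signedConj_mul_pow_apply, simple_mul_simple_pow, two_mul, Finset.sum_range_add]
  simp only [pow_add, simple_mul_simple_pow, one_mul, mul_one, inv_one]
  rw [CharTwo.add_self_eq_zero]
  simp

/-- The parity of the number of times `t` occurs in the right inversion sequence of a word
for `w`. -/
noncomputable def inversionParity (w t : W) : ZMod 2 :=
  (cs.lift ⟨cs.signedConj, cs.isLiftable_signedConj⟩ w (t, 0)).2

theorem lift_signedConj_apply (w t : W) (ε : ZMod 2) :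
    cs.lift ⟨cs.signedConj, cs.isLiftable_signedConj⟩ w (t, ε) =
      (w * t * w⁻¹, ε + cs.inversionParity w t) := by
  suffices ∃ x, ∀ ε, cs.lift ⟨cs.signedConj, cs.isLiftable_signedConj⟩ w (t, ε) =
      (w * t * w⁻¹, ε + x) by
    obtain ⟨x, hx⟩ := this
    rw [inversionParity, hx, hx]
    simp
  induction w using cs.simple_induction_left with
  | one => exact ⟨0, by simp⟩
  | mul_simple_left w i ih =>
    classical
    obtain ⟨x, hx⟩ := ih
    refine ⟨x + if w * t * w⁻¹ = s i then 1 else 0, fun ε => ?_⟩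
    rw [map_mul, Equiv.Perm.mul_apply, hx, lift_apply_simple, signedConj_apply]
    simp [mul_assoc, add_assoc]

theorem inversionParity_mul (w w' t : W) : cs.inversionParity (w * w') t =
    cs.inversionParity w' t + cs.inversionParity w (w' * t * w'⁻¹) := by
  have := cs.lift_signedConj_apply (w * w') t 0
  rw [map_mul, Equiv.Perm.mul_apply, lift_signedConj_apply, lift_signedConj_apply] at this
  simpa using (congrArg Prod.snd this).symm

open Classical in
theorem inversionParity_simple (i : B) (t : W) :
    cs.inversionParity (s i) t = if t = s i then 1 else 0 := by
  have := cs.lift_signedConj_apply (s i) t 0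
  rw [lift_apply_simple, signedConj_apply] at this
  simpa using (congrArg Prod.snd this).symm

@[simp] theorem inversionParity_one (t : W) : cs.inversionParity 1 t = 0 := by
  simp [inversionParity]

theorem mem_rightInvSeq_of_inversionParity {ω : List B} {t : W}
    (h : cs.inversionParity (π ω) t ≠ 0) : t ∈ cs.rightInvSeq ω := by
  classical
  induction ω with
  | nil => simp at h
  | cons i ω ih =>
    rw [wordProd_cons, inversionParity_mul, inversionParity_simple] at h
    rw [rightInvSeq, mem_cons]
    by_cases hi : π ω * t * (π ω)⁻¹ = s i
    · left
      rw [← hi]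
      group
    · right
      apply ih
      simpa [hi] using h

/-- The parity depends on `w` alone, so a nonzero value puts `t` in the inversion sequence of every
word for `w`, in particular of a reduced one. -/
theorem length_mul_lt_of_inversionParity {w t : W} (h : cs.inversionParity w t ≠ 0) :
    ℓ (w * t) < ℓ w := by
  obtain ⟨ω, hω, rfl⟩ := cs.exists_isReduced w
  exact (cs.isRightInversion_of_mem_rightInvSeq hω (cs.mem_rightInvSeq_of_inversionParity h)).2

/-- If the parity at `w` were zero, the cocycle rule would make it one at `w s_i`; then `w` would be
shorter than `w s_i`. -/
theorem isRightDescent_iff_inversionParity {w : W} {i : B} :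
    cs.IsRightDescent w i ↔ cs.inversionParity w (s i) = 1 := by
  have h01 : ∀ x : ZMod 2, x = 1 ↔ x ≠ 0 := by decide
  rw [h01]
  refine ⟨fun h h0 => ?_, cs.length_mul_lt_of_inversionParity⟩
  have := cs.length_mul_lt_of_inversionParity (w := w * s i) (t := s i) <| by
    rw [inversionParity_mul, inversionParity_simple]
    simp [h0]
  rw [simple_mul_simple_cancel_right] at this
  exact absurd h this.asymm

theorem isLeftDescent_iff_inversionParity {w : W} {i : B} :
    cs.IsLeftDescent w i ↔ cs.inversionParity w⁻¹ (s i) = 1 := by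
  rw [← isRightDescent_inv_iff, isRightDescent_iff_inversionParity]

/-- By the cocycle rule, left multiplication by `s_i` changes the parity at `s_j` only if `w s_j w⁻¹
= s_i`. This form of the exchange condition later separates left from right descents. -/
theorem isRightDescent_simple_mul_iff {w : W} {i j : B} (h : s i * w ≠ w * s j) :
    cs.IsRightDescent (s i * w) j ↔ cs.IsRightDescent w j := by
  classical
  rw [isRightDescent_iff_inversionParity, isRightDescent_iff_inversionParity,
    inversionParity_mul, inversionParity_simple, if_neg, add_zero]
  rw [mul_inv_eq_iff_eq_mul]
  exact h.symm

theorem isLeftDescent_mul_simple_iff {w : W} {i j : B} (h : s i * w ≠ w * s j) :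
    cs.IsLeftDescent (w * s j) i ↔ cs.IsLeftDescent w i := by
  rw [← isRightDescent_inv_iff, ← isRightDescent_inv_iff, mul_inv_rev, inv_simple]
  refine cs.isRightDescent_simple_mul_iff fun h' => h ?_
  simpa using (congrArg (·⁻¹) h').symm

/-- Induction on the word. The new letter is a descent of `w` but not of the shorter word, so by the
cocycle rule its conjugate is an inversion of the remaining factor, whose length must drop. This
replaces the use of longest elements of parabolic subgroups. -/
theorem length_eq_add_of_forall_isLeftDescent {w : W} {ω : List B} (hω : cs.IsReduced ω)
    (h : ∀ i ∈ ω, cs.IsLeftDescent w i) : ℓ w = ω.length + ℓ ((π ω)⁻¹ * w) := by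
  induction ω with
  | nil => simp
  | cons i ω ih =>
    have hω' : cs.IsReduced ω := by simpa using hω.drop 1
    have ih := ih hω' fun j hj => h j (mem_cons_of_mem _ hj)
    have hup : ¬ cs.IsLeftDescent (π ω) i := by
      rw [not_isLeftDescent_iff, ← wordProd_cons, hω, hω'.eq, length_cons]
    have hdown := h i mem_cons_self
    rw [isLeftDescent_iff_inversionParity] at hup hdown
    set b := (π ω)⁻¹ * w with hb
    have hw : w = π ω * b := by simp [hb]
    rw [hw, mul_inv_rev, inversionParity_mul] at hdown
    have hne : cs.inversionParity b⁻¹ ((π ω)⁻¹ * s i * (π ω)⁻¹⁻¹) ≠ 0 := by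
      intro h0
      rw [h0, add_zero] at hdown
      exact hup hdown
    have hlt := cs.length_mul_lt_of_inversionParity hne
    have hb' : b⁻¹ * ((π ω)⁻¹ * s i * (π ω)⁻¹⁻¹) = ((π (i :: ω))⁻¹ * w)⁻¹ := by
      rw [wordProd_cons, hw]
      simp [mul_assoc]
    rw [hb', length_inv, length_inv] at hlt
    have hle := cs.length_mul_le (π (i :: ω)) ((π (i :: ω))⁻¹ * w)
    rw [mul_inv_cancel_left, hω, length_cons] at hle
    rw [length_cons]
    omega

theorem isReduced_pair {i j : B} (h : s i ≠ s j) : cs.IsReduced [i, j] := by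
  classical
  have : ¬ cs.IsLeftDescent (s j) i := by
    rw [isLeftDescent_iff_inversionParity, inv_simple, inversionParity_simple, if_neg h]
    decide
  rw [not_isLeftDescent_iff, length_simple] at this
  simp [IsReduced, wordProd_cons, this]

theorem isReduced_triple {i j : B} (h : s i ≠ s j) (h' : s i * s j ≠ s j * s i) :
    cs.IsReduced [i, j, i] := by
  classical
  have h2 := cs.isReduced_pair h.symm
  have : ¬ cs.IsLeftDescent (s j * s i) i := by
    rw [isLeftDescent_iff_inversionParity, mul_inv_rev, inv_simple, inv_simple,
      inversionParity_mul, inversionParity_simple, inversionParity_simple, if_neg h, if_neg,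
      zero_add]
    · decide
    · rw [mul_inv_eq_iff_eq_mul]
      exact h'.symm
  rw [not_isLeftDescent_iff] at this
  rw [IsReduced, wordProd_cons, wordProd_singleton] at h2
  simp_all [IsReduced, wordProd_cons]

/-! ### Matsumoto's theorem -/

section Matsumoto

variable {A : Type*} [Monoid A] {f : B → A}

/-- Matsumoto's theorem for Coxeter matrices with entries `1, 2, 3, ∞`. -/
theorem prod_map_eq_of_isReduced (hM : ∀ i j, M i j ≤ 3)
    (hinj : Function.Injective cs.simple)
    (h_infty : ∀ i j, M i j = 0 → ∀ w, cs.IsLeftDescent w i → ¬ cs.IsLeftDescent w j)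
    (h_two : ∀ i j, M i j = 2 → f i * f j = f j * f i)
    (h_three : ∀ i j, M i j = 3 → f i * f j * f i = f j * f i * f j)
    (h_ne : ∀ i j, M i j = 3 → s i * s j ≠ s j * s i)
    {ω ω' : List B} (hω : cs.IsReduced ω) (hω' : cs.IsReduced ω') (h : π ω = π ω') :
    (ω.map f).prod = (ω'.map f).prod := by
  induction hn : ω.length generalizing ω ω' with
  | zero =>
    have : ω'.length = 0 := by rw [← hω'.eq, ← h, hω.eq, hn]
    rw [List.length_eq_zero_iff] at hn this
    rw [hn, this]
  | succ n ih =>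
    have hlen : ω'.length = n + 1 := by rw [← hω'.eq, ← h, hω.eq, hn]
    obtain ⟨i, a, rfl⟩ := exists_cons_of_length_eq_add_one hn
    obtain ⟨j, b, rfl⟩ := exists_cons_of_length_eq_add_one hlen
    have ha : cs.IsReduced a := by simpa using hω.drop 1
    have hb : cs.IsReduced b := by simpa using hω'.drop 1
    simp only [length_cons, Nat.add_right_cancel_iff] at hn hlen
    by_cases hij : i = j
    · subst hij
      rw [wordProd_cons, wordProd_cons, mul_left_cancel_iff] at h
      rw [map_cons, map_cons, prod_cons, prod_cons, ih ha hb h hn]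
    set w := π (i :: a) with hw
    have hℓ : ℓ w = n + 1 := by rw [hω, length_cons, hn]
    have hdi : cs.IsLeftDescent w i := by
      rw [IsLeftDescent, hℓ, hw, wordProd_cons, simple_mul_simple_cancel_left, ha.eq]
      omega
    have hdj : cs.IsLeftDescent w j := by
      rw [IsLeftDescent, hℓ, h, wordProd_cons, simple_mul_simple_cancel_left, hb.eq]
      omega
    have hne : s i ≠ s j := fun h => hij (hinj h)
    have hai : π a = s i * w := by rw [hw, wordProd_cons, simple_mul_simple_cancel_left]
    have hbj : π b = s j * w := by rw [h, wordProd_cons, simple_mul_simple_cancel_left]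
    have hmem : ∀ k ∈ [i, j, i], cs.IsLeftDescent w k := by simp [hdi, hdj]
    obtain hm | hm | hm | hm : M i j = 0 ∨ M i j = 1 ∨ M i j = 2 ∨ M i j = 3 := by
      have := hM i j
      omega
    -- An infinite bond cannot occur between two descents of one element, so no braid move is
    -- needed.
    · exact absurd hdj (h_infty i j hm w hdi)
    · exact absurd hm (M.off_diagonal i j hij)
    · have hc := cs.length_eq_add_of_forall_isLeftDescent (cs.isReduced_pair hne)
        (fun k hk => hmem k (by simp at hk ⊢; tauto))
      have hcomm : s i * s j = s j * s i := by
        have h2 := cs.simple_mul_simple_pow i j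
        rw [hm, sq] at h2
        rw [eq_comm, ← mul_left_inj (s i * s j), h2]
        simp [mul_assoc]
      -- Both letters are descents, so `w` starts with `s_i s_j`; `c` spells the rest. The tails `a`
      -- and `b` are compared by induction with `j :: c` and `i :: c`, and a single commutation
      -- remains.
      obtain ⟨c, hc', hcw⟩ := cs.exists_isReduced ((π [i, j])⁻¹ * w)
      rw [hcw, hc'.eq, hℓ] at hc
      simp only [length_cons, length_nil] at hc
      have hcc : π c = s j * (s i * w) := by
        rw [← hcw]
        simp [wordProd_cons, mul_assoc]
      have e1 : π a = π (j :: c) := by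
        rw [wordProd_cons, hcc, hai, simple_mul_simple_cancel_left]
      have e2 : π b = π (i :: c) := by
        rw [wordProd_cons, hcc, hbj, ← mul_assoc, hcomm, mul_assoc, simple_mul_simple_cancel_left]
      have r1 : cs.IsReduced (j :: c) := by
        rw [IsReduced, ← e1, ha.eq, length_cons]
        omega
      have r2 : cs.IsReduced (i :: c) := by
        rw [IsReduced, ← e2, hb.eq, length_cons]
        omega
      rw [map_cons, map_cons, prod_cons, prod_cons, ih ha r1 e1 hn, ih hb r2 e2 hlen, map_cons,
        map_cons, prod_cons, prod_cons, ← mul_assoc, ← mul_assoc, h_two i j hm]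
    · have hc := cs.length_eq_add_of_forall_isLeftDescent
        (cs.isReduced_triple hne (h_ne i j hm)) hmem
      have hbraid : s i * s j * s i = s j * s i * s j := by
        have h2 := cs.simple_mul_simple_pow i j
        rw [hm, pow_succ, sq] at h2
        have := congrArg (fun x => x * (s j * s i * s j)) h2
        simpa [mul_assoc] using this
      -- The same argument with the common prefix `s_i s_j s_i = s_j s_i s_j`.
      obtain ⟨c, hc', hcw⟩ := cs.exists_isReduced ((π [i, j, i])⁻¹ * w)
      rw [hcw, hc'.eq, hℓ] at hc
      simp only [length_cons, length_nil] at hc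
      have hcc : π c = s i * (s j * (s i * w)) := by
        rw [← hcw]
        simp [wordProd_cons, mul_assoc]
      have hcc' : π c = s j * (s i * (s j * w)) := by
        rw [hcc]
        simpa [mul_assoc] using congrArg (· * w) hbraid
      have e1 : π a = π (j :: i :: c) := by
        rw [wordProd_cons, wordProd_cons, hcc, hai]
        simp
      have e2 : π b = π (i :: j :: c) := by
        rw [wordProd_cons, wordProd_cons, hcc', hbj]
        simp
      have r1 : cs.IsReduced (j :: i :: c) := by
        rw [IsReduced, ← e1, ha.eq, length_cons, length_cons]
        omega
      have r2 : cs.IsReduced (i :: j :: c) := by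
        rw [IsReduced, ← e2, hb.eq, length_cons, length_cons]
        omega
      rw [map_cons, map_cons, prod_cons, prod_cons, ih ha r1 e1 hn, ih hb r2 e2 hlen]
      simp only [map_cons, prod_cons, ← mul_assoc]
      rw [h_three i j hm]

end Matsumoto

end CoxeterSystem

namespace AffineYokonuma

/-! ### Cyclic indices and the braid relations of affine type A -/

section Indices

variable {n : ℕ}

@[ext] theorem AffIdx.ext {i j : AffIdx n} (h : i.1 = j.1) : i = j := Subtype.ext h

@[simp] theorem AffIdx.pred_val (i : AffIdx n) : i.pred.1 = i.1 - 1 := rfl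
@[simp] theorem AffIdx.succ_val (i : AffIdx n) : i.succ.1 = i.1 + 1 := rfl
@[simp] theorem AffIdx.pred_succ (i : AffIdx n) : i.succ.pred = i := by ext; simp
@[simp] theorem AffIdx.succ_pred (i : AffIdx n) : i.pred.succ = i := by ext; simp

theorem one_ne_zero_of_two_le (hn : 2 ≤ n) : (1 : ZMod n) ≠ 0 := by
  have : Fact (1 < n) := ⟨hn⟩
  exact one_ne_zero

theorem AffIdx.add_one_ne (i : AffIdx n) : i.1 + 1 ≠ i.1 := by
  simpa using one_ne_zero_of_two_le i.2

theorem two_ne_zero_of_three_le (hn : 3 ≤ n) : (2 : ZMod n) ≠ 0 := by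
  intro h
  have h2 : ((2 : ℕ) : ZMod n) = 0 := by exact_mod_cast h
  rw [ZMod.natCast_eq_zero_iff] at h2
  exact absurd (Nat.le_of_dvd (by norm_num) h2) (by omega)

theorem affineA_apply (i j : AffIdx n) : affineA n i j =
    if i = j then 1 else if n = 2 then 0 else if i.1 - j.1 = 1 ∨ i.1 - j.1 = -1 then 3 else 2 := rfl

theorem affineA_le_three (i j : AffIdx n) : affineA n i j ≤ 3 := by
  rw [affineA_apply]
  split_ifs <;> norm_num

theorem ne_of_affineA_eq_two {i j : AffIdx n} (h : affineA n i j = 2) :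
    i.1 - j.1 ≠ 1 ∧ i.1 - j.1 ≠ -1 := by
  rw [affineA_apply] at h
  split_ifs at h
  · omega
  · omega
  · tauto

theorem eq_succ_of_affineA_eq_three {i j : AffIdx n} (h : affineA n i j = 3) :
    3 ≤ n ∧ (i = j.succ ∨ j = i.succ) := by
  rw [affineA_apply] at h
  split_ifs at h with h1 h2 h3 <;> try omega
  have := i.2
  refine ⟨by omega, h3.imp (fun h => ?_) fun h => ?_⟩
  · ext
    rw [AffIdx.succ_val, ← h]
    ring
  · ext
    rw [AffIdx.succ_val, ← neg_eq_iff_eq_neg.2 h]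
    ring

theorem eq_two_of_affineA_eq_zero {i j : AffIdx n} (h : affineA n i j = 0) : n = 2 ∧ i ≠ j := by
  rw [affineA_apply] at h
  split_ifs at h with h1 h2
  exact ⟨h2, h1⟩

/-- For `n = 2` distinct residues differ by `1`, so the hypotheses exclude the infinite bond. -/
theorem affineA_eq_two {i j : AffIdx n} (hij : i ≠ j) (h : i.1 - j.1 ≠ 1) (h' : i.1 - j.1 ≠ -1) :
    affineA n i j = 2 := by
  rw [affineA_apply, if_neg hij, if_neg, if_neg (by tauto)]
  rintro rfl
  have : ∀ a b : ZMod 2, a ≠ b → a - b = 1 := by decide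
  exact h (this _ _ fun h => hij (Subtype.ext h))

theorem affineA_succ (hn : 3 ≤ n) (i : AffIdx n) : affineA n i i.succ = 3 := by
  rw [affineA_apply, if_neg, if_neg (by omega), if_pos (by simp)]
  intro h
  exact i.add_one_ne (congrArg Subtype.val h).symm

/-- The braid relations of affine type `A`, for elements of a monoid. -/
structure IsAffineBraid {A : Type*} [Monoid A] (f : AffIdx n → A) : Prop where
  comm : ∀ i j, i.1 - j.1 ≠ 1 → i.1 - j.1 ≠ -1 → f i * f j = f j * f i
  braid : 3 ≤ n → ∀ i, f i * f i.succ * f i = f i.succ * f i * f i.succ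

namespace IsAffineBraid

variable {A A' : Type*} [Monoid A] [Monoid A'] {f : AffIdx n → A}

theorem of_two (hf : IsAffineBraid f) (i j : AffIdx n) (h : affineA n i j = 2) :
    f i * f j = f j * f i :=
  hf.comm i j (ne_of_affineA_eq_two h).1 (ne_of_affineA_eq_two h).2

theorem of_three (hf : IsAffineBraid f) (i j : AffIdx n) (h : affineA n i j = 3) :
    f i * f j * f i = f j * f i * f j := by
  obtain ⟨hn, rfl | rfl⟩ := eq_succ_of_affineA_eq_three h
  · exact (hf.braid hn j).symm
  · exact hf.braid hn i

theorem comp_pred (hf : IsAffineBraid f) : IsAffineBraid fun i => f i.pred where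
  comm i j h h' := hf.comm _ _ (by simpa using h) (by simpa using h')
  braid hn i := by simpa using hf.braid hn i.pred

theorem comp_succ (hf : IsAffineBraid f) : IsAffineBraid fun i => f i.succ where
  comm i j h h' := hf.comm _ _ (by simpa using h) (by simpa using h')
  braid hn i := by simpa using hf.braid hn i.succ

theorem map (hf : IsAffineBraid f) (φ : A →* A') : IsAffineBraid fun i => φ (f i) where
  comm i j h h' := by simp only [← map_mul, hf.comm i j h h']
  braid hn i := by simp only [← map_mul, hf.braid hn i]

theorem isLiftable {Γ : Type*} [Group Γ] {f : AffIdx n → Γ} (hf : IsAffineBraid f)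
    (hsq : ∀ i, f i * f i = 1) : (affineA n).IsLiftable f := by
  intro i j
  by_cases hij : i = j
  · subst hij
    rw [(affineA n).diagonal, pow_one, hsq]
  have hinv : ∀ i, (f i)⁻¹ = f i := fun i => inv_eq_of_mul_eq_one_left (hsq i)
  obtain hm | hm | hm | hm : affineA n i j = 0 ∨ affineA n i j = 1 ∨ affineA n i j = 2 ∨
      affineA n i j = 3 := by
    have := affineA_le_three i j
    omega
  -- The infinite bond is encoded by `0` and imposes nothing.
  · rw [hm, pow_zero]
  · exact absurd hm ((affineA n).off_diagonal i j hij)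
  · rw [hm, sq]
    nth_rw 2 [hf.of_two i j hm]
    rw [mul_assoc, ← mul_assoc (f j), hsq, one_mul, hsq]
  · have := hf.of_three i j hm
    rw [hm, pow_succ, sq, show f i * f j * (f i * f j) * (f i * f j) =
      (f i * f j * f i) * (f j * f i * f j) by simp only [mul_assoc], ← this,
      ← hinv i, ← hinv j]
    simp only [hinv, mul_assoc]
    simp only [← mul_assoc]
    rw [mul_assoc _ (f i) (f i), hsq, mul_one, mul_assoc _ (f j) (f j), hsq, mul_one, hsq]

end IsAffineBraid

end Indices

/-! ### The affine Weyl group, its rotation and its action on residues -/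

/-- The affine Weyl group of type `A`. -/
abbrev Cox (n : ℕ) : Type := (affineA n).Group

/-- The Coxeter system of affine type `A`. -/
def cox (n : ℕ) : CoxeterSystem (affineA n) (Cox n) := (affineA n).toCoxeterSystem

section CoxeterGroup

variable {n : ℕ}

theorem isAffineBraid_simple : IsAffineBraid (cox n).simple where
  comm i j h h' := by
    by_cases hij : i = j
    · rw [hij]
    have := (cox n).simple_mul_simple_pow i j
    rw [affineA_eq_two hij h h', sq] at this
    simpa using eq_inv_of_mul_eq_one_left this
  braid hn i := by
    have := (cox n).simple_mul_simple_pow i i.succ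
    rw [affineA_succ hn, pow_succ, sq, show ∀ a b : Cox n, a * b * (a * b) * (a * b) =
      (a * b * a) * (b * a * b) by intros; simp only [mul_assoc]] at this
    simpa [mul_assoc] using eq_inv_of_mul_eq_one_left this

/-- The homomorphism from the affine Weyl group determined by images of simple reflections. -/
noncomputable def coxLift {Γ : Type*} [Group Γ] (f : AffIdx n → Γ) (hf : IsAffineBraid f)
    (hsq : ∀ i, f i * f i = 1) : Cox n →* Γ :=
  (cox n).lift ⟨f, hf.isLiftable hsq⟩

@[simp] theorem coxLift_simple {Γ : Type*} [Group Γ] (f : AffIdx n → Γ) (hf : IsAffineBraid f)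
    (hsq : ∀ i, f i * f i = 1) (i : AffIdx n) : coxLift f hf hsq ((cox n).simple i) = f i :=
  (cox n).lift_apply_simple _ i

/-- The automorphism of the affine Weyl group with `s_i ↦ s_{i-1}`. -/
noncomputable def rot (n : ℕ) : MulAut (Cox n) :=
  MonoidHom.toMulEquiv
    (coxLift (fun i => (cox n).simple i.pred) isAffineBraid_simple.comp_pred (by simp))
    (coxLift (fun i => (cox n).simple i.succ) isAffineBraid_simple.comp_succ (by simp))
    ((cox n).ext_simple fun i => by simp) ((cox n).ext_simple fun i => by simp)

@[simp] theorem rot_simple (i : AffIdx n) :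
    rot n ((cox n).simple i) = (cox n).simple i.pred := by
  simp [rot]

@[simp] theorem rot_symm_simple (i : AffIdx n) :
    (rot n).symm ((cox n).simple i) = (cox n).simple i.succ := by
  simp [rot]

/-- An automorphism that permutes the simple reflections cannot increase length; this applies to the
rotation and to its inverse. -/
theorem length_rot (x : Cox n) : (cox n).length (rot n x) = (cox n).length x := by
  have key : ∀ (φ : MulAut (Cox n)) (_ : ∀ i, ∃ j, φ ((cox n).simple i) = (cox n).simple j)
      (x : Cox n), (cox n).length (φ x) ≤ (cox n).length x := by
    intro φ hφ x
    obtain ⟨ω, hω, rfl⟩ := (cox n).exists_isReduced x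
    choose p hp using hφ
    have : φ ((cox n).wordProd ω) = (cox n).wordProd (ω.map p) := by
      clear hω
      induction ω with
      | nil => simp
      | cons i ω ih => rw [CoxeterSystem.wordProd_cons, map_mul, ih, hp, List.map_cons,
          CoxeterSystem.wordProd_cons]
    rw [this, hω.eq]
    simpa using (cox n).length_wordProd_le (ω.map p)
  refine le_antisymm (key (rot n) (fun i => ⟨_, rot_simple i⟩) x) ?_
  simpa using key (rot n).symm (fun i => ⟨_, rot_symm_simple i⟩) (rot n x)

theorem rot_zpow_simple (k : ℤ) (i : AffIdx n) :
    ∃ j, (rot n ^ k) ((cox n).simple i) = (cox n).simple j := by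
  induction k using Int.induction_on generalizing i with
  | zero => exact ⟨i, by simp⟩
  | succ k ih =>
    obtain ⟨j, hj⟩ := ih i.pred
    exact ⟨j, by rw [zpow_add_one, MulAut.mul_apply, rot_simple, hj]⟩
  | pred k ih =>
    obtain ⟨j, hj⟩ := ih i.succ
    exact ⟨j, by rw [zpow_sub_one, MulAut.mul_apply, MulAut.inv_apply, rot_symm_simple, hj]⟩

theorem isAffineBraid_swap :
    IsAffineBraid fun i : AffIdx n => (Equiv.swap i.1 (i.1 + 1) : Equiv.Perm (ZMod n)) where
  comm i j h h' := by
    by_cases hij : i.1 = j.1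
    · rw [hij]
    have h1 : i.1 ≠ j.1 + 1 := fun h1 => h (by rw [h1]; ring)
    have h2 : i.1 + 1 ≠ j.1 := fun h1 => h' (by rw [← h1]; ring)
    refine Equiv.Perm.Disjoint.commute fun x => ?_
    by_cases hx : x = i.1 ∨ x = i.1 + 1
    · right
      obtain rfl | rfl := hx
      · exact Equiv.swap_apply_of_ne_of_ne hij h1
      · exact Equiv.swap_apply_of_ne_of_ne h2 (by simpa using hij)
    · left
      exact Equiv.swap_apply_of_ne_of_ne (fun h => hx (.inl h)) fun h => hx (.inr h)
  braid hn i := by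
    have h1 := i.add_one_ne
    have h2 := i.succ.add_one_ne
    have h3 : i.1 + 1 + 1 ≠ i.1 := by
      rw [add_assoc, one_add_one_eq_two]
      simpa using two_ne_zero_of_three_le hn
    rw [AffIdx.succ_val] at h2 ⊢
    rw [Equiv.swap_mul_swap_mul_swap h1.symm h3.symm, Equiv.swap_comm i.1,
      Equiv.swap_comm _ (i.1 + 1 + 1), Equiv.swap_mul_swap_mul_swap h2 h3, Equiv.swap_comm]

/-- The action of the affine Weyl group on residues modulo `n`. -/
noncomputable def coxPerm (n : ℕ) : Cox n →* Equiv.Perm (ZMod n) :=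
  coxLift _ isAffineBraid_swap (by simp)

@[simp] theorem coxPerm_simple (i : AffIdx n) :
    coxPerm n ((cox n).simple i) = Equiv.swap i.1 (i.1 + 1) := by
  simp [coxPerm]

end CoxeterGroup

end AffineYokonuma

namespace AffineYokonuma

/-! ### Reduced words in the affine Weyl group -/

section Matsumoto

variable {n : ℕ}

/-- The homomorphism to the infinite dihedral group, for `n = 2`. -/
noncomputable def dihedralHom : Cox 2 →* DihedralGroup 0 :=
  coxLift (fun i => DihedralGroup.sr (if i.1 = 0 then 0 else 1))
    { comm := fun i j h h' => by
        have : ∀ a b : ZMod 2, a - b ≠ 1 → a = b := by decide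
        rw [this _ _ h]
      braid := fun h => absurd h (by norm_num) }
    (fun i => by simp)

/-- The product `s_0 s_1` maps to a rotation of infinite order in the infinite dihedral group. -/
theorem infinite_cox_two : Infinite (Cox 2) := by
  let s : ZMod 2 → Cox 2 := fun i => (cox 2).simple ⟨i, le_rfl⟩
  refine Infinite.of_injective (fun k : ℕ => (s 0 * s 1) ^ k) fun a b hab => ?_
  have := congrArg dihedralHom hab
  simpa [s, dihedralHom, ← DihedralGroup.r_zpow, DihedralGroup.r_pow] using this

/-- For `n ≥ 3` the transpositions of residues tell the reflections apart. For `n = 2` both give the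
same transposition, so the map to the infinite dihedral group is used instead. -/
theorem cox_simple_injective : Function.Injective (cox n).simple := by
  intro i j hij
  by_contra hne
  have hne' : i.1 ≠ j.1 := fun h => hne (Subtype.ext h)
  obtain hn | hn := eq_or_lt_of_le i.2
  · subst hn
    have := congrArg dihedralHom hij
    have key : ∀ a b : ZMod 2, a ≠ b →
        (DihedralGroup.sr (if a = 0 then 0 else 1) : DihedralGroup 0) ≠
          DihedralGroup.sr (if b = 0 then 0 else 1) := by decide
    simp only [dihedralHom, coxLift_simple] at this
    exact key _ _ hne' this
  · have := congrArg (coxPerm n) hij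
    have h2 := Equiv.congr_fun this i.1
    rw [coxPerm_simple, coxPerm_simple, Equiv.swap_apply_left] at h2
    by_cases h3 : i.1 = j.1 + 1
    · rw [h3, Equiv.swap_apply_right, add_assoc, one_add_one_eq_two] at h2
      exact two_ne_zero_of_three_le hn (by simpa using h2)
    · rw [Equiv.swap_apply_of_ne_of_ne hne' h3] at h2
      exact i.add_one_ne h2

theorem cox_simple_mul_ne {i j : AffIdx n} (h : affineA n i j = 3) :
    (cox n).simple i * (cox n).simple j ≠ (cox n).simple j * (cox n).simple i := by
  have key : ∀ (_ : 3 ≤ n) (i : AffIdx n), (cox n).simple i * (cox n).simple i.succ ≠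
      (cox n).simple i.succ * (cox n).simple i := by
    intro hn i h
    have := Equiv.congr_fun (congrArg (coxPerm n) h) i.1
    have h1 := i.add_one_ne
    have h2 := i.succ.add_one_ne
    have h3 : i.1 + 1 + 1 ≠ i.1 := by
      rw [add_assoc, one_add_one_eq_two]
      simpa using two_ne_zero_of_three_le hn
    rw [AffIdx.succ_val] at h2
    simp only [map_mul, coxPerm_simple, AffIdx.succ_val, Equiv.Perm.mul_apply] at this
    rw [Equiv.swap_apply_of_ne_of_ne h1.symm h3.symm, Equiv.swap_apply_left,
      Equiv.swap_apply_left] at this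
    exact h2 this.symm
  obtain ⟨hn, rfl | rfl⟩ := eq_succ_of_affineA_eq_three h
  · exact (key hn j).symm
  · exact key hn i

/-- If both generators of the infinite dihedral group were descents of `x`, every reduced word would
be a prefix of `x` in the sense of `length_eq_add_of_forall_isLeftDescent`; lengths would be bounded
by that of `x` and the group finite. -/
theorem not_isLeftDescent_of_affineA_eq_zero {i j : AffIdx n} (h : affineA n i j = 0) (x : Cox n)
    (hi : (cox n).IsLeftDescent x i) : ¬ (cox n).IsLeftDescent x j := by
  intro hj
  obtain ⟨rfl, hij⟩ := eq_two_of_affineA_eq_zero h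
  have hall : ∀ k, (cox 2).IsLeftDescent x k := by
    intro k
    have : ∀ a b c : ZMod 2, a ≠ b → c = a ∨ c = b := by decide
    obtain h | h := this i.1 j.1 k.1 fun h => hij (Subtype.ext h)
    · rwa [Subtype.ext h]
    · rwa [Subtype.ext h]
  have hfin : (Set.univ : Set (Cox 2)).Finite := by
    refine ((List.finite_length_le (AffIdx 2) ((cox 2).length x)).image (cox 2).wordProd).subset ?_
    intro u _
    obtain ⟨ω, hω, rfl⟩ := (cox 2).exists_isReduced u
    refine ⟨ω, ?_, rfl⟩
    have := (cox 2).length_eq_add_of_forall_isLeftDescent hω fun i _ => hall i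
    simp only [Set.mem_ofPred_eq]
    omega
  have := infinite_cox_two
  exact Set.infinite_univ hfin

/-- The product of the images of the letters of a reduced word for `x`. -/
noncomputable def reducedProd {A : Type*} [Monoid A] (f : AffIdx n → A) (x : Cox n) : A :=
  (((cox n).exists_isReduced x).choose.map f).prod

theorem reducedProd_wordProd {A : Type*} [Monoid A] {f : AffIdx n → A} (hf : IsAffineBraid f)
    {ω : List (AffIdx n)} (hω : (cox n).IsReduced ω) :
    reducedProd f ((cox n).wordProd ω) = (ω.map f).prod :=
  have h := ((cox n).exists_isReduced ((cox n).wordProd ω)).choose_spec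
  (cox n).prod_map_eq_of_isReduced affineA_le_three cox_simple_injective
    (fun _ _ h x => not_isLeftDescent_of_affineA_eq_zero h x) hf.of_two hf.of_three
    (fun _ _ h => cox_simple_mul_ne h) h.1 hω h.2.symm

theorem reducedProd_one {A : Type*} [Monoid A] {f : AffIdx n → A} (hf : IsAffineBraid f) :
    reducedProd f 1 = 1 := by
  have : (cox n).IsReduced [] := by simp [CoxeterSystem.IsReduced]
  simpa using reducedProd_wordProd hf this

theorem reducedProd_simple_mul {A : Type*} [Monoid A] {f : AffIdx n → A} (hf : IsAffineBraid f)
    {x : Cox n} {i : AffIdx n} (h : ¬ (cox n).IsLeftDescent x i) :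
    reducedProd f ((cox n).simple i * x) = f i * reducedProd f x := by
  obtain ⟨ω, hω, rfl⟩ := (cox n).exists_isReduced x
  rw [CoxeterSystem.not_isLeftDescent_iff, hω.eq] at h
  rw [reducedProd_wordProd hf hω, ← CoxeterSystem.wordProd_cons, reducedProd_wordProd hf]
  · simp
  · rw [CoxeterSystem.IsReduced, CoxeterSystem.wordProd_cons, h, List.length_cons]

end Matsumoto

/-! ### The extended affine Weyl group -/

section ExtendedAffine

variable {n : ℕ}

/-- The extended affine Weyl group of type `A`. -/
abbrev ExtAff (n : ℕ) : Type :=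
  Cox n ⋊[zpowersHom (MulAut (Cox n)) (rot n)] Multiplicative ℤ

/-- A simple reflection in the extended affine Weyl group. -/
noncomputable def es (i : AffIdx n) : ExtAff n := SemidirectProduct.inl ((cox n).simple i)

/-- The element `ρ` of the extended affine Weyl group. -/
noncomputable def eρ (n : ℕ) : ExtAff n := SemidirectProduct.inr (Multiplicative.ofAdd 1)

theorem map_zpow_of_map_eq_conj {C Γ : Type*} [Group C] [Group Γ] (φ : MulAut C) (f : C →* Γ)
    (a : Γ) (h : ∀ c, f (φ c) = a * f c * a⁻¹) (k : ℤ) (c : C) :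
    f ((φ ^ k) c) = a ^ k * f c * (a ^ k)⁻¹ := by
  induction k using Int.induction_on generalizing c with
  | zero => simp
  | succ k ih =>
    rw [zpow_add_one, MulAut.mul_apply, ih, h, zpow_add_one, mul_inv_rev]
    simp only [mul_assoc]
  | pred k ih =>
    have h' : f (φ⁻¹ c) = a⁻¹ * f c * a := by
      have := h (φ⁻¹ c)
      rw [MulAut.apply_inv_self] at this
      rw [this]
      simp [mul_assoc]
    rw [zpow_sub_one, MulAut.mul_apply, ih, h', zpow_sub_one, mul_inv_rev, inv_inv]
    simp only [mul_assoc]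

/-- The homomorphism from the extended affine Weyl group determined by the images of the simple
reflections and of `ρ`. -/
noncomputable def extLift {Γ : Type*} [Group Γ] (f : Cox n →* Γ) (a : Γ)
    (h : ∀ i, f (rot n ((cox n).simple i)) = a * f ((cox n).simple i) * a⁻¹) : ExtAff n →* Γ :=
  SemidirectProduct.lift f (zpowersHom Γ a) fun g => by
    have h' : ∀ c, f (rot n c) = a * f c * a⁻¹ := fun c => by
      have : f.comp (rot n).toMonoidHom = (MulAut.conj a).toMonoidHom.comp f :=
        (cox n).ext_simple fun i => by simpa using h i
      simpa using DFunLike.congr_fun this c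
    ext c
    simpa [← map_zpow] using map_zpow_of_map_eq_conj (rot n) f a h' g.toAdd c

@[simp] theorem extLift_es {Γ : Type*} [Group Γ] (f : Cox n →* Γ) (a : Γ) (h) (i : AffIdx n) :
    extLift f a h (es i) = f ((cox n).simple i) := by
  simp [extLift, es]

@[simp] theorem extLift_eρ {Γ : Type*} [Group Γ] (f : Cox n →* Γ) (a : Γ) (h) :
    extLift f a h (eρ n) = a := by
  simp [extLift, eρ]

theorem extAff_hom_ext {Γ : Type*} [Group Γ] {f g : ExtAff n →* Γ} (hs : ∀ i, f (es i) = g (es i))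
    (hρ : f (eρ n) = g (eρ n)) : f = g := by
  refine SemidirectProduct.hom_ext ((cox n).ext_simple hs) ?_
  ext
  exact hρ

theorem eρ_zpow (k : ℤ) : eρ n ^ k = SemidirectProduct.inr (Multiplicative.ofAdd k) := by
  rw [eρ, ← map_zpow, ← ofAdd_zsmul]
  simp

theorem eρ_mul_inl (x : Cox n) :
    eρ n * SemidirectProduct.inl x = SemidirectProduct.inl (rot n x) * eρ n := by
  have := SemidirectProduct.inl_aut (φ := zpowersHom (MulAut (Cox n)) (rot n))
    (Multiplicative.ofAdd 1) x
  rw [show (zpowersHom (MulAut (Cox n)) (rot n)) (Multiplicative.ofAdd 1) = rot n by simp] at this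
  rw [this, eρ, mul_assoc, ← map_mul]
  simp

theorem es_mul_self (i : AffIdx n) : es i * es i = 1 := by
  rw [es, ← map_mul, CoxeterSystem.simple_mul_simple_self, map_one]

theorem eρ_mul_es (i : AffIdx n) : eρ n * es i = es i.pred * eρ n := by
  rw [es, eρ_mul_inl, rot_simple, es]

theorem isAffineBraid_es : IsAffineBraid (es : AffIdx n → ExtAff n) :=
  isAffineBraid_simple.map SemidirectProduct.inl

/-- The action of the extended affine Weyl group on residues modulo `n`. -/
noncomputable def extPerm (n : ℕ) : ExtAff n →* Equiv.Perm (ZMod n) :=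
  extLift (coxPerm n) (Equiv.subRight 1) fun i => by
    rw [rot_simple, coxPerm_simple, coxPerm_simple, Equiv.mul_swap_eq_swap_mul,
      mul_inv_cancel_right]
    simp [AffIdx.pred_val]

@[simp] theorem extPerm_es (i : AffIdx n) : extPerm n (es i) = Equiv.swap i.1 (i.1 + 1) := by
  simp [extPerm]

@[simp] theorem extPerm_eρ : extPerm n (eρ n) = Equiv.subRight 1 := by
  simp [extPerm]

/-- The length function of the extended affine Weyl group. -/
noncomputable def elen (x : ExtAff n) : ℕ := (cox n).length x.left

theorem elen_eρ_mul (x : ExtAff n) : elen (eρ n * x) = elen x := by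
  simp [elen, eρ, length_rot]

theorem elen_mul_eρ (x : ExtAff n) : elen (x * eρ n) = elen x := by
  simp [elen, eρ]

theorem elen_one : elen (1 : ExtAff n) = 0 := by simp [elen]

theorem elen_es_mul (i : AffIdx n) (x : ExtAff n) :
    elen (es i * x) = elen x + 1 ∨ elen (es i * x) + 1 = elen x := by
  simpa [elen, es] using (cox n).length_simple_mul x.left i


/-- Moving `s_j` to the left past a power of `ρ` relabels it. The new label depends only on that
power, so the same `j'` serves `x` and `s_i x`. -/
theorem exists_left_mul_es (x : ExtAff n) (j : AffIdx n) :
    ∃ j', (∀ y : ExtAff n, y.right = x.right → (y * es j).left = y.left * (cox n).simple j') ∧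
      (x.left * (cox n).simple j' = (x * es j).left) := by
  obtain ⟨j', hj'⟩ := rot_zpow_simple (n := n) x.right.toAdd j
  refine ⟨j', fun y hy => ?_, ?_⟩ <;> simp_all [es]

theorem es_mul_left (i : AffIdx n) (x : ExtAff n) :
    (es i * x).left = (cox n).simple i * x.left := by simp [es]

theorem es_mul_right (i : AffIdx n) (x : ExtAff n) : (es i * x).right = x.right := by simp [es]

theorem mul_es_right (i : AffIdx n) (x : ExtAff n) : (x * es i).right = x.right := by simp [es]

theorem elen_mul_es (x : ExtAff n) (i : AffIdx n) :
    elen (x * es i) = elen x + 1 ∨ elen (x * es i) + 1 = elen x := by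
  obtain ⟨j', hj', -⟩ := exists_left_mul_es x i
  rw [elen, elen, hj' x rfl]
  exact (cox n).length_mul_simple x.left j'

/-- After the relabelling of `j` this is the exchange condition in the affine Weyl group, once on
each side. -/
theorem elen_es_mul_mul_es {i j : AffIdx n} {x : ExtAff n} (h : es i * x ≠ x * es j) :
    (elen (es i * x * es j) < elen (es i * x) ↔ elen (x * es j) < elen x) ∧
      (elen (es i * x * es j) < elen (x * es j) ↔ elen (es i * x) < elen x) := by
  obtain ⟨j', hj', -⟩ := exists_left_mul_es x j
  have hne : (cox n).simple i * x.left ≠ x.left * (cox n).simple j' := by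
    intro h'
    apply h
    ext1
    · rw [es_mul_left, hj' x rfl, h']
    · rw [es_mul_right, mul_es_right]
  simp only [elen, hj' _ (es_mul_right i x), es_mul_left, hj' x rfl]
  exact ⟨(cox n).isRightDescent_simple_mul_iff hne, by
    rw [mul_assoc]; exact (cox n).isLeftDescent_mul_simple_iff hne⟩

end ExtendedAffine

end AffineYokonuma

namespace AffineYokonuma

/-! ### The torus and the semidirect product model -/

section Torus

variable {r n : ℕ}

/-- The torus `(ℤ/r)^n`. -/
abbrev Tor (r n : ℕ) : Type := ZMod n → Multiplicative (ZMod r)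

/-- A standard generator of the torus. -/
def torGen (r : ℕ) {n : ℕ} (j : ZMod n) : Tor r n := Pi.mulSingle j (Multiplicative.ofAdd 1)

/-- The homomorphism from `ℤ/r` with `1 ↦ a`. -/
noncomputable def zmodHom {Γ : Type*} [Group Γ] (a : Γ) (h : a ^ r = 1) :
    Multiplicative (ZMod r) →* Γ :=
  AddMonoidHom.toMultiplicativeLeft (ZMod.lift r ⟨zmultiplesHom (Additive Γ) (Additive.ofMul a), by
    simpa [← ofMul_pow] using h⟩)

theorem zmodHom_ofAdd_one {Γ : Type*} [Group Γ] (a : Γ) (h : a ^ r = 1) :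
    zmodHom a h (Multiplicative.ofAdd 1) = a := by
  have : (1 : ZMod r) = ((1 : ℤ) : ZMod r) := by simp
  simp only [zmodHom, AddMonoidHom.toMultiplicativeLeft_apply_apply, toAdd_ofAdd]
  rw [this, ZMod.lift_coe]
  simp

theorem zmod_hom_ext {Γ : Type*} [Group Γ] {f g : Multiplicative (ZMod r) →* Γ}
    (h : f (Multiplicative.ofAdd 1) = g (Multiplicative.ofAdd 1)) : f = g := by
  refine MonoidHom.ext fun x => ?_
  obtain ⟨k, hk⟩ := ZMod.intCast_surjective x.toAdd
  have : x = Multiplicative.ofAdd (1 : ZMod r) ^ k := by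
    rw [← ofAdd_zsmul, zsmul_one, hk, ofAdd_toAdd]
  rw [this, map_zpow, map_zpow, h]

theorem tor_hom_ext [NeZero n] {Γ : Type*} [Group Γ] {f g : Tor r n →* Γ}
    (h : ∀ j, f (torGen r j) = g (torGen r j)) : f = g := by
  refine MonoidHom.pi_ext fun j x => ?_
  have : f.comp (MonoidHom.mulSingle (fun _ => Multiplicative (ZMod r)) j) =
      g.comp (MonoidHom.mulSingle (fun _ => Multiplicative (ZMod r)) j) := zmod_hom_ext (h j)
  exact DFunLike.congr_fun this x

/-- The homomorphism from the torus determined by the images of the standard generators. -/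
noncomputable def torLift [NeZero n] {Γ : Type*} [Group Γ] (t : ZMod n → Γ)
    (hpow : ∀ j, t j ^ r = 1)
    (hcomm : ∀ i j, t i * t j = t j * t i) : Tor r n →* Γ :=
  MonoidHom.noncommPiCoprod (fun j => zmodHom (t j) (hpow j)) <| by
    intro i j _ x y
    obtain ⟨k, hk⟩ := ZMod.intCast_surjective x.toAdd
    obtain ⟨l, hl⟩ := ZMod.intCast_surjective y.toAdd
    have hx : x = Multiplicative.ofAdd (1 : ZMod r) ^ k := by
      rw [← ofAdd_zsmul, zsmul_one, hk, ofAdd_toAdd]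
    have hy : y = Multiplicative.ofAdd (1 : ZMod r) ^ l := by
      rw [← ofAdd_zsmul, zsmul_one, hl, ofAdd_toAdd]
    rw [hx, hy, map_zpow, map_zpow, zmodHom_ofAdd_one, zmodHom_ofAdd_one]
    exact Commute.zpow_zpow (hcomm i j) k l

@[simp] theorem torLift_torGen [NeZero n] {Γ : Type*} [Group Γ] (t : ZMod n → Γ)
    (hpow : ∀ j, t j ^ r = 1)
    (hcomm : ∀ i j, t i * t j = t j * t i) (j : ZMod n) :
    torLift t hpow hcomm (torGen r j) = t j :=
  (MonoidHom.noncommPiCoprod_mulSingle _ _ _).trans (zmodHom_ofAdd_one _ _)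

/-- The action of the extended affine Weyl group on the torus. -/
noncomputable def torAct (r n : ℕ) : ExtAff n →* MulAut (Tor r n) :=
  (mulAutArrow (A := ZMod n) (M := Multiplicative (ZMod r))).comp (extPerm n)

theorem torAct_torGen (x : ExtAff n) (j : ZMod n) :
    torAct r n x (torGen r j) = torGen r (extPerm n x j) := by
  refine funext fun k => ?_
  change (Pi.mulSingle j (Multiplicative.ofAdd 1) : Tor r n) ((extPerm n x)⁻¹ k) =
    (Pi.mulSingle (extPerm n x j) (Multiplicative.ofAdd 1) : Tor r n) k
  simp only [Pi.mulSingle_apply, Equiv.Perm.inv_eq_iff_eq]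

/-- The wreath-type model of the group `Ŵ_{r,n}`. -/
abbrev Model (r n : ℕ) : Type := Tor r n ⋊[torAct r n] ExtAff n

theorem model_inr_mul_inl (x : ExtAff n) (τ : Tor r n) :
    (SemidirectProduct.inr x * SemidirectProduct.inl τ : Model r n) =
      SemidirectProduct.inl (torAct r n x τ) * SemidirectProduct.inr x := by
  rw [SemidirectProduct.inl_aut, mul_assoc, ← map_mul]
  simp

theorem torGen_pow (j : ZMod n) : torGen r j ^ r = 1 := by
  rw [torGen, ← Pi.mulSingle_pow, ← ofAdd_nsmul]
  simp

end Torus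

/-! ### The group as an extension of the extended affine Weyl group by the torus -/

section Group

variable {r n : ℕ}

theorem w_rel {x : FreeGroup (WGen n)} (hx : WRel r n x) :
    (PresentedGroup.mk {x | WRel r n x} x : WGroup r n) = 1 :=
  (PresentedGroup.one_of_mem (rels := {x | WRel r n x}) hx)

theorem w_rel_mul {x y : FreeGroup (WGen n)} (hx : WRel r n (x * y⁻¹)) :
    (PresentedGroup.mk {x | WRel r n x} x : WGroup r n) = PresentedGroup.mk _ y := by
  have := w_rel hx
  rwa [map_mul, map_inv, mul_inv_eq_one] at this

theorem ws_mul_self (i : AffIdx n) : w r (.s i) * w r (.s i) = 1 := by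
  have := w_rel (r := r) (WRel.s_sq i)
  rwa [map_pow, sq] at this

theorem ws_inv (i : AffIdx n) : (w r (.s i))⁻¹ = w r (.s i) :=
  inv_eq_of_mul_eq_one_left (ws_mul_self i)

theorem isAffineBraid_ws : IsAffineBraid fun i : AffIdx n => w r (.s i) where
  comm i j h h' := w_rel_mul (WRel.s_comm i j h h')
  braid hn i := w_rel_mul (WRel.s_braid hn i)

theorem wrho_mul_ws (i : AffIdx n) : w r .rho * w r (.s i) = w r (.s i.pred) * w r .rho :=
  w_rel_mul (WRel.rho_s i)

theorem wt_pow (i : ZMod n) : w r (.t i) ^ r = 1 := w_rel (WRel.t_pow i)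

theorem wt_comm (i j : ZMod n) : w r (.t i) * w r (.t j) = w r (.t j) * w r (.t i) :=
  w_rel_mul (WRel.t_comm i j)

theorem wrho_mul_wt (j : ZMod n) : w r .rho * w r (.t j) = w r (.t (j - 1)) * w r .rho :=
  w_rel_mul (WRel.rho_t j)

/-- The extended affine Weyl group as a subgroup of `Ŵ_{r,n}`. -/
noncomputable def wsec (r n : ℕ) : ExtAff n →* WGroup r n :=
  extLift (coxLift _ isAffineBraid_ws ws_mul_self) (w r .rho) fun i => by
    rw [rot_simple, coxLift_simple, coxLift_simple, wrho_mul_ws, mul_inv_cancel_right]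

@[simp] theorem wsec_es (i : AffIdx n) : wsec r n (es i) = w r (.s i) := by simp [wsec]

@[simp] theorem wsec_eρ : wsec r n (eρ n) = w r .rho := by simp [wsec]

theorem closure_range_w : Subgroup.closure (Set.range (w r : WGen n → WGroup r n)) = ⊤ :=
  PresentedGroup.closure_range_of _

theorem wt_mem_torus (j : ZMod n) : w r (.t j) ∈ torus r n := Subgroup.subset_closure ⟨j, rfl⟩

theorem torus_comm {x y : WGroup r n} (hx : x ∈ torus r n) (hy : y ∈ torus r n) :
    x * y = y * x := by
  have := Subgroup.isMulCommutative_closure (k := Set.range fun j : ZMod n => w r (.t j)) <| by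
    rintro _ ⟨i, rfl⟩ _ ⟨j, rfl⟩
    exact wt_comm i j
  exact congrArg Subtype.val (this.is_comm.comm ⟨x, hx⟩ ⟨y, hy⟩)

theorem torus_pow {τ : WGroup r n} (hτ : τ ∈ torus r n) : τ ^ r = 1 := by
  induction hτ using Subgroup.closure_induction with
  | mem _ h =>
    obtain ⟨j, rfl⟩ := h
    exact wt_pow j
  | one => simp
  | mul a b ha hb iha ihb =>
    have hc : Commute a b := torus_comm ha hb
    rw [hc.mul_pow, iha, ihb, one_mul]
  | inv a _ ih => rw [inv_pow, ih, inv_one]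

theorem wgroup_induction {p : WGroup r n → Prop} (g : WGroup r n) (hgen : ∀ x, p (w r x))
    (one : p 1) (mul : ∀ a b, p a → p b → p (a * b)) (inv : ∀ a, p a → p a⁻¹) : p g := by
  have hg : g ∈ Subgroup.closure (Set.range (w r : WGen n → WGroup r n)) := by
    rw [closure_range_w]
    trivial
  induction hg using Subgroup.closure_induction with
  | mem _ h =>
    obtain ⟨x, rfl⟩ := h
    exact hgen x
  | one => exact one
  | mul a b _ _ ha hb => exact mul a b ha hb
  | inv a _ ha => exact inv a ha

/-- For `i = 0` this is not a defining relation: it comes from the one for `s_1` by writing `s_0 = ρ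
s_1 ρ⁻¹`, since `ρ` shifts all indices by one. -/
theorem ws_mul_wt (i : AffIdx n) (j : ZMod n) :
    w r (.s i) * w r (.t j) = w r (.t (Equiv.swap i.1 (i.1 + 1) j)) * w r (.s i) := by
  by_cases hi : i.1 = 0
  · have hi' : i.succ.1 ≠ 0 := by
      rw [AffIdx.succ_val, hi, zero_add]
      exact one_ne_zero_of_two_le i.2
    have h0 : w r (.s i) = w r .rho * w r (.s i.succ) * (w r .rho)⁻¹ := by
      rw [wrho_mul_ws, AffIdx.pred_succ, mul_inv_cancel_right]
    have h1 : ∀ k : ZMod n, (w r .rho)⁻¹ * w r (.t k) = w r (.t (k + 1)) * (w r .rho)⁻¹ := by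
      intro k
      rw [inv_mul_eq_iff_eq_mul, ← mul_assoc, wrho_mul_wt, mul_inv_cancel_right,
        add_sub_cancel_right]
    have h2 : w r (.s i.succ) * w r (.t (j + 1)) = _ := w_rel_mul (WRel.s_t i.succ hi' (j + 1))
    change _ = w r (.t _) * w r (.s _) at h2
    rw [h0, mul_assoc, h1, ← mul_assoc, mul_assoc _ _ (w r (.t (j + 1))), h2, ← mul_assoc,
      wrho_mul_wt]
    simp only [mul_assoc, AffIdx.succ_val]
    congr 3
    have := Equiv.swap_apply_apply (Equiv.addRight (1 : ZMod n)) i.1 (i.1 + 1)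
    have h3 := Equiv.congr_fun this (j + 1)
    simp only [Equiv.coe_addRight] at h3
    rw [h3]
    simp
  · exact w_rel_mul (WRel.s_t i hi j)

variable [NeZero n]

/-- The map to the model on generators. -/
noncomputable def toModelGen (r : ℕ) {n : ℕ} : WGen n → Model r n
  | .t j => SemidirectProduct.inl (torGen r j)
  | .rho => SemidirectProduct.inr (eρ n)
  | .s i => SemidirectProduct.inr (es i)

/-- The homomorphism from `Ŵ_{r,n}` to the model. -/
noncomputable def toModel (r n : ℕ) [NeZero n] : WGroup r n →* Model r n :=
  PresentedGroup.toGroup (f := toModelGen r) <| by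
    have hs := isAffineBraid_es.map (SemidirectProduct.inr : ExtAff n →* Model r n)
    rintro _ (⟨i⟩ | ⟨i, j, h, h'⟩ | ⟨i⟩ | ⟨h, i⟩ | ⟨i⟩ | ⟨i, j⟩ | ⟨i, hi, j⟩ | ⟨j⟩) <;>
      simp only [map_mul, map_pow, map_inv, FreeGroup.lift_apply_of, toModelGen, mul_inv_eq_one]
    · rw [sq, ← map_mul, es_mul_self, map_one]
    · exact hs.comm i j h h'
    · rw [← map_mul, eρ_mul_es, map_mul]
    · exact hs.braid h i
    · rw [← map_pow, torGen_pow, map_one]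
    · rw [← map_mul, mul_comm, map_mul]
    · rw [model_inr_mul_inl, torAct_torGen, extPerm_es]
    · rw [model_inr_mul_inl, torAct_torGen, extPerm_eρ, Equiv.subRight_apply]

theorem toModel_w (x : WGen n) : toModel r n (w r x) = toModelGen r x :=
  PresentedGroup.toGroup.of _

/-- The projection of `Ŵ_{r,n}` to the extended affine Weyl group. -/
noncomputable def wproj (r n : ℕ) [NeZero n] : WGroup r n →* ExtAff n :=
  SemidirectProduct.rightHom.comp (toModel r n)

@[simp] theorem wproj_t (j : ZMod n) : wproj r n (w r (.t j)) = 1 := by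
  simp [wproj, toModel_w, toModelGen]

@[simp] theorem wproj_s (i : AffIdx n) : wproj r n (w r (.s i)) = es i := by
  simp [wproj, toModel_w, toModelGen]

@[simp] theorem wproj_rho : wproj r n (w r .rho) = eρ n := by
  simp [wproj, toModel_w, toModelGen]

@[simp] theorem wproj_wsec (x : ExtAff n) : wproj r n (wsec r n x) = x := by
  have : (wproj r n).comp (wsec r n) = MonoidHom.id _ := extAff_hom_ext (by simp) (by simp)
  exact DFunLike.congr_fun this x

theorem wproj_of_mem_torus {x : WGroup r n} (hx : x ∈ torus r n) : wproj r n x = 1 := by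
  have : torus r n ≤ (wproj r n).ker := by
    rw [torus, Subgroup.closure_le]
    rintro _ ⟨j, rfl⟩
    exact wproj_t j
  exact this hx

/-- The action of `Ŵ_{r,n}` on residues modulo `n`. -/
noncomputable def wperm (r n : ℕ) [NeZero n] : WGroup r n →* Equiv.Perm (ZMod n) :=
  (extPerm n).comp (wproj r n)

theorem mul_wt (g : WGroup r n) (j : ZMod n) :
    g * w r (.t j) = w r (.t (wperm r n g j)) * g := by
  induction g using wgroup_induction generalizing j with
  | hgen x =>
    cases x with
    | t i => simp [wperm, wt_comm i j]
    | rho => simp [wperm, wrho_mul_wt]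
    | s i => simp [wperm, ws_mul_wt]
  | one => simp
  | mul a b ha hb => rw [mul_assoc, hb, ← mul_assoc, ha, mul_assoc, map_mul, Equiv.Perm.mul_apply]
  | inv a ha =>
    have := ha ((wperm r n a)⁻¹ j)
    rw [← Equiv.Perm.mul_apply, mul_inv_cancel, Equiv.Perm.one_apply] at this
    rw [map_inv, inv_mul_eq_iff_eq_mul, ← mul_assoc, this, mul_inv_cancel_right]

instance torus_normal : (torus r n).Normal := by
  refine ⟨fun x hx g => ?_⟩
  induction hx using Subgroup.closure_induction with
  | mem _ h =>
    obtain ⟨j, rfl⟩ := h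
    simp only [mul_wt, mul_inv_cancel_right]
    exact wt_mem_torus _
  | one => simp
  | mul a b _ _ ha hb =>
    have := mul_mem ha hb
    simpa [mul_assoc] using this
  | inv a _ ha =>
    have := inv_mem ha
    simpa [mul_assoc] using this

/-- Modulo the torus, projecting and then applying the section fixes every generator, hence every
element. -/
theorem exists_eq_mul_wsec (g : WGroup r n) :
    ∃ τ ∈ torus r n, g = τ * wsec r n (wproj r n g) := by
  have : (QuotientGroup.mk' (torus r n)).comp ((wsec r n).comp (wproj r n)) =
      QuotientGroup.mk' (torus r n) := by
    refine PresentedGroup.ext fun x => ?_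
    change QuotientGroup.mk' (torus r n) (wsec r n (wproj r n (w r x))) =
      QuotientGroup.mk' (torus r n) (w r x)
    cases x with
    | t j =>
      rw [wproj_t, map_one, map_one, eq_comm, QuotientGroup.mk'_apply, QuotientGroup.eq_one_iff]
      exact wt_mem_torus j
    | rho => simp
    | s i => simp
  have h := DFunLike.congr_fun this g
  refine ⟨g * (wsec r n (wproj r n g))⁻¹, ?_, by simp⟩
  rw [← QuotientGroup.eq_one_iff, QuotientGroup.mk_mul, QuotientGroup.mk_inv, mul_inv_eq_one]
  exact h.symm

theorem ker_wproj : (wproj r n).ker = torus r n := by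
  refine le_antisymm (fun g hg => ?_) fun g hg => wproj_of_mem_torus hg
  obtain ⟨τ, hτ, h⟩ := exists_eq_mul_wsec g
  rw [MonoidHom.mem_ker] at hg
  rw [hg, map_one, mul_one] at h
  rwa [h]

theorem wproj_surjective : Function.Surjective (wproj r n) := fun x => ⟨_, wproj_wsec x⟩

/-- The torus lies in the image of the finite group `(ℤ/r)^n`. -/
theorem torus_finite [NeZero r] : Finite (torus r n) := by
  have h : torus r n ≤ (torLift (r := r) (fun j : ZMod n => w r (.t j)) wt_pow wt_comm).range := by
    rw [torus, Subgroup.closure_le]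
    rintro _ ⟨j, rfl⟩
    exact ⟨torGen r j, torLift_torGen _ _ _ j⟩
  have : Finite (Multiplicative (ZMod r)) := inferInstanceAs (Finite (ZMod r))
  have : Finite (torLift (r := r) (fun j : ZMod n => w r (.t j)) wt_pow wt_comm).range :=
    Finite.of_surjective _ (MonoidHom.rangeRestrict_surjective _)
  exact Finite.of_injective _ (Subgroup.inclusion_injective h)

/-- The length function of `Ŵ_{r,n}`. -/
noncomputable def wlen (g : WGroup r n) : ℕ := elen (wproj r n g)

end Group

end AffineYokonuma

namespace AffineYokonuma

/-! ### The elements `e_i` in the group algebra -/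

section PowerSum

theorem sum_range_pow_mul_self {A : Type*} [Ring A] {r : ℕ} {x : A} (hx : x ^ r = 1) :
    (∑ s ∈ Finset.range r, x ^ s) * x = ∑ s ∈ Finset.range r, x ^ s := by
  have h := geom_sum_mul x r
  rw [hx, sub_self, mul_sub, mul_one, sub_eq_zero] at h
  exact h

/-- Since `x^r = 1`, one has `y^{r-1-s} = x^{s+1}`: reversing the sum over `y` gives the sum over
`x` multiplied by `x`, which is the same sum. -/
theorem sum_range_pow_of_mul_eq_one {A : Type*} [Ring A] {r : ℕ} {x y : A} (hx : x ^ r = 1)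
    (hxy : x * y = 1) (hyx : y * x = 1) :
    ∑ s ∈ Finset.range r, y ^ s = ∑ s ∈ Finset.range r, x ^ s := by
  rw [← sum_range_pow_mul_self hx, ← Finset.sum_range_reflect, Finset.sum_mul]
  refine Finset.sum_congr rfl fun s hs => ?_
  rw [Finset.mem_range] at hs
  have hc : Commute x y := hxy.trans hyx.symm
  have h1 : x ^ (s + 1) * y ^ (s + 1) = 1 := by rw [← hc.mul_pow, hxy, one_pow]
  have h2 : y ^ (r - 1 - s) * x ^ (r - 1 - s) = 1 := by rw [← hc.symm.mul_pow, hyx, one_pow]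
  rw [← pow_succ, ← mul_one (y ^ (r - 1 - s)), ← hx,
    show r = r - 1 - s + (s + 1) by omega, pow_add, ← mul_assoc,
    ← show r = r - 1 - s + (s + 1) by omega,
    h2, one_mul]

end PowerSum

variable {r n : ℕ}

/-- The group algebra of `Ŵ_{r,n}`. -/
abbrev WAlg (r n : ℕ) : Type := MonoidAlgebra (Ground r) (WGroup r n)

/-- A basis element of the group algebra of `Ŵ_{r,n}`. -/
noncomputable abbrev δ (g : WGroup r n) : WAlg r n := MonoidAlgebra.of (Ground r) (WGroup r n) g

section Idempotents

/-- The element `(1/r) ∑_{s=0}^{r-1} t_a^s t_b^{-s}` of the group algebra. -/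
noncomputable def idem (r : ℕ) {n : ℕ} (a b : ZMod n) : WAlg r n :=
  rInv r • ∑ s ∈ Finset.range r, δ ((w r (.t a) * (w r (.t b))⁻¹) ^ s)

theorem wt_mul_inv_pow (a b : ZMod n) (s : ℕ) :
    (w r (.t a) * (w r (.t b))⁻¹) ^ s = w r (.t a) ^ s * (w r (.t b) ^ s)⁻¹ := by
  have hc : Commute (w r (.t a)) (w r (.t b))⁻¹ := Commute.inv_right (wt_comm a b)
  rw [hc.mul_pow, inv_pow]

theorem wE_eq_idem (i : AffIdx n) : wE r i = idem r i.1 (i.1 + 1) := by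
  simp only [wE, idem, wt_mul_inv_pow]

theorem wt_mul_inv_pow_self (a b : ZMod n) : (w r (.t a) * (w r (.t b))⁻¹) ^ r = 1 := by
  rw [wt_mul_inv_pow, wt_pow, wt_pow, inv_one, mul_one]

theorem idem_comm (a b : ZMod n) : idem r a b = idem r b a := by
  simp only [idem, δ, map_pow]
  congr 1
  apply sum_range_pow_of_mul_eq_one
  · rw [← map_pow, wt_mul_inv_pow_self, map_one]
  · rw [← map_mul, ← map_one (MonoidAlgebra.of (Ground r) (WGroup r n))]
    congr 1
    group
  · rw [← map_mul, ← map_one (MonoidAlgebra.of (Ground r) (WGroup r n))]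
    congr 1
    group

/-- Averaging over the powers of `t_a t_b⁻¹` absorbs that element. -/
theorem idem_mul_δ_t (a b : ZMod n) :
    idem r a b * δ (w r (.t a)) = idem r a b * δ (w r (.t b)) := by
  have h : idem r a b * δ (w r (.t a) * (w r (.t b))⁻¹) = idem r a b := by
    simp only [idem, δ, map_pow, smul_mul_assoc]
    rw [sum_range_pow_mul_self]
    rw [← map_pow, wt_mul_inv_pow_self, map_one]
  nth_rw 2 [← h]
  rw [mul_assoc, ← map_mul, inv_mul_cancel_right]

theorem idem_mul_δ_t_swap (a b j : ZMod n) :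
    idem r a b * δ (w r (.t (Equiv.swap a b j))) = idem r a b * δ (w r (.t j)) := by
  rw [Equiv.swap_apply_def]
  split_ifs with h1 h2
  · rw [h1, idem_mul_δ_t]
  · rw [h2, idem_mul_δ_t]
  · rfl

theorem δ_mul_idem_of_mem_torus {τ : WGroup r n} (hτ : τ ∈ torus r n) (a b : ZMod n) :
    δ τ * idem r a b = idem r a b * δ τ := by
  simp only [idem, mul_smul_comm, smul_mul_assoc, Finset.mul_sum, Finset.sum_mul, δ, ← map_mul]
  congr 1
  refine Finset.sum_congr rfl fun s _ => ?_
  rw [torus_comm hτ]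
  exact pow_mem (mul_mem (wt_mem_torus a) (inv_mem (wt_mem_torus b))) s

theorem walg_hom_ext {N : Type*} [AddCommGroup N] [Module (Ground r) N]
    {A B : WAlg r n →ₗ[Ground r] N} (h : ∀ g, A (δ g) = B (δ g)) : A = B := by
  refine (MonoidAlgebra.basis (WGroup r n) (Ground r)).ext fun g => ?_
  simpa [MonoidAlgebra.basis_apply] using h g

theorem map_wE_mul (i : AffIdx n) (A : Module.End (Ground r) (WAlg r n))
    (hA : ∀ τ ∈ torus r n, ∀ m, A (δ τ * m) = δ τ * A m) (m : WAlg r n) :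
    A (wE r i * m) = wE r i * A m := by
  simp only [wE_eq_idem, idem, smul_mul_assoc, Finset.sum_mul, map_smul, map_sum]
  congr 1
  exact Finset.sum_congr rfl fun s _ =>
    hA _ (pow_mem (mul_mem (wt_mem_torus _) (inv_mem (wt_mem_torus _))) s) m

variable [NeZero n]

theorem δ_mul_idem (g : WGroup r n) (a b : ZMod n) :
    δ g * idem r a b = idem r (wperm r n g a) (wperm r n g b) * δ g := by
  simp only [idem, mul_smul_comm, smul_mul_assoc, Finset.mul_sum, Finset.sum_mul, δ, ← map_mul]
  congr 1
  refine Finset.sum_congr rfl fun s _ => ?_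
  have h : ∀ j, g * w r (.t j) * g⁻¹ = w r (.t (wperm r n g j)) := fun j => by
    rw [mul_wt, mul_inv_cancel_right]
  congr 1
  rw [← h, ← h, ← mul_inv_eq_iff_eq_mul, ← conj_pow]
  congr 1
  group

theorem wperm_ws (i : AffIdx n) : wperm r n (w r (.s i)) = Equiv.swap i.1 (i.1 + 1) := by
  simp [wperm]

theorem δ_ws_mul_wE (i : AffIdx n) : δ (w r (.s i)) * wE r i = wE r i * δ (w r (.s i)) := by
  rw [wE_eq_idem, δ_mul_idem, wperm_ws, Equiv.swap_apply_left, Equiv.swap_apply_right, idem_comm]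

/-- Conjugation by `s_i` only exchanges `t_i` and `t_{i+1}`, which `e_i` does not distinguish.
Commutativity of the torus passes this from generators to all elements. -/
theorem wE_mul_δ_conj (i : AffIdx n) {τ : WGroup r n} (hτ : τ ∈ torus r n) :
    wE r i * δ (w r (.s i) * τ * (w r (.s i))⁻¹) = wE r i * δ τ := by
  rw [wE_eq_idem]
  induction hτ using Subgroup.closure_induction with
  | mem _ h =>
    obtain ⟨j, rfl⟩ := h
    simp only [ws_mul_wt, mul_inv_cancel_right, idem_mul_δ_t_swap]
  | one => simp
  | mul a b ha hb iha ihb =>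
    have hb' : w r (.s i) * b * (w r (.s i))⁻¹ ∈ torus r n := torus_normal.conj_mem b hb _
    have : w r (.s i) * (a * b) * (w r (.s i))⁻¹ =
      w r (.s i) * a * (w r (.s i))⁻¹ * (w r (.s i) * b * (w r (.s i))⁻¹) := by group
    rw [this, δ, map_mul, ← mul_assoc, iha, mul_assoc, ← map_mul, torus_comm ha hb', map_mul,
      ← mul_assoc, ihb, mul_assoc, ← map_mul, torus_comm hb ha]
  | inv a ha ih =>
    have ha' : w r (.s i) * a * (w r (.s i))⁻¹ ∈ torus r n := torus_normal.conj_mem a ha _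
    have h1 : w r (.s i) * a⁻¹ * (w r (.s i))⁻¹ = (w r (.s i) * a * (w r (.s i))⁻¹)⁻¹ := by group
    rw [h1]
    generalize w r (.s i) * a * (w r (.s i))⁻¹ = b at ih ha'
    -- Multiplying by `a⁻¹ b⁻¹` turns the identity for `a` and its conjugate `b` into the one for
    -- their inverses.
    have := congrArg (fun x => x * δ (a⁻¹ * b⁻¹)) ih
    simp only [mul_assoc, δ, ← map_mul] at this
    rw [torus_comm (inv_mem ha) (inv_mem ha'), mul_inv_cancel_left, ← mul_assoc a,
      torus_comm ha (inv_mem ha'), mul_assoc, mul_inv_cancel, mul_one] at this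
    exact this.symm

/-- The permutation of `g` carries the pair `{j, j+1}` to `{i, i+1}`, so `e_j` becomes `e_i` on the
other side. With `τ` the torus part of `g`, the elements `s_i g` and `g s_j` differ by `(s_i τ
s_i⁻¹) τ⁻¹`, which `e_i` absorbs. -/
theorem δ_mul_wE_of_wproj_eq {i j : AffIdx n} {g : WGroup r n}
    (h : wproj r n (w r (.s i) * g) = wproj r n (g * w r (.s j))) :
    δ (w r (.s i) * g) * wE r j = wE r i * δ (g * w r (.s j)) := by
  have h1 : Equiv.swap i.1 (i.1 + 1) =
      Equiv.swap (wperm r n g j.1) (wperm r n g (j.1 + 1)) := by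
    have := congrArg (extPerm n) h
    simp only [map_mul, wproj_s, extPerm_es] at this
    rw [Equiv.mul_swap_eq_swap_mul, mul_left_inj] at this
    exact this
  have h2 : idem r (wperm r n (w r (.s i) * g) j.1) (wperm r n (w r (.s i) * g) (j.1 + 1)) =
      wE r i := by
    rw [map_mul, Equiv.Perm.mul_apply, Equiv.Perm.mul_apply, wperm_ws, wE_eq_idem]
    nth_rw 1 [h1]
    rw [h1, Equiv.swap_apply_left, Equiv.swap_apply_right]
    have hne : wperm r n g j.1 ≠ wperm r n g (j.1 + 1) :=
      fun h => j.add_one_ne ((wperm r n g).injective h).symm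
    have h3 : wperm r n g j.1 = i.1 ∨ wperm r n g j.1 = i.1 + 1 := by
      by_contra h
      rw [not_or] at h
      have := Equiv.swap_apply_of_ne_of_ne h.1 h.2
      rw [h1, Equiv.swap_apply_left] at this
      exact hne this.symm
    -- The pair may be carried over in either order; `idem_comm` makes this harmless.
    obtain h3 | h3 := h3
    · have h4 := Equiv.swap_apply_left i.1 (i.1 + 1)
      nth_rw 1 [h1] at h4
      rw [← h3, Equiv.swap_apply_left] at h4
      rw [h4, h3, idem_comm]
    · have h4 := Equiv.swap_apply_right i.1 (i.1 + 1)
      nth_rw 1 [h1] at h4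
      rw [← h3, Equiv.swap_apply_left] at h4
      rw [h4, h3]
  obtain ⟨τ, hτ, hg⟩ := exists_eq_mul_wsec g
  have h3 : w r (.s i) * g = (w r (.s i) * τ * (w r (.s i))⁻¹) * (τ⁻¹ * (g * w r (.s j))) := by
    have := congrArg (wsec r n) h
    simp only [map_mul, wproj_s, wsec_es] at this
    rw [show τ⁻¹ * (g * w r (.s j)) = w r (.s i) * wsec r n (wproj r n g) by
      rw [this, ← mul_assoc]
      congr 1
      rw [inv_mul_eq_iff_eq_mul]
      exact hg]
    nth_rw 1 [hg]
    group
  rw [wE_eq_idem j, δ_mul_idem, h2, h3, δ, map_mul, ← mul_assoc, wE_mul_δ_conj i hτ, mul_assoc,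
    ← map_mul,
    mul_inv_cancel_left]

end Idempotents

end AffineYokonuma

namespace AffineYokonuma

variable {r n : ℕ} [NeZero n]

/-! ### Lengths, and the left and right multiplication operators -/

section Length

theorem wlen_mul_of_mem_torus {τ : WGroup r n} (hτ : τ ∈ torus r n) (g : WGroup r n) :
    wlen (τ * g) = wlen g := by
  rw [wlen, map_mul, wproj_of_mem_torus hτ, one_mul, wlen]

theorem wlen_of_mem_torus_mul {τ : WGroup r n} (hτ : τ ∈ torus r n) (g : WGroup r n) :
    wlen (g * τ) = wlen g := by
  rw [wlen, map_mul, wproj_of_mem_torus hτ, mul_one, wlen]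

theorem wlen_rho_mul (g : WGroup r n) : wlen (w r .rho * g) = wlen g := by
  rw [wlen, map_mul, wproj_rho, elen_eρ_mul, wlen]

theorem wlen_mul_rho (g : WGroup r n) : wlen (g * w r .rho) = wlen g := by
  rw [wlen, map_mul, wproj_rho, elen_mul_eρ, wlen]

theorem wlen_mul_rho_inv (g : WGroup r n) : wlen (g * (w r .rho)⁻¹) = wlen g := by
  rw [← wlen_mul_rho (g * (w r .rho)⁻¹), inv_mul_cancel_right]

theorem wlen_ws_mul (i : AffIdx n) (g : WGroup r n) :
    wlen (w r (.s i) * g) = wlen g + 1 ∨ wlen (w r (.s i) * g) + 1 = wlen g := by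
  simpa [wlen] using elen_es_mul i (wproj r n g)

theorem wlen_mul_ws (g : WGroup r n) (i : AffIdx n) :
    wlen (g * w r (.s i)) = wlen g + 1 ∨ wlen (g * w r (.s i)) + 1 = wlen g := by
  simpa [wlen] using elen_mul_es (wproj r n g) i

theorem wlen_wsec_inl (x : Cox n) :
    wlen (wsec r n (SemidirectProduct.inl x)) = (cox n).length x := by
  rw [wlen, wproj_wsec, elen, SemidirectProduct.left_inl]

theorem wlen_one : wlen (1 : WGroup r n) = 0 := by
  rw [wlen, map_one, elen_one]

/-- A right unit of length zero: an element of the torus or `ρ^{±1}`. -/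
def IsLengthZeroGen (u : WGroup r n) : Prop :=
  u ∈ torus r n ∨ u = w r .rho ∨ u = (w r .rho)⁻¹

theorem wlen_mul_of_isLengthZeroGen {u : WGroup r n} (hu : IsLengthZeroGen u) (g : WGroup r n) :
    wlen (g * u) = wlen g := by
  obtain hu | rfl | rfl := hu
  · exact wlen_of_mem_torus_mul hu g
  · exact wlen_mul_rho g
  · exact wlen_mul_rho_inv g

end Length

section Operators

open Classical in
/-- Left multiplication by `T_{s_i}` in the Iwahori–Matsumoto basis. -/
noncomputable def leftOp (r : ℕ) (i : AffIdx n) : Module.End (Ground r) (WAlg r n) :=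
  (MonoidAlgebra.basis (WGroup r n) (Ground r)).constr (Ground r) fun g =>
    δ (w r (.s i) * g) +
      if wlen (w r (.s i) * g) < wlen g then (q r - qInv r) • (wE r i * δ g) else 0

open Classical in
/-- Right multiplication by `T_{s_j}` in the Iwahori–Matsumoto basis. -/
noncomputable def rightOp (r : ℕ) (j : AffIdx n) : Module.End (Ground r) (WAlg r n) :=
  (MonoidAlgebra.basis (WGroup r n) (Ground r)).constr (Ground r) fun g =>
    δ (g * w r (.s j)) +
      if wlen (g * w r (.s j)) < wlen g then (q r - qInv r) • (δ g * wE r j) else 0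

open Classical in
theorem leftOp_δ (i : AffIdx n) (g : WGroup r n) : leftOp r i (δ g) =
    δ (w r (.s i) * g) +
      if wlen (w r (.s i) * g) < wlen g then (q r - qInv r) • (wE r i * δ g) else 0 := by
  rw [leftOp, δ, MonoidAlgebra.of_apply, ← MonoidAlgebra.basis_apply, Module.Basis.constr_basis,
    MonoidAlgebra.basis_apply, ← MonoidAlgebra.of_apply]

open Classical in
theorem rightOp_δ (j : AffIdx n) (g : WGroup r n) : rightOp r j (δ g) =
    δ (g * w r (.s j)) +
      if wlen (g * w r (.s j)) < wlen g then (q r - qInv r) • (δ g * wE r j) else 0 := by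
  rw [rightOp, δ, MonoidAlgebra.of_apply, ← MonoidAlgebra.basis_apply, Module.Basis.constr_basis,
    MonoidAlgebra.basis_apply, ← MonoidAlgebra.of_apply]

theorem leftOp_δ_of_lt {i : AffIdx n} {g : WGroup r n} (h : wlen g < wlen (w r (.s i) * g)) :
    leftOp r i (δ g) = δ (w r (.s i) * g) := by
  rw [leftOp_δ, if_neg (not_lt.2 h.le), add_zero]

theorem rightOp_δ_of_lt {j : AffIdx n} {g : WGroup r n} (h : wlen g < wlen (g * w r (.s j))) :
    rightOp r j (δ g) = δ (g * w r (.s j)) := by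
  rw [rightOp_δ, if_neg (not_lt.2 h.le), add_zero]

/-- Right multiplication by `u` changes no length, so both sides take the same branch. -/
theorem leftOp_mul_δ (i : AffIdx n) {u : WGroup r n} (hu : IsLengthZeroGen u) (m : WAlg r n) :
    leftOp r i (m * δ u) = leftOp r i m * δ u := by
  suffices leftOp r i ∘ₗ LinearMap.mulRight (Ground r) (δ u) =
      LinearMap.mulRight (Ground r) (δ u) ∘ₗ leftOp r i from DFunLike.congr_fun this m
  refine walg_hom_ext fun g => ?_
  simp only [LinearMap.comp_apply, LinearMap.mulRight_apply]
  rw [← map_mul, leftOp_δ, leftOp_δ, add_mul, ite_mul, zero_mul, smul_mul_assoc, mul_assoc (wE r i),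
    ← map_mul, ← map_mul, ← mul_assoc, wlen_mul_of_isLengthZeroGen hu,
    wlen_mul_of_isLengthZeroGen hu]

theorem rightOp_δ_mul (j : AffIdx n) {τ : WGroup r n} (hτ : τ ∈ torus r n) (m : WAlg r n) :
    rightOp r j (δ τ * m) = δ τ * rightOp r j m := by
  suffices rightOp r j ∘ₗ LinearMap.mulLeft (Ground r) (δ τ) =
      LinearMap.mulLeft (Ground r) (δ τ) ∘ₗ rightOp r j from DFunLike.congr_fun this m
  refine walg_hom_ext fun g => ?_
  simp only [LinearMap.comp_apply, LinearMap.mulLeft_apply]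
  rw [← map_mul, rightOp_δ, rightOp_δ, mul_add, mul_ite, mul_zero, mul_smul_comm, ← mul_assoc,
    ← map_mul, ← map_mul, mul_assoc τ, wlen_mul_of_mem_torus hτ, wlen_mul_of_mem_torus hτ]

/-- The main term is conjugated by `s_i`. The correction term carries `τ` itself, but there `e_i`
lets `τ` be replaced by its conjugate. -/
theorem leftOp_δ_mul (i : AffIdx n) {τ : WGroup r n} (hτ : τ ∈ torus r n) (m : WAlg r n) :
    leftOp r i (δ τ * m) = δ (w r (.s i) * τ * (w r (.s i))⁻¹) * leftOp r i m := by
  suffices leftOp r i ∘ₗ LinearMap.mulLeft (Ground r) (δ τ) =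
      LinearMap.mulLeft (Ground r) (δ (w r (.s i) * τ * (w r (.s i))⁻¹)) ∘ₗ leftOp r i from
    DFunLike.congr_fun this m
  refine walg_hom_ext fun g => ?_
  have hτ' : w r (.s i) * τ * (w r (.s i))⁻¹ ∈ torus r n := torus_normal.conj_mem τ hτ _
  simp only [LinearMap.comp_apply, LinearMap.mulLeft_apply]
  have h1 : w r (.s i) * (τ * g) = w r (.s i) * τ * (w r (.s i))⁻¹ * (w r (.s i) * g) := by group
  rw [← map_mul, leftOp_δ, leftOp_δ, h1, mul_add, mul_ite, mul_zero, mul_smul_comm, ← map_mul,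
    ← mul_assoc (δ _) (wE r i), wlen_mul_of_mem_torus hτ', wlen_mul_of_mem_torus hτ]
  rw [wE_eq_idem, δ_mul_idem_of_mem_torus hτ', ← wE_eq_idem, wE_mul_δ_conj i hτ, mul_assoc (wE r i),
    ← map_mul]

theorem rightOp_wE_mul (i j : AffIdx n) (m : WAlg r n) :
    rightOp r j (wE r i * m) = wE r i * rightOp r j m :=
  map_wE_mul i _ (fun _ hτ => rightOp_δ_mul j hτ) m

theorem leftOp_mul_wE (i j : AffIdx n) (m : WAlg r n) :
    leftOp r i (m * wE r j) = leftOp r i m * wE r j := by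
  simp only [wE_eq_idem, idem, mul_smul_comm, Finset.mul_sum, map_smul, map_sum]
  congr 1
  exact Finset.sum_congr rfl fun s _ => leftOp_mul_δ i
    (.inl (pow_mem (mul_mem (wt_mem_torus _) (inv_mem (wt_mem_torus _))) s)) m

/-- The operator conjugates each summand of `e_i` by `s_i`; the sum as a whole is invariant, by
`δ_ws_mul_wE`. -/
theorem leftOp_wE_mul (i : AffIdx n) (m : WAlg r n) :
    leftOp r i (wE r i * m) = wE r i * leftOp r i m := by
  have h := δ_ws_mul_wE (r := r) i
  simp only [wE_eq_idem, idem, smul_mul_assoc, Finset.sum_mul, map_smul, map_sum,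
    mul_smul_comm, Finset.mul_sum] at h ⊢
  have h2 := congrArg (fun x => x * δ (w r (.s i))⁻¹ * leftOp r i m) h
  simp only [smul_mul_assoc, Finset.sum_mul, ← map_mul, mul_inv_cancel_right] at h2
  rw [← h2]
  congr 1
  exact Finset.sum_congr rfl fun s _ => leftOp_δ_mul i
    (pow_mem (mul_mem (wt_mem_torus _) (inv_mem (wt_mem_torus _))) s) m

/-- Associativity of the future product in the form `(T_s T_g) T_{s'} = T_s (T_g T_{s'})`. Both
sides are expanded at a group element, and the only question is which correction terms appear. -/
theorem leftOp_rightOp_comm (i j : AffIdx n) (m : WAlg r n) :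
    leftOp r i (rightOp r j m) = rightOp r j (leftOp r i m) := by
  suffices leftOp r i ∘ₗ rightOp r j = rightOp r j ∘ₗ leftOp r i from DFunLike.congr_fun this m
  refine walg_hom_ext fun g => ?_
  have hL : leftOp r i (rightOp r j (δ g)) = leftOp r i (δ (g * w r (.s j))) +
      if wlen (g * w r (.s j)) < wlen g then
        (q r - qInv r) • (leftOp r i (δ g) * wE r j) else 0 := by
    rw [rightOp_δ, map_add, apply_ite (leftOp r i), map_zero, map_smul, leftOp_mul_wE]
  have hR : rightOp r j (leftOp r i (δ g)) = rightOp r j (δ (w r (.s i) * g)) +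
      if wlen (w r (.s i) * g) < wlen g then
        (q r - qInv r) • (wE r i * rightOp r j (δ g)) else 0 := by
    rw [leftOp_δ, map_add, apply_ite (rightOp r j), map_zero, map_smul, rightOp_wE_mul]
  simp only [LinearMap.comp_apply]
  rw [hL, hR, leftOp_δ, rightOp_δ, leftOp_δ, rightOp_δ, ← mul_assoc]
  -- In the degenerate case `s_i g s_j` has the length of `g`, and left and right corrections appear
  -- together. They match by `δ_mul_wE_of_wproj_eq`.
  by_cases h : wproj r n (w r (.s i) * g) = wproj r n (g * w r (.s j))
  · have key := δ_mul_wE_of_wproj_eq h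
    have hlen : wlen (w r (.s i) * g) = wlen (g * w r (.s j)) := by rw [wlen, h, wlen]
    have hlen' : wlen (w r (.s i) * g * w r (.s j)) = wlen g := by
      rw [wlen, map_mul, h, ← map_mul, mul_assoc, ws_mul_self, mul_one, wlen]
    rw [hlen', hlen]
    by_cases hd : wlen (g * w r (.s j)) < wlen g
    · simp only [if_pos hd, if_neg hd.asymm, add_zero, add_mul, mul_add, smul_add, key,
        smul_mul_assoc,
        mul_smul_comm, mul_assoc]
    · have hd' : wlen g < wlen (g * w r (.s j)) := by
        have := wlen_mul_ws g j
        omega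
      simp only [if_neg hd, if_pos hd', add_zero, key]
  -- Otherwise multiplying on one side does not affect descents on the other, so the expansions
  -- agree term by term.
  · have := elen_es_mul_mul_es (i := i) (j := j) (x := wproj r n g) (by simpa using h)
    have h1 : wlen (w r (.s i) * g * w r (.s j)) < wlen (w r (.s i) * g) ↔
        wlen (g * w r (.s j)) < wlen g := by simpa [wlen] using this.1
    have h2 : wlen (w r (.s i) * g * w r (.s j)) < wlen (g * w r (.s j)) ↔
        wlen (w r (.s i) * g) < wlen g := by simpa [wlen] using this.2
    simp only [h1, h2]
    split_ifs <;> (simp only [add_mul, mul_add, smul_add, add_zero, smul_mul_assoc, mul_smul_comm,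
      map_mul, mul_assoc]; try abel)

end Operators

/-! ### Operators determined by their value at the identity -/

section Centralizer

/-- The endomorphisms that commute with the right operators. -/
structure CommutesRight (A : Module.End (Ground r) (WAlg r n)) : Prop where
  rightOp_comm : ∀ j m, A (rightOp r j m) = rightOp r j (A m)
  mul_δ : ∀ u, IsLengthZeroGen u → ∀ m, A (m * δ u) = A m * δ u

theorem commutesRight_leftOp (i : AffIdx n) : CommutesRight (leftOp r i) where
  rightOp_comm j m := leftOp_rightOp_comm i j m
  mul_δ _ hu m := leftOp_mul_δ i hu m

theorem CommutesRight.mul {A B : Module.End (Ground r) (WAlg r n)} (hA : CommutesRight A)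
    (hB : CommutesRight B) : CommutesRight (A * B) where
  rightOp_comm j m := by
    rw [Module.End.mul_apply, hB.rightOp_comm, hA.rightOp_comm, Module.End.mul_apply]
  mul_δ u hu m := by
    rw [Module.End.mul_apply, hB.mul_δ u hu, hA.mul_δ u hu, Module.End.mul_apply]

/-- Every basis vector is reached from `δ 1` by right operators along a reduced word, followed by
right multiplications by powers of `ρ` and torus elements. -/
theorem CommutesRight.ext {A B : Module.End (Ground r) (WAlg r n)} (hA : CommutesRight A)
    (hB : CommutesRight B) (h : A (δ 1) = B (δ 1)) : A = B := by
  have hx : ∀ (k : ℕ) (x : Cox n), (cox n).length x = k →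
      A (δ (wsec r n (SemidirectProduct.inl x))) = B (δ (wsec r n (SemidirectProduct.inl x))) := by
    intro k
    induction k with
    | zero =>
      intro x hx
      rw [CoxeterSystem.length_eq_zero_iff] at hx
      rw [hx, map_one, map_one, h]
    | succ k ih =>
      intro x hx
      have hne : x ≠ 1 := by
        rintro rfl
        simp at hx
      -- Removing a right descent makes the right operator act in its length-increasing branch,
      -- where it is plain multiplication.
      obtain ⟨i, hi⟩ := (cox n).exists_rightDescent_of_ne_one hne
      rw [CoxeterSystem.isRightDescent_iff] at hi
      have hx' : wsec r n (SemidirectProduct.inl x) =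
          wsec r n (SemidirectProduct.inl (x * (cox n).simple i)) * w r (.s i) := by
        rw [← wsec_es, ← map_mul, es, ← map_mul, CoxeterSystem.simple_mul_simple_cancel_right]
      have : rightOp r i (δ (wsec r n (SemidirectProduct.inl (x * (cox n).simple i)))) =
          δ (wsec r n (SemidirectProduct.inl x)) := by
        rw [rightOp_δ_of_lt, ← hx']
        rw [← hx', wlen_wsec_inl, wlen_wsec_inl]
        omega
      rw [← this, hA.rightOp_comm, hB.rightOp_comm, ih _ (by omega)]
  have hk : ∀ (k : ℤ) (g : WGroup r n), A (δ g) = B (δ g) →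
      A (δ (g * w r .rho ^ k)) = B (δ (g * w r .rho ^ k)) := by
    intro k g hg
    induction k using Int.induction_on with
    | zero => simpa using hg
    | succ k ih =>
      rw [zpow_add_one, ← mul_assoc, δ, map_mul, hA.mul_δ _ (.inr (.inl rfl)),
        hB.mul_δ _ (.inr (.inl rfl)), ih]
    | pred k ih =>
      rw [zpow_sub_one, ← mul_assoc, δ, map_mul, hA.mul_δ _ (.inr (.inr rfl)),
        hB.mul_δ _ (.inr (.inr rfl)), ih]
  refine walg_hom_ext fun g => ?_
  obtain ⟨τ, hτ, hg⟩ := exists_eq_mul_wsec g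
  set y := wproj r n g
  have hy : wsec r n y = wsec r n (SemidirectProduct.inl y.left) * w r .rho ^ y.right.toAdd := by
    rw [← wsec_eρ, ← map_zpow, eρ_zpow, ← map_mul, ofAdd_toAdd,
      SemidirectProduct.inl_left_mul_inr_right]
  -- The torus factor is moved to the far right, since compatibility is available only for right
  -- multiplication.
  have hτ' : (wsec r n y)⁻¹ * τ * (wsec r n y)⁻¹⁻¹ ∈ torus r n := torus_normal.conj_mem τ hτ _
  rw [show g = wsec r n y * ((wsec r n y)⁻¹ * τ * (wsec r n y)⁻¹⁻¹) by rw [hg]; group, δ, map_mul,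
    hA.mul_δ _ (.inl hτ'), hB.mul_δ _ (.inl hτ'), hy, hk _ _ (hx _ _ rfl)]

end Centralizer

end AffineYokonuma

namespace AffineYokonuma

variable {r n : ℕ}

/-! ### Relations of the Iwahori–Matsumoto algebra and its regular representation -/

section Relations

theorem h_rel {a b : HFree r n} (hab : HRel r n a b) :
    RingQuot.mkAlgHom (Ground r) (HRel r n) a = RingQuot.mkAlgHom (Ground r) (HRel r n) b :=
  RingQuot.mkAlgHom_rel (Ground r) hab

theorem mkAlgHom_hf (x : HGen n) :
    RingQuot.mkAlgHom (Ground r) (HRel r n) (hf r x) = h r x := rfl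

/-- The element `e_i` of `Ĥ_{r,n}`. -/
noncomputable def hIdem (r : ℕ) {n : ℕ} (i : AffIdx n) : HAlg r n :=
  rInv r • ∑ s ∈ Finset.range r, h r (.t i.1) ^ s * h r (.t (i.1 + 1)) ^ (r - s)

theorem mkAlgHom_hE (i : AffIdx n) :
    RingQuot.mkAlgHom (Ground r) (HRel r n) (hE r i) = hIdem r i := by
  simp only [hE, hIdem, map_smul, map_sum, map_mul, map_pow, h]

theorem ht_pow (j : ZMod n) : h r (.t j) ^ r = 1 := by
  simpa only [map_pow, map_one, mkAlgHom_hf] using h_rel (r := r) (HRel.t_pow j)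

theorem ht_comm (i j : ZMod n) : h r (.t i) * h r (.t j) = h r (.t j) * h r (.t i) := by
  simpa only [map_mul, mkAlgHom_hf] using h_rel (r := r) (HRel.t_comm i j)

theorem hrho_mul_ht (j : ZMod n) : h r .rho * h r (.t j) = h r (.t (j - 1)) * h r .rho := by
  simpa only [map_mul, mkAlgHom_hf] using h_rel (r := r) (HRel.rho_t j)

theorem hrho_mul_hs (i : AffIdx n) : h r .rho * h r (.s i) = h r (.s i.pred) * h r .rho := by
  simpa only [map_mul, mkAlgHom_hf] using h_rel (r := r) (HRel.rho_s i)

theorem isAffineBraid_hs : IsAffineBraid fun i : AffIdx n => h r (.s i) where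
  comm i j h h' := by simpa only [map_mul, mkAlgHom_hf] using h_rel (r := r) (HRel.s_comm i j h h')
  braid hn i := by simpa only [map_mul, mkAlgHom_hf] using h_rel (r := r) (HRel.s_braid hn i)

theorem hs_mul_self (i : AffIdx n) :
    h r (.s i) * h r (.s i) = 1 + (q r - qInv r) • (hIdem r i * h r (.s i)) := by
  have := h_rel (r := r) (HRel.s_sq i)
  rwa [map_pow, map_add, map_smul, map_mul, mkAlgHom_hE, sq, map_one] at this

@[simp] theorem val_hRho : ((hRho r n : (HAlg r n)ˣ) : HAlg r n) = h r .rho := rfl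

theorem val_inv_hRho : (((hRho r n)⁻¹ : (HAlg r n)ˣ) : HAlg r n) = h r .rhoInv := rfl

/-- As in the group: for `i = 0` the relation for `s_1` is multiplied by `T_ρ` on the left, shifted,
and `T_ρ` is cancelled on the right. -/
theorem hs_mul_ht (i : AffIdx n) (j : ZMod n) :
    h r (.s i) * h r (.t j) = h r (.t (Equiv.swap i.1 (i.1 + 1) j)) * h r (.s i) := by
  by_cases hi : i.1 = 0
  · have hi' : i.succ.1 ≠ 0 := by
      rw [AffIdx.succ_val, hi, zero_add]
      exact one_ne_zero_of_two_le i.2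
    have h2 : h r (.s i.succ) * h r (.t (j + 1)) =
        h r (.t (Equiv.swap (i.1 + 1) (i.1 + 1 + 1) (j + 1))) * h r (.s i.succ) := by
      simpa only [map_mul, mkAlgHom_hf, AffIdx.succ_val] using
        h_rel (r := r) (HRel.s_t i.succ hi' (j + 1))
    have h3 : Equiv.swap (i.1 + 1) (i.1 + 1 + 1) (j + 1) = Equiv.swap i.1 (i.1 + 1) j + 1 := by
      have := Equiv.congr_fun (Equiv.swap_apply_apply (Equiv.addRight (1 : ZMod n)) i.1 (i.1 + 1))
        (j + 1)
      simp only [Equiv.coe_addRight] at this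
      rw [this]
      simp
    rw [h3] at h2
    have h4 := congrArg (h r .rho * ·) h2
    simp only [← mul_assoc, hrho_mul_hs, hrho_mul_ht, AffIdx.pred_succ, add_sub_cancel_right] at h4
    rw [mul_assoc, hrho_mul_ht, mul_assoc _ (h r .rho), hrho_mul_hs, AffIdx.pred_succ,
      add_sub_cancel_right, ← mul_assoc, ← mul_assoc] at h4
    exact (hRho r n).isUnit.mul_right_cancel h4
  · simpa only [map_mul, mkAlgHom_hf] using h_rel (r := r) (HRel.s_t i hi j)

theorem halg_induction {p : HAlg r n → Prop} (a : HAlg r n) (gen : ∀ x, p (h r x))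
    (scalar : ∀ c, p (algebraMap (Ground r) _ c)) (mul : ∀ a b, p a → p b → p (a * b))
    (add : ∀ a b, p a → p b → p (a + b)) : p a := by
  obtain ⟨x, rfl⟩ := RingQuot.mkAlgHom_surjective (Ground r) (HRel r n) a
  induction x using FreeAlgebra.induction with
  | grade0 c => simpa only [AlgHom.commutes] using scalar c
  | grade1 x => exact gen x
  | mul a b ha hb => simpa only [map_mul] using mul _ _ ha hb
  | add a b ha hb => simpa only [map_add] using add _ _ ha hb

end Relations

section Action

theorem lmul_δ_mul (g g' : WGroup r n) : Algebra.lmul (Ground r) (WAlg r n) (δ (g * g')) =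
    Algebra.lmul (Ground r) (WAlg r n) (δ g) * Algebra.lmul (Ground r) (WAlg r n) (δ g') := by
  rw [δ, map_mul, map_mul]

theorem lmul_δ_one : Algebra.lmul (Ground r) (WAlg r n) (δ 1) = 1 := by
  rw [δ, map_one, map_one]

theorem lmul_δ_apply (g : WGroup r n) (m : WAlg r n) :
    Algebra.lmul (Ground r) (WAlg r n) (δ g) m = δ g * m := rfl

theorem wE_eq_sum (i : AffIdx n) : wE r i =
    rInv r • ∑ s ∈ Finset.range r, δ (w r (.t i.1)) ^ s * δ (w r (.t (i.1 + 1))) ^ (r - s) := by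
  rw [wE]
  congr 1
  refine Finset.sum_congr rfl fun s hs => ?_
  rw [← map_pow, ← map_pow, ← map_mul]
  congr 2
  rw [inv_eq_iff_mul_eq_one, ← pow_add, Nat.add_sub_cancel' (Finset.mem_range.1 hs).le, wt_pow]

variable [NeZero n]

/-- The images of the generators of `Ĥ_{r,n}` in its regular representation. -/
noncomputable def actGen (r : ℕ) {n : ℕ} [NeZero n] : HGen n → Module.End (Ground r) (WAlg r n)
  | .t j => Algebra.lmul (Ground r) (WAlg r n) (δ (w r (.t j)))
  | .s i => leftOp r i
  | .rho => Algebra.lmul (Ground r) (WAlg r n) (δ (w r .rho))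
  | .rhoInv => Algebra.lmul (Ground r) (WAlg r n) (δ (w r .rho)⁻¹)

/-- Of `g` and `s_i g` exactly one is shortened by `s_i`, so the correction term enters once from a
longer element and the rest is `s_i² = 1`. -/
theorem leftOp_leftOp (i : AffIdx n) (m : WAlg r n) :
    leftOp r i (leftOp r i m) = m + (q r - qInv r) • (wE r i * leftOp r i m) := by
  classical
  suffices leftOp r i ∘ₗ leftOp r i = LinearMap.id + (q r - qInv r) •
      (LinearMap.mulLeft (Ground r) (wE r i) ∘ₗ leftOp r i) from DFunLike.congr_fun this m
  refine walg_hom_ext fun g => ?_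
  simp only [LinearMap.comp_apply, LinearMap.add_apply, LinearMap.smul_apply, LinearMap.id_apply,
    LinearMap.mulLeft_apply]
  have hcancel : w r (.s i) * (w r (.s i) * g) = g := by rw [← mul_assoc, ws_mul_self, one_mul]
  obtain hl | hl := wlen_ws_mul i g
  · rw [leftOp_δ_of_lt (by omega), leftOp_δ, hcancel, if_pos (by omega)]
  · conv_lhs => rw [leftOp_δ]
    rw [if_pos (by omega), map_add, map_smul, leftOp_wE_mul,
      leftOp_δ_of_lt (by rw [hcancel]; omega),
      hcancel]

theorem leftOp_braid_one {i j : AffIdx n} (h2 : affineA n i j = 3) :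
    leftOp r i (leftOp r j (leftOp r i (δ 1))) = δ (w r (.s i) * w r (.s j) * w r (.s i)) := by
  have hne : (cox n).simple i ≠ (cox n).simple j := fun h => cox_simple_mul_ne h2 (by rw [h])
  have h3 := (cox n).isReduced_triple hne (cox_simple_mul_ne h2)
  have h4 := (cox n).isReduced_pair hne.symm
  simp only [CoxeterSystem.IsReduced, CoxeterSystem.wordProd_cons, CoxeterSystem.wordProd_nil,
    mul_one, List.length_cons, List.length_nil] at h3 h4
  have e1 : wlen (w r (.s i)) = 1 := by
    rw [wlen, wproj_s, elen, es, SemidirectProduct.left_inl, CoxeterSystem.length_simple]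
  have e2 : wlen (w r (.s j) * w r (.s i)) = 2 := by
    rw [wlen, map_mul, wproj_s, wproj_s, elen, es, es, ← map_mul, SemidirectProduct.left_inl, h4]
  have e3 : wlen (w r (.s i) * (w r (.s j) * w r (.s i))) = 3 := by
    rw [wlen, map_mul, map_mul, wproj_s, wproj_s, elen, es, es, ← map_mul, ← map_mul,
      SemidirectProduct.left_inl, h3]
  rw [leftOp_δ_of_lt (by rw [mul_one, wlen_one, e1]; omega), mul_one,
    leftOp_δ_of_lt (by rw [e1, e2]; omega), leftOp_δ_of_lt (by rw [e2, e3]; omega), mul_assoc]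

theorem leftOp_comm_one {i j : AffIdx n} (h2 : i ≠ j) :
    leftOp r i (leftOp r j (δ 1)) = δ (w r (.s i) * w r (.s j)) := by
  have hne : (cox n).simple i ≠ (cox n).simple j := fun h => h2 (cox_simple_injective h)
  have h4 := (cox n).isReduced_pair hne
  simp only [CoxeterSystem.IsReduced, CoxeterSystem.wordProd_cons, CoxeterSystem.wordProd_nil,
    mul_one, List.length_cons, List.length_nil] at h4
  have e1 : wlen (w r (.s j)) = 1 := by
    rw [wlen, wproj_s, elen, es, SemidirectProduct.left_inl, CoxeterSystem.length_simple]
  have e2 : wlen (w r (.s i) * w r (.s j)) = 2 := by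
    rw [wlen, map_mul, wproj_s, wproj_s, elen, es, es, ← map_mul, SemidirectProduct.left_inl, h4]
  rw [leftOp_δ_of_lt (by rw [mul_one, wlen_one, e1]; omega), mul_one,
    leftOp_δ_of_lt (by rw [e1, e2]; omega)]

/-- By `CommutesRight.ext` it suffices to evaluate at `δ 1`. The words there are reduced, so no
correction appears and the relation is the one in the group. -/
theorem isAffineBraid_leftOp : IsAffineBraid fun i : AffIdx n => leftOp r i where
  comm i j h h' := by
    by_cases hij : i = j
    · rw [hij]
    refine ((commutesRight_leftOp i).mul (commutesRight_leftOp j)).ext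
      ((commutesRight_leftOp j).mul (commutesRight_leftOp i)) ?_
    rw [Module.End.mul_apply, Module.End.mul_apply, leftOp_comm_one hij,
      leftOp_comm_one (Ne.symm hij), isAffineBraid_ws.comm i j h h']
  braid hn i := by
    refine (((commutesRight_leftOp i).mul (commutesRight_leftOp i.succ)).mul
      (commutesRight_leftOp i)).ext (((commutesRight_leftOp i.succ).mul
      (commutesRight_leftOp i)).mul (commutesRight_leftOp i.succ)) ?_
    have hm := affineA_succ hn i
    simp only [Module.End.mul_apply]
    rw [leftOp_braid_one hm, leftOp_braid_one (by rw [← hm]; exact (affineA n).symmetric _ _),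
      isAffineBraid_ws.braid hn i]

theorem leftOp_mul_lmul (i : AffIdx n) (j : ZMod n) :
    leftOp r i * Algebra.lmul (Ground r) (WAlg r n) (δ (w r (.t j))) =
      Algebra.lmul (Ground r) (WAlg r n) (δ (w r (.t (Equiv.swap i.1 (i.1 + 1) j)))) *
        leftOp r i := by
  refine LinearMap.ext fun m => ?_
  rw [Module.End.mul_apply, Module.End.mul_apply, lmul_δ_apply, lmul_δ_apply,
    leftOp_δ_mul i (wt_mem_torus j), ws_mul_wt, mul_inv_cancel_right]

/-- Left multiplication by `ρ` preserves length and carries `e_i` to `e_{i-1}`. -/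
theorem lmul_rho_mul_leftOp (i : AffIdx n) :
    Algebra.lmul (Ground r) (WAlg r n) (δ (w r .rho)) * leftOp r i =
      leftOp r i.pred * Algebra.lmul (Ground r) (WAlg r n) (δ (w r .rho)) := by
  classical
  refine walg_hom_ext fun g => ?_
  rw [Module.End.mul_apply, Module.End.mul_apply, lmul_δ_apply, lmul_δ_apply]
  have hE : δ (w r .rho) * wE r i = wE r i.pred * δ (w r .rho) := by
    rw [wE_eq_idem, δ_mul_idem, wE_eq_idem]
    simp [wperm]
  rw [leftOp_δ, ← map_mul, leftOp_δ, mul_add, mul_ite, mul_zero, mul_smul_comm, ← mul_assoc, hE,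
    ← map_mul, ← mul_assoc (w r (.s i.pred)), ← wrho_mul_ws, mul_assoc (w r .rho), wlen_rho_mul,
    wlen_rho_mul, mul_assoc (wE _ _), ← map_mul]

/-- The regular representation of `Ĥ_{r,n}` in the Iwahori–Matsumoto basis. -/
noncomputable def act (r n : ℕ) [NeZero n] :
    HAlg r n →ₐ[Ground r] Module.End (Ground r) (WAlg r n) :=
  RingQuot.liftAlgHom (Ground r) ⟨FreeAlgebra.lift (Ground r) (actGen r), by
    have hs := isAffineBraid_leftOp (r := r) (n := n)
    rintro _ _ (⟨i⟩ | ⟨i, j⟩ | ⟨i, hi, j⟩ | ⟨j⟩ | ⟨i⟩ | ⟨i, j, h, h'⟩ | ⟨h, i⟩ | ⟨i⟩ | _ | _) <;>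
      simp only [map_mul, map_pow, map_one, map_add, map_smul, FreeAlgebra.lift_ι_apply, actGen]
    · rw [← map_pow, ← map_pow, wt_pow, map_one, map_one]
    · rw [← map_mul, ← map_mul, wt_comm, map_mul, map_mul]
    · exact leftOp_mul_lmul i j
    · rw [← map_mul, ← map_mul, wrho_mul_wt, map_mul, map_mul]
    · exact lmul_rho_mul_leftOp i
    · exact hs.comm i j h h'
    · exact hs.braid h i
    · have : (FreeAlgebra.lift (Ground r)) (actGen r) (hE r i) =
          Algebra.lmul (Ground r) (WAlg r n) (wE r i) := by
        rw [wE_eq_sum]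
        simp only [hE, map_mul, map_pow, map_smul, map_sum, FreeAlgebra.lift_ι_apply, actGen]
      rw [this]
      exact LinearMap.ext fun m => by rw [sq]; exact leftOp_leftOp i m
    · rw [← map_mul, ← map_mul, mul_inv_cancel, map_one, map_one]
    · rw [← map_mul, ← map_mul, inv_mul_cancel, map_one, map_one]⟩

theorem act_h (x : HGen n) : act r n (h r x) = actGen r x := by
  rw [act, h, RingQuot.liftAlgHom_mkAlgHom_apply, FreeAlgebra.lift_ι_apply]

end Action

end AffineYokonuma

namespace AffineYokonuma

/-! ### The Iwahori–Matsumoto basis -/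

variable {r n : ℕ}

theorem rho_mul_reducedProd (x : Cox n) :
    h r .rho * reducedProd (fun i => h r (.s i)) x =
      reducedProd (fun i => h r (.s i)) (rot n x) * h r .rho := by
  obtain ⟨l, hl, rfl⟩ := (cox n).exists_isReduced x
  have hrot : ∀ l : List (AffIdx n), rot n ((cox n).wordProd l) =
      (cox n).wordProd (l.map AffIdx.pred) := by
    intro l
    induction l with
    | nil => simp
    | cons i l ih => rw [CoxeterSystem.wordProd_cons, map_mul, ih, rot_simple, List.map_cons,
        CoxeterSystem.wordProd_cons]
  have hl' : (cox n).IsReduced (l.map AffIdx.pred) := by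
    rw [CoxeterSystem.IsReduced, ← hrot, length_rot, hl.eq, List.length_map]
  rw [hrot, reducedProd_wordProd isAffineBraid_hs hl, reducedProd_wordProd isAffineBraid_hs hl']
  clear hl hl'
  induction l with
  | nil => simp
  | cons i l ih =>
    simp only [List.map_cons, List.prod_cons]
    rw [← mul_assoc, hrho_mul_hs, mul_assoc, ih, mul_assoc]

/-- A standard torus generator as a unit of `Ĥ_{r,n}`. -/
noncomputable def htUnit (r : ℕ) {n : ℕ} [NeZero r] (j : ZMod n) : (HAlg r n)ˣ :=
  Units.ofPowEqOne (h r (.t j)) r (ht_pow j) (NeZero.ne r)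

@[simp] theorem val_htUnit [NeZero r] (j : ZMod n) : (htUnit r j : HAlg r n) = h r (.t j) := rfl

variable [NeZero n]

section Act

theorem act_t_apply (j : ZMod n) (m : WAlg r n) : act r n (h r (.t j)) m = δ (w r (.t j)) * m := by
  rw [act_h]
  rfl

theorem act_rho_apply (m : WAlg r n) : act r n (h r .rho) m = δ (w r .rho) * m := by
  rw [act_h]
  rfl

theorem act_rhoInv_apply (m : WAlg r n) :
    act r n (h r .rhoInv) m = δ (w r .rho)⁻¹ * m := by
  rw [act_h]
  rfl

theorem act_s (i : AffIdx n) : act r n (h r (.s i)) = leftOp r i := act_h _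

theorem act_rho_zpow (k : ℤ) :
    act r n ((hRho r n ^ k : (HAlg r n)ˣ) : HAlg r n) =
      Algebra.lmul (Ground r) (WAlg r n) (δ (w r .rho ^ k)) := by
  have h1 : act r n ((hRho r n : (HAlg r n)ˣ) : HAlg r n) =
      Algebra.lmul (Ground r) (WAlg r n) (δ (w r .rho)) := act_h _
  have h2 : act r n (((hRho r n)⁻¹ : (HAlg r n)ˣ) : HAlg r n) =
      Algebra.lmul (Ground r) (WAlg r n) (δ (w r .rho)⁻¹) := act_h .rhoInv
  induction k using Int.induction_on with
  | zero => rw [zpow_zero, zpow_zero, Units.val_one, map_one, lmul_δ_one]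
  | succ k ih => rw [zpow_add_one, zpow_add_one, Units.val_mul, map_mul, ih, h1, lmul_δ_mul]
  | pred k ih => rw [zpow_sub_one, zpow_sub_one, Units.val_mul, map_mul, ih, h2, lmul_δ_mul]

theorem wlen_prod_mul_le (l : List (AffIdx n)) (g : WGroup r n) :
    wlen ((l.map fun i => w r (.s i)).prod * g) ≤ l.length + wlen g := by
  induction l with
  | nil => simp
  | cons i l ih =>
    rw [List.map_cons, List.prod_cons, mul_assoc, List.length_cons]
    have := wlen_ws_mul i ((l.map fun i => w r (.s i)).prod * g)
    omega

theorem act_prod_apply_δ (l : List (AffIdx n)) (g : WGroup r n)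
    (hl : wlen ((l.map fun i => w r (.s i)).prod * g) = l.length + wlen g) :
    act r n (l.map fun i => h r (.s i)).prod (δ g) = δ ((l.map fun i => w r (.s i)).prod * g) := by
  induction l with
  | nil => simp
  | cons i l ih =>
    rw [List.map_cons, List.prod_cons, mul_assoc, List.length_cons] at hl
    have h1 := wlen_prod_mul_le l g
    have h2 := wlen_ws_mul i ((l.map fun i => w r (.s i)).prod * g)
    rw [List.map_cons, List.prod_cons, map_mul, Module.End.mul_apply, ih (by omega), act_s,
      leftOp_δ_of_lt (by omega), List.map_cons, List.prod_cons, mul_assoc]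

/-- Inverses cost nothing, because `τ⁻¹ = τ^{r-1}`. -/
theorem exists_act_eq_lmul [NeZero r] {τ : WGroup r n} (hτ : τ ∈ torus r n) :
    ∃ a, act r n a = Algebra.lmul (Ground r) (WAlg r n) (δ τ) := by
  induction hτ using Subgroup.closure_induction with
  | mem _ h =>
    obtain ⟨j, rfl⟩ := h
    exact ⟨_, act_h (.t j)⟩
  | one => exact ⟨1, by rw [map_one, lmul_δ_one]⟩
  | mul a b _ _ ha hb =>
    obtain ⟨x, hx⟩ := ha
    obtain ⟨y, hy⟩ := hb
    exact ⟨x * y, by rw [map_mul, hx, hy, lmul_δ_mul]⟩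
  | inv a ha' ha =>
    obtain ⟨x, hx⟩ := ha
    refine ⟨x ^ (r - 1), ?_⟩
    rw [map_pow, hx, ← map_pow, ← map_pow]
    congr 2
    rw [eq_inv_iff_mul_eq_one, ← pow_succ, Nat.sub_add_cancel (NeZero.pos r), torus_pow ha']

/-- Separating the length-zero factor `u = τ ρ^k` from a reduced word gives an element of the
algebra whose action on `δ 1` never meets a correction term. -/
theorem exists_monomial [NeZero r] (g : WGroup r n) :
    ∃ (a : HAlg r n) (l : List (AffIdx n)) (u : WGroup r n),
      act r n a = Algebra.lmul (Ground r) (WAlg r n) (δ u) ∧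
        g = u * (l.map fun i => w r (.s i)).prod ∧ wlen g = l.length ∧
        ∀ g', wlen (u * g') = wlen g' := by
  obtain ⟨τ, hτ, hg⟩ := exists_eq_mul_wsec g
  set y := wproj r n g with hy
  set k : ℤ := y.right.toAdd with hk
  -- The power of `ρ` is pulled out on the left, whereas the semidirect product has it on the right;
  -- `x` is the affine part after this.
  set x : Cox n := (eρ n ^ (-k) * y).left with hx
  have hy' : y = eρ n ^ k * SemidirectProduct.inl x := by
    have h1 : (eρ n ^ (-k) * y).right = 1 := by
      rw [eρ_zpow, SemidirectProduct.mul_right, SemidirectProduct.right_inr, ofAdd_neg, hk,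
        ofAdd_toAdd, inv_mul_cancel]
    have h2 := SemidirectProduct.inl_left_mul_inr_right (eρ n ^ (-k) * y)
    rw [h1, map_one, mul_one] at h2
    rw [hx, h2, zpow_neg, mul_inv_cancel_left]
  obtain ⟨l, hl, hlx⟩ := (cox n).exists_isReduced x
  have hsec : ∀ l : List (AffIdx n), wsec r n (SemidirectProduct.inl ((cox n).wordProd l)) =
      (l.map fun i => w r (.s i)).prod := by
    intro l
    induction l with
    | nil => simp
    | cons i l ih =>
      rw [CoxeterSystem.wordProd_cons, map_mul, map_mul, ih, List.map_cons, List.prod_cons,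
        ← wsec_es, es]
  have hρ : ∀ (k : ℤ) (g' : WGroup r n), wlen (w r .rho ^ k * g') = wlen g' := by
    intro k g'
    induction k using Int.induction_on with
    | zero => simp
    | succ k ih => rw [add_comm, zpow_one_add, mul_assoc, wlen_rho_mul, ih]
    | pred k ih =>
      rw [← wlen_rho_mul, ← mul_assoc, ← zpow_one_add, add_sub_cancel, ih]
  obtain ⟨a, ha⟩ := exists_act_eq_lmul hτ
  have hgl : g = τ * w r .rho ^ k * (l.map fun i => w r (.s i)).prod := by
    nth_rw 1 [hg]
    rw [hy', map_mul, map_zpow, wsec_eρ, hlx, hsec, mul_assoc]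
  have hlen : ∀ g', wlen (τ * w r .rho ^ k * g') = wlen g' := fun g' => by
    rw [mul_assoc, wlen_mul_of_mem_torus hτ, hρ]
  refine ⟨a * ((hRho r n ^ k : (HAlg r n)ˣ) : HAlg r n), l, τ * w r .rho ^ k, ?_, hgl, ?_, hlen⟩
  · rw [map_mul, ha, act_rho_zpow, lmul_δ_mul]
  · rw [hgl, hlen, ← hsec, wlen_wsec_inl, hl.eq]

end Act

section Section

theorem closure_torGen : Subgroup.closure (Set.range (torGen r : ZMod n → Tor r n)) = ⊤ := by
  set K := Subgroup.closure (Set.range (torGen r : ZMod n → Tor r n)) with hK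
  have : QuotientGroup.mk' K = 1 := tor_hom_ext fun j => by
    rw [QuotientGroup.mk'_apply, MonoidHom.one_apply, QuotientGroup.eq_one_iff]
    exact Subgroup.subset_closure ⟨j, rfl⟩
  rw [eq_top_iff]
  intro τ _
  rw [← QuotientGroup.eq_one_iff]
  exact DFunLike.congr_fun this τ

variable [NeZero r]

/-- The torus in the units of `Ĥ_{r,n}`. -/
noncomputable def hTor (r n : ℕ) [NeZero r] [NeZero n] : Tor r n →* (HAlg r n)ˣ :=
  torLift (htUnit r) (fun j => Units.ext (by simp [ht_pow]))
    fun i j => Units.ext (by simp [ht_comm i j])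

@[simp] theorem hTor_torGen (j : ZMod n) : hTor r n (torGen r j) = htUnit r j := by
  simp [hTor]

theorem mul_hTor {a : HAlg r n} {x : ExtAff n}
    (ha : ∀ j, a * h r (.t j) = h r (.t (extPerm n x j)) * a) (τ : Tor r n) :
    a * (hTor r n τ : HAlg r n) = (hTor r n (torAct r n x τ) : HAlg r n) * a := by
  have hτ : τ ∈ Subgroup.closure (Set.range (torGen r : ZMod n → Tor r n)) := by
    rw [closure_torGen]
    trivial
  induction hτ using Subgroup.closure_induction with
  | mem _ h =>
    obtain ⟨j, rfl⟩ := h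
    rw [torAct_torGen, hTor_torGen, hTor_torGen, val_htUnit, val_htUnit, ha]
  | one => simp
  | mul u v _ _ hu hv =>
    rw [map_mul, map_mul, map_mul, Units.val_mul, Units.val_mul, ← mul_assoc, hu, mul_assoc, hv,
      mul_assoc]
  | inv u _ hu =>
    rw [map_inv, map_inv, map_inv]
    rw [Units.eq_inv_mul_iff_mul_eq, ← mul_assoc, ← hu, Units.mul_inv_cancel_right]

/-- The element `T_g` of `Ĥ_{r,n}`, from a reduced expression. -/
noncomputable def hT (g : WGroup r n) : HAlg r n :=
  (hTor r n (toModel r n g).left : HAlg r n) *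
    reducedProd (fun i => h r (.s i)) (toModel r n g).right.left *
      ((hRho r n ^ (toModel r n g).right.right.toAdd : (HAlg r n)ˣ) : HAlg r n)

theorem hT_one : hT (1 : WGroup r n) = 1 := by
  simp [hT, reducedProd_one isAffineBraid_hs]

theorem hT_t_mul (j : ZMod n) (g : WGroup r n) : hT (w r (.t j) * g) = h r (.t j) * hT g := by
  simp [hT, toModel_w, toModelGen, mul_assoc]

theorem hT_rho_mul (g : WGroup r n) : hT (w r .rho * g) = h r .rho * hT g := by
  have h1 := mul_hTor (x := eρ n) (a := h r .rho)
    (fun j => by rw [hrho_mul_ht, extPerm_eρ, Equiv.subRight_apply]) (toModel r n g).left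
  have h2 := rho_mul_reducedProd (r := r) (toModel r n g).right.left
  have h3 : (eρ n * (toModel r n g).right).left = rot n (toModel r n g).right.left := by simp [eρ]
  have h4 : (eρ n * (toModel r n g).right).right =
      Multiplicative.ofAdd 1 * (toModel r n g).right.right := by simp [eρ]
  rw [hT, hT, map_mul, toModel_w, toModelGen, SemidirectProduct.mul_left,
    SemidirectProduct.left_inr,
    one_mul, SemidirectProduct.right_inr, SemidirectProduct.mul_right, SemidirectProduct.right_inr,
    h3, h4, toAdd_mul, toAdd_ofAdd, zpow_one_add, Units.val_mul, val_hRho, ← mul_assoc, ← mul_assoc,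
    ← mul_assoc, h1, mul_assoc _ (h r .rho) (reducedProd _ _), h2]
  simp only [mul_assoc]

theorem hT_s_mul_of_lt {i : AffIdx n} {g : WGroup r n} (hlt : wlen g < wlen (w r (.s i) * g)) :
    hT (w r (.s i) * g) = h r (.s i) * hT g := by
  have h1 := mul_hTor (x := es i) (a := h r (.s i))
    (fun j => by rw [hs_mul_ht, extPerm_es]) (toModel r n g).left
  have hup : ¬ (cox n).IsLeftDescent (toModel r n g).right.left i := by
    rw [wlen, wlen, map_mul, wproj_s, elen, elen, es_mul_left] at hlt
    exact not_lt.2 hlt.le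
  rw [hT, hT, map_mul, toModel_w, toModelGen, SemidirectProduct.mul_left,
    SemidirectProduct.left_inr,
    one_mul, SemidirectProduct.right_inr, SemidirectProduct.mul_right, SemidirectProduct.right_inr,
    es_mul_left, es_mul_right, reducedProd_simple_mul isAffineBraid_hs hup, ← mul_assoc,
    ← mul_assoc,
    ← mul_assoc, h1]

/-- The linear map with `δ g ↦ T_g`. -/
noncomputable def hSection (r n : ℕ) [NeZero r] [NeZero n] : WAlg r n →ₗ[Ground r] HAlg r n :=
  (MonoidAlgebra.basis (WGroup r n) (Ground r)).constr (Ground r) hT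

theorem hSection_δ (g : WGroup r n) : hSection r n (δ g) = hT g := by
  rw [hSection, δ, MonoidAlgebra.of_apply, ← MonoidAlgebra.basis_apply, Module.Basis.constr_basis]

theorem hSection_t_mul (j : ZMod n) (m : WAlg r n) :
    hSection r n (δ (w r (.t j)) * m) = h r (.t j) * hSection r n m := by
  suffices hSection r n ∘ₗ LinearMap.mulLeft (Ground r) (δ (w r (.t j))) =
      LinearMap.mulLeft (Ground r) (h r (.t j)) ∘ₗ hSection r n from DFunLike.congr_fun this m
  refine walg_hom_ext fun g => ?_
  simp only [LinearMap.comp_apply, LinearMap.mulLeft_apply]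
  rw [← map_mul, hSection_δ, hSection_δ, hT_t_mul]

theorem hSection_rho_mul (m : WAlg r n) :
    hSection r n (δ (w r .rho) * m) = h r .rho * hSection r n m := by
  suffices hSection r n ∘ₗ LinearMap.mulLeft (Ground r) (δ (w r .rho)) =
      LinearMap.mulLeft (Ground r) (h r .rho) ∘ₗ hSection r n from DFunLike.congr_fun this m
  refine walg_hom_ext fun g => ?_
  simp only [LinearMap.comp_apply, LinearMap.mulLeft_apply]
  rw [← map_mul, hSection_δ, hSection_δ, hT_rho_mul]

theorem hSection_wE_mul (i : AffIdx n) (m : WAlg r n) :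
    hSection r n (wE r i * m) = hIdem r i * hSection r n m := by
  have hpow : ∀ (j : ZMod n) (k : ℕ) (m : WAlg r n),
      hSection r n (δ (w r (.t j)) ^ k * m) = h r (.t j) ^ k * hSection r n m := by
    intro j k m
    induction k with
    | zero => simp
    | succ k ih => rw [pow_succ', mul_assoc, hSection_t_mul, ih, pow_succ', mul_assoc]
  simp only [wE_eq_sum, hIdem, smul_mul_assoc, Finset.sum_mul, map_smul, map_sum, mul_assoc, hpow]

/-- If `s_i` lengthens `g` this is Matsumoto's theorem. Otherwise `T_g = T_{s_i} T_{s_i g}` and the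
quadratic relation of the algebra yields exactly the correction term of the operator. -/
theorem hSection_leftOp (i : AffIdx n) (m : WAlg r n) :
    hSection r n (leftOp r i m) = h r (.s i) * hSection r n m := by
  classical
  suffices hSection r n ∘ₗ leftOp r i =
      LinearMap.mulLeft (Ground r) (h r (.s i)) ∘ₗ hSection r n from DFunLike.congr_fun this m
  refine walg_hom_ext fun g => ?_
  simp only [LinearMap.comp_apply, LinearMap.mulLeft_apply]
  obtain hl | hl := wlen_ws_mul i g
  · rw [leftOp_δ_of_lt (by omega), hSection_δ, hSection_δ, hT_s_mul_of_lt (by omega)]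
  · have hcancel : w r (.s i) * (w r (.s i) * g) = g := by rw [← mul_assoc, ws_mul_self, one_mul]
    have hg : hT g = h r (.s i) * hT (w r (.s i) * g) := by
      rw [← hT_s_mul_of_lt (by rw [hcancel]; omega), hcancel]
    rw [leftOp_δ, if_pos (by omega), map_add, map_smul, hSection_wE_mul, hSection_δ, hSection_δ, hg,
      ← mul_assoc (h r (.s i)), hs_mul_self, add_mul, one_mul, smul_mul_assoc, mul_assoc]

theorem hSection_act (a : HAlg r n) (m : WAlg r n) :
    hSection r n (act r n a m) = a * hSection r n m := by
  induction a using halg_induction generalizing m with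
  | gen x =>
    cases x with
    | t j => rw [act_t_apply, hSection_t_mul]
    | s i => rw [act_s, hSection_leftOp]
    | rho => rw [act_rho_apply, hSection_rho_mul]
    | rhoInv =>
      rw [act_rhoInv_apply, ← val_inv_hRho, Units.eq_inv_mul_iff_mul_eq, val_hRho,
        ← hSection_rho_mul, ← mul_assoc, ← map_mul,
        mul_inv_cancel, map_one, one_mul]
  | scalar c => rw [AlgHom.commutes, Module.algebraMap_end_apply, map_smul, Algebra.smul_def]
  | mul a b ha hb => rw [map_mul, Module.End.mul_apply, ha, hb, mul_assoc]
  | add a b ha hb => rw [map_add, LinearMap.add_apply, map_add, ha, hb, add_mul]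

end Section

section Basis

/-- The linear map `a ↦ a • δ 1` from `Ĥ_{r,n}` to the group algebra. -/
noncomputable def orbitMap (r n : ℕ) [NeZero n] : HAlg r n →ₗ[Ground r] WAlg r n :=
  LinearMap.applyₗ (δ 1) ∘ₗ (act r n).toLinearMap

theorem orbitMap_apply (a : HAlg r n) : orbitMap r n a = act r n a (δ 1) := rfl

variable [NeZero r]

theorem hSection_orbitMap (a : HAlg r n) : hSection r n (orbitMap r n a) = a := by
  rw [orbitMap_apply, hSection_act, hSection_δ, hT_one, mul_one]

/-- Each `δ g` is the image of a monomial under the orbit map, and the section is already a left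
inverse of that map. -/
theorem orbitMap_hSection (m : WAlg r n) : orbitMap r n (hSection r n m) = m := by
  have hinj : Function.Injective (orbitMap r n) :=
    Function.LeftInverse.injective hSection_orbitMap
  suffices orbitMap r n ∘ₗ hSection r n = LinearMap.id from DFunLike.congr_fun this m
  refine walg_hom_ext fun g => ?_
  obtain ⟨a, l, u, ha, hg, hlen, hu⟩ := exists_monomial g
  have h1 : orbitMap r n (a * (l.map fun i => h r (.s i)).prod) = δ g := by
    rw [orbitMap_apply, map_mul, Module.End.mul_apply, act_prod_apply_δ, ha, lmul_δ_apply,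
      ← map_mul, mul_one, ← hg]
    rw [mul_one, wlen_one, add_zero, ← hlen, hg, hu]
  rw [LinearMap.comp_apply, ← h1, hSection_orbitMap, LinearMap.id_apply]

/-- The Iwahori–Matsumoto basis of `Ĥ_{r,n}`. -/
noncomputable def hBasis (r n : ℕ) [NeZero r] [NeZero n] :
    Module.Basis (WGroup r n) (Ground r) (HAlg r n) :=
  (MonoidAlgebra.basis (WGroup r n) (Ground r)).map
    (LinearEquiv.ofLinearMap (hSection r n) (orbitMap r n) (LinearMap.ext hSection_orbitMap)
      (LinearMap.ext orbitMap_hSection))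

theorem act_hBasis_one (g : WGroup r n) : act r n (hBasis r n g) (δ 1) = δ g := by
  rw [hBasis, Module.Basis.map_apply, MonoidAlgebra.basis_apply, ← MonoidAlgebra.of_apply]
  exact orbitMap_hSection _

theorem hAlg_ext {a b : HAlg r n} (hab : act r n a (δ 1) = act r n b (δ 1)) : a = b :=
  (Function.LeftInverse.injective hSection_orbitMap) hab

/-- Writing `T_g` as a length-zero factor times a reduced word, additivity of lengths forces each
letter to act on `δ g'` in the increasing branch. -/
theorem hBasis_mul (g g' : WGroup r n) (hlen : wlen (g * g') = wlen g + wlen g') :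
    hBasis r n g * hBasis r n g' = hBasis r n (g * g') := by
  apply hAlg_ext
  obtain ⟨a, l, u, ha, hg, hl, hu⟩ := exists_monomial g
  have h1 : hBasis r n g = a * (l.map fun i => h r (.s i)).prod := by
    apply hAlg_ext
    rw [act_hBasis_one, map_mul, Module.End.mul_apply, act_prod_apply_δ, ha, lmul_δ_apply,
      ← map_mul, mul_one, ← hg]
    rw [mul_one, wlen_one, add_zero, ← hl, hg, hu]
  rw [map_mul, Module.End.mul_apply, act_hBasis_one, act_hBasis_one, h1, map_mul,
    Module.End.mul_apply, act_prod_apply_δ, ha, lmul_δ_apply, ← map_mul, ← mul_assoc, ← hg]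
  rw [← hl, ← hlen, hg, mul_assoc, hu]

end Basis

end AffineYokonuma

namespace AffineYokonuma

/-! ### Descending products in braid monoids -/

section BraidSequence

variable {A : Type*} [Monoid A] {n : ℕ} {g : ℕ → A}

/-- The product `g_{a+k-1} ⋯ g_{a+1} g_a`. -/
def downProd (g : ℕ → A) (a k : ℕ) : A := ((List.range' a k).reverse.map g).prod

/-- The product `g_a g_{a+1} ⋯ g_{a+k-1}`. -/
def upProd (g : ℕ → A) (a k : ℕ) : A := ((List.range' a k).map g).prod

@[simp] theorem downProd_zero (a : ℕ) : downProd g a 0 = 1 := rfl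

@[simp] theorem upProd_zero (a : ℕ) : upProd g a 0 = 1 := rfl

theorem downProd_succ (a k : ℕ) : downProd g a (k + 1) = g (a + k) * downProd g a k := by
  simp [downProd, List.range'_concat]

theorem downProd_succ' (a k : ℕ) : downProd g a (k + 1) = downProd g (a + 1) k * g a := by
  simp [downProd, List.range'_succ]

theorem upProd_succ (a k : ℕ) : upProd g a (k + 1) = upProd g a k * g (a + k) := by
  simp [upProd, List.range'_concat]

theorem upProd_succ' (a k : ℕ) : upProd g a (k + 1) = g a * upProd g (a + 1) k := by
  simp [upProd, List.range'_succ]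

theorem commute_downProd {x : A} {a k : ℕ} (hx : ∀ j, a ≤ j → j < a + k → Commute x (g j)) :
    Commute x (downProd g a k) := by
  induction k with
  | zero => exact Commute.one_right x
  | succ k ih =>
    rw [downProd_succ]
    exact (hx _ (by omega) (by omega)).mul_right (ih fun j h1 h2 => hx j h1 (by omega))

theorem commute_upProd {x : A} {a k : ℕ} (hx : ∀ j, a ≤ j → j < a + k → Commute x (g j)) :
    Commute x (upProd g a k) := by
  induction k with
  | zero => exact Commute.one_right x
  | succ k ih =>
    rw [upProd_succ]
    exact (ih fun j h1 h2 => hx j h1 (by omega)).mul_right (hx _ (by omega) (by omega))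

theorem map_downProd {A' F : Type*} [Monoid A'] [FunLike F A A'] [MonoidHomClass F A A'] (φ : F)
    (a k : ℕ) : φ (downProd g a k) = downProd (fun i => φ (g i)) a k := by
  simp [downProd, map_list_prod, Function.comp_def]

theorem map_upProd {A' F : Type*} [Monoid A'] [FunLike F A A'] [MonoidHomClass F A A'] (φ : F)
    (a k : ℕ) : φ (upProd g a k) = upProd (fun i => φ (g i)) a k := by
  simp [upProd, map_list_prod, Function.comp_def]

theorem downProd_congr {g' : ℕ → A} {a k : ℕ} (hg : ∀ j, a ≤ j → j < a + k → g j = g' j) :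
    downProd g a k = downProd g' a k := by
  induction k with
  | zero => rfl
  | succ k ih =>
    rw [downProd_succ, downProd_succ, hg _ (by omega) (by omega),
      ih fun j h1 h2 => hg j h1 (by omega)]

/-- The relations of the braid group on `n` strands, for a sequence of elements of which only those
with indices `1, …, n-1` matter. -/
structure IsBraidSeq (n : ℕ) (g : ℕ → A) : Prop where
  comm : ∀ i j, 1 ≤ i → i + 2 ≤ j → j < n → g i * g j = g j * g i
  braid : ∀ i, 1 ≤ i → i + 1 < n → g i * g (i + 1) * g i = g (i + 1) * g i * g (i + 1)

theorem IsBraidSeq.map (hg : IsBraidSeq n g) {A' F : Type*} [Monoid A'] [FunLike F A A']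
    [MonoidHomClass F A A'] (φ : F) : IsBraidSeq n fun i => φ (g i) where
  comm i j h1 h2 h3 := by simp only [← map_mul, hg.comm i j h1 h2 h3]
  braid i h1 h2 := by simp only [← map_mul, hg.braid i h1 h2]

/-- Moving left, `g_{i+1}` commutes past the small factors, becomes `g_i` by one braid move with
`g_{i+1} g_i`, and then commutes past the large factors. -/
theorem IsBraidSeq.downProd_mul (hg : IsBraidSeq n g) {a k i : ℕ} (ha : 1 ≤ a) (hak : a + k ≤ n)
    (hi : a ≤ i) (hik : i + 1 < a + k) :
    downProd g a k * g (i + 1) = g i * downProd g a k := by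
  induction k with
  | zero => omega
  | succ k ih =>
    rw [downProd_succ]
    obtain h | h : i + 1 < a + k ∨ i + 1 = a + k := by omega
    · rw [mul_assoc, ih (by omega) h, ← mul_assoc, ← hg.comm i (a + k) (by omega) (by omega)
        (by omega), mul_assoc]
    · obtain ⟨k, rfl⟩ : ∃ k', k = k' + 1 := ⟨k - 1, by omega⟩
      have hi' : a + k = i := by omega
      have hc : Commute (g (i + 1)) (downProd g a k) := commute_downProd fun j h1 h2 =>
        (hg.comm j (i + 1) (by omega) (by omega) (by omega)).symm
      rw [downProd_succ, hi', ← h, mul_assoc, mul_assoc, ← hc.eq, ← mul_assoc, ← mul_assoc,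
        ← hg.braid i (by omega) (by omega)]
      simp only [mul_assoc]

/-- The relations between the braid generators and `X_1` in the affine braid group. -/
structure IsBraidX (n : ℕ) (g : ℕ → A) (X : A) : Prop extends IsBraidSeq n g where
  one : 2 ≤ n → g 1 * X * g 1 * X = X * g 1 * X * g 1
  comm_X : ∀ i, 2 ≤ i → i < n → g i * X = X * g i

/-- Passing `g_{n-1} ⋯ g_2` leftwards through `D = g_{n-1} ⋯ g_1` lowers its indices to `g_{n-2} ⋯
g_1`, which the extra `g_{n-1}` completes to a second `D`. -/
theorem IsBraidSeq.mul_downProd_mul_downProd (hg : IsBraidSeq n g) (hn : 2 ≤ n) :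
    g (n - 1) * (downProd g 1 (n - 1) * downProd g 2 (n - 2)) =
      downProd g 1 (n - 1) * downProd g 1 (n - 1) := by
  have hk : ∀ k, k + 2 ≤ n →
      downProd g 1 (n - 1) * downProd g 2 k = downProd g 1 k * downProd g 1 (n - 1) := by
    intro k hk
    induction k with
    | zero => simp
    | succ k ih =>
      rw [downProd_succ, downProd_succ, ← mul_assoc, show 2 + k = 1 + k + 1 by omega,
        hg.downProd_mul le_rfl (by omega) (by omega) (by omega), mul_assoc, ih (by omega),
        mul_assoc]
  rw [hk _ (by omega), ← mul_assoc]
  congr 1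
  obtain ⟨m, rfl⟩ : ∃ m, n = m + 2 := ⟨n - 2, by omega⟩
  have := downProd_succ (g := g) 1 m
  rw [show m + 2 - 1 = 1 + m by omega, Nat.add_sub_cancel, ← this, add_comm 1 m]

theorem downProd_one_eq (hn : 2 ≤ n) : downProd g 1 (n - 1) = downProd g 2 (n - 2) * g 1 := by
  rw [← downProd_succ']
  congr 1
  omega

theorem IsBraidSeq.downProd_mul_X_mul (hg : IsBraidSeq n g) {X : A}
    (hX : ∀ i, 2 ≤ i → i < n → g i * X = X * g i) {i : ℕ} (hi : 1 ≤ i) (hin : i + 1 < n) :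
    downProd g 1 (n - 1) * X * g (i + 1) = g i * (downProd g 1 (n - 1) * X) := by
  rw [mul_assoc, ← hX _ (by omega) hin, ← mul_assoc,
    hg.downProd_mul le_rfl (by omega) hi (by omega), mul_assoc]

theorem IsBraidSeq.downProd_mul_X_sq (hn : 2 ≤ n) {X : A}
    (hX : ∀ i, 2 ≤ i → i < n → g i * X = X * g i) :
    downProd g 1 (n - 1) * X * (downProd g 1 (n - 1) * X) =
      downProd g 1 (n - 1) * downProd g 2 (n - 2) * (X * g 1 * X) := by
  have hc : Commute X (downProd g 2 (n - 2)) := commute_downProd fun j h1 h2 =>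
    (hX j h1 (by omega)).symm
  rw [show downProd g 1 (n - 1) * X * (downProd g 1 (n - 1) * X) =
    downProd g 1 (n - 1) * X * (downProd g 2 (n - 2) * g 1 * X) by rw [← downProd_one_eq hn]]
  rw [show downProd g 1 (n - 1) * X * (downProd g 2 (n - 2) * g 1 * X) =
    downProd g 1 (n - 1) * (X * downProd g 2 (n - 2)) * g 1 * X by simp only [mul_assoc], hc.eq]
  simp only [mul_assoc]

end BraidSequence

section BraidGroup

variable {Γ : Type*} [Group Γ] {n : ℕ} {g : ℕ → Γ} {X ρ : Γ}

/-- With `X = D⁻¹ ρ`, both sides of the `ρ²` relation become a common factor `D g_{n-1} ⋯ g_2` times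
the two sides of the four-term relation between `g_1` and `X`. The relations with `i ≥ 2` hold
because `D` and `ρ` shift indices alike. -/
theorem IsBraidSeq.isBraidX (hg : IsBraidSeq n g)
    (h1 : ∀ i, 1 ≤ i → i + 1 < n → ρ * g (i + 1) = g i * ρ)
    (h2 : 2 ≤ n → ρ * ρ * g 1 = g (n - 1) * (ρ * ρ)) :
    IsBraidX n g ((downProd g 1 (n - 1))⁻¹ * ρ) := by
  set X := (downProd g 1 (n - 1))⁻¹ * ρ with hXdef
  have hρ : ρ = downProd g 1 (n - 1) * X := by rw [hXdef, mul_inv_cancel_left]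
  have hX : ∀ i, 2 ≤ i → i < n → g i * X = X * g i := by
    intro i hi hin
    obtain ⟨i, rfl⟩ : ∃ i', i = i' + 1 := ⟨i - 1, by omega⟩
    rw [hXdef, mul_assoc _ ρ, h1 i (by omega) hin, ← mul_assoc, ← mul_assoc, eq_comm]
    congr 1
    rw [eq_mul_inv_iff_mul_eq, mul_assoc, inv_mul_eq_iff_eq_mul,
      hg.downProd_mul le_rfl (by omega) (by omega) (by omega)]
  refine ⟨hg, fun hn => ?_, hX⟩
  have := h2 hn
  rw [hρ, IsBraidSeq.downProd_mul_X_sq hn hX, ← mul_assoc (g (n - 1)),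
    hg.mul_downProd_mul_downProd hn] at this
  -- Splitting `g_1` off one copy of `D` exposes the common left factor to be cancelled.
  nth_rw 3 [downProd_one_eq hn] at this
  simp only [mul_assoc, mul_right_inj] at this
  simpa only [mul_assoc] using this.symm

end BraidGroup

/-! ### The translation subgroup and its finite complement -/

section TranslationSubgroup

variable {Γ : Type*} [Group Γ] {n : ℕ} {g : ℕ → Γ} {X : Γ}

/-- The conjugates `g_k ⋯ g_1 X g_1⁻¹ ⋯ g_k⁻¹`. -/
def conjX (g : ℕ → Γ) (X : Γ) : ℕ → Γ
  | 0 => X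
  | k + 1 => g (k + 1) * conjX g X k * (g (k + 1))⁻¹

theorem IsBraidX.commute_conjX_of_lt (hX : IsBraidX n g X) {i k : ℕ} (hik : k + 2 ≤ i)
    (hin : i < n) : Commute (g i) (conjX g X k) := by
  induction k with
  | zero => exact hX.comm_X i hik hin
  | succ k ih =>
    have : Commute (g i) (g (k + 1)) := (hX.comm (k + 1) i (by omega) (by omega) hin).symm
    exact (this.mul_right (ih (by omega))).mul_right this.inv_right

/-- The essential case is `k = i + 1`. For `a = g_i`, `b = g_{i+1}` the braid relation gives `a (b
a) = (b a) b`, and `b` commutes with the earlier conjugate. -/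
theorem IsBraidX.commute_conjX_of_gt (hX : IsBraidX n g X) {i k : ℕ} (hi : 1 ≤ i) (hik : i < k)
    (hkn : k < n) : Commute (g i) (conjX g X k) := by
  induction k with
  | zero => omega
  | succ k ih =>
    obtain h | rfl := Nat.lt_or_eq_of_le (Nat.lt_succ_iff.1 hik)
    · have : Commute (g i) (g (k + 1)) := hX.comm i (k + 1) hi (by omega) hkn
      exact (this.mul_right (ih h (by omega))).mul_right this.inv_right
    · obtain ⟨i, rfl⟩ : ∃ i', i = i' + 1 := ⟨i - 1, by omega⟩
      have hb := hX.braid (i + 1) (by omega) hkn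
      have hc := (hX.commute_conjX_of_lt (i := i + 1 + 1) (k := i) le_rfl hkn).eq
      simp only [conjX]
      set a := g (i + 1)
      set b := g (i + 1 + 1)
      set x := conjX g X i
      have h1 : a * (b * a * x * (b * a)⁻¹) = b * a * x * (b * a)⁻¹ * a := by
        rw [show b * a * x * (b * a)⁻¹ * a = b * a * x * ((b * a)⁻¹ * a * (b * a)) * (b * a)⁻¹ by
          group]
        rw [show (b * a)⁻¹ * a * (b * a) = b by
          rw [mul_assoc, ← mul_assoc a b a, hb, ← mul_assoc]
          group]
        rw [mul_assoc _ x b, ← hc, ← mul_assoc, ← mul_assoc, ← mul_assoc, hb]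
        simp only [mul_assoc]
      have h2 : b * (a * x * a⁻¹) * b⁻¹ = b * a * x * (b * a)⁻¹ := by group
      rw [h2]
      exact h1

/-- For the first conjugate this is the four-term relation read with `g_1⁻¹ = g_1`; the later `g_k`
commute with `X`. -/
theorem IsBraidX.commute_X_conjX (hX : IsBraidX n g X)
    (hsq : ∀ i, 1 ≤ i → i < n → g i * g i = 1) {k : ℕ} (hkn : k + 1 < n) :
    Commute X (conjX g X (k + 1)) := by
  induction k with
  | zero =>
    have hinv : (g 1)⁻¹ = g 1 := inv_eq_of_mul_eq_one_left (hsq 1 le_rfl (by omega))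
    have := hX.one (by omega)
    simp only [conjX, zero_add, hinv, Commute, SemiconjBy]
    simpa only [mul_assoc] using this.symm
  | succ k ih =>
    have : Commute X (g (k + 2)) := (hX.comm_X (k + 2) (by omega) hkn).symm
    exact (this.mul_right (ih (by omega))).mul_right this.inv_right

theorem IsBraidX.commute_conjX (hX : IsBraidX n g X)
    (hsq : ∀ i, 1 ≤ i → i < n → g i * g i = 1) {j k : ℕ} (hjk : j < k) (hkn : k < n) :
    Commute (conjX g X j) (conjX g X k) := by
  induction j with
  | zero =>
    obtain ⟨k, rfl⟩ : ∃ k', k = k' + 1 := ⟨k - 1, by omega⟩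
    exact hX.commute_X_conjX hsq hkn
  | succ j ih =>
    have h1 : Commute (g (j + 1)) (conjX g X k) :=
      hX.commute_conjX_of_gt (by omega) hjk hkn
    exact (h1.mul_left (ih (by omega))).mul_left h1.inv_left

/-- The subgroup generated by the conjugates of `X`. -/
def translations (n : ℕ) (g : ℕ → Γ) (X : Γ) : Subgroup Γ :=
  Subgroup.closure (conjX g X '' Set.Iio n)

theorem translations_fg : (translations n g X).FG :=
  (Subgroup.fg_iff _).2 ⟨_, rfl, (Set.finite_Iio n).image _⟩

theorem IsBraidX.translations_comm (hX : IsBraidX n g X)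
    (hsq : ∀ i, 1 ≤ i → i < n → g i * g i = 1) :
    ∀ x ∈ translations n g X, ∀ y ∈ translations n g X, x * y = y * x := by
  have h1 : ∀ x ∈ conjX g X '' Set.Iio n, ∀ y ∈ conjX g X '' Set.Iio n, x * y = y * x := by
    rintro _ ⟨j, hj, rfl⟩ _ ⟨k, hk, rfl⟩
    obtain h | rfl | h := lt_trichotomy j k
    · exact hX.commute_conjX hsq h hk
    · rfl
    · exact (hX.commute_conjX hsq h hj).symm
  intro x hx y hy
  have := Subgroup.isMulCommutative_closure h1
  exact congrArg Subtype.val (mul_comm' (⟨x, hx⟩ : Subgroup.closure _) ⟨y, hy⟩)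

/-- Conjugation by `g_i` exchanges the conjugates numbered `i - 1` and `i`, and fixes the others. -/
theorem IsBraidX.conj_g_mem (hX : IsBraidX n g X)
    (hsq : ∀ i, 1 ≤ i → i < n → g i * g i = 1) {i : ℕ} (hi : 1 ≤ i) (hin : i < n) {x : Γ}
    (hx : x ∈ translations n g X) : g i * x * (g i)⁻¹ ∈ translations n g X := by
  have hmem : ∀ k, k < n → conjX g X k ∈ translations n g X := fun k hk =>
    Subgroup.subset_closure ⟨k, hk, rfl⟩
  suffices h : translations n g X ≤ (translations n g X).comap (MulAut.conj (g i)).toMonoidHom from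
    h hx
  rw [translations, Subgroup.closure_le]
  rintro _ ⟨k, hk, rfl⟩
  change g i * conjX g X k * (g i)⁻¹ ∈ translations n g X
  have hk : k < n := hk
  obtain h | h | h | h : i + 1 ≤ k ∨ i = k ∨ i = k + 1 ∨ k + 2 ≤ i := by omega
  · rw [(hX.commute_conjX_of_gt hi h hk).eq, mul_inv_cancel_right]
    exact hmem k hk
  · obtain ⟨k, rfl⟩ : ∃ k', k = k' + 1 := ⟨k - 1, by omega⟩
    have hinv : (g i)⁻¹ = g i := inv_eq_of_mul_eq_one_left (hsq i hi hin)
    rw [conjX, ← h, hinv, ← mul_assoc, ← mul_assoc, hsq i hi hin, one_mul, mul_assoc,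
      hsq i hi hin, mul_one]
    exact hmem k (by omega)
  · subst h
    exact hmem (k + 1) hin
  · rw [(hX.commute_conjX_of_lt h hin).eq, mul_inv_cancel_right]
    exact hmem k hk

theorem IsBraidX.translations_normal (hX : IsBraidX n g X) (hn : 1 ≤ n)
    (hsq : ∀ i, 1 ≤ i → i < n → g i * g i = 1)
    (htop : Subgroup.closure (insert X (g '' Set.Ico 1 n)) = ⊤) :
    (translations n g X).Normal := by
  have hXmem : X ∈ translations n g X := Subgroup.subset_closure ⟨0, hn, rfl⟩
  have hle : Subgroup.closure (insert X (g '' Set.Ico 1 n)) ≤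
      Subgroup.normalizer (translations n g X : Set Γ) := by
    rw [Subgroup.closure_le]
    rintro _ (rfl | ⟨i, ⟨hi, hin⟩, rfl⟩)
    · exact Subgroup.le_normalizer hXmem
    · refine Subgroup.mem_normalizer_iff.2 fun x => ⟨hX.conj_g_mem hsq hi hin, fun hx => ?_⟩
      have := hX.conj_g_mem hsq hi hin hx
      have hinv : (g i)⁻¹ = g i := inv_eq_of_mul_eq_one_left (hsq i hi hin)
      rwa [hinv, ← mul_assoc, ← mul_assoc, hsq i hi hin, one_mul, mul_assoc, hsq i hi hin,
        mul_one] at this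
  rw [← Subgroup.normalizer_eq_top_iff, eq_top_iff, ← htop]
  exact hle

theorem IsBraidX.normalClosure_X (hX : IsBraidX n g X) (hn : 1 ≤ n)
    (hsq : ∀ i, 1 ≤ i → i < n → g i * g i = 1)
    (htop : Subgroup.closure (insert X (g '' Set.Ico 1 n)) = ⊤) :
    Subgroup.normalClosure {X} = translations n g X := by
  have := hX.translations_normal hn hsq htop
  refine le_antisymm (Subgroup.normalClosure_le_normal ?_) ?_
  · rw [Set.singleton_subset_iff]
    exact Subgroup.subset_closure ⟨0, hn, rfl⟩
  · rw [translations, Subgroup.closure_le]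
    rintro _ ⟨k, -, rfl⟩
    induction k with
    | zero => exact Subgroup.subset_normalClosure rfl
    | succ k ih => exact Subgroup.normalClosure_normal.conj_mem _ ih _

/-- Every element of the subgroup generated by `g_1, …, g_{k+1}` lies in a coset of the subgroup
generated by `g_1, …, g_k`, represented by a descending product that starts at `g_{k+1}`. -/
theorem IsBraidSeq.exists_eq_mul_downProd (hg : IsBraidSeq n g)
    (hsq : ∀ i, 1 ≤ i → i < n → g i * g i = 1) {k : ℕ} (hk : k + 1 < n) {x : Γ}
    (hx : x ∈ Subgroup.closure (g '' Set.Ico 1 (k + 2))) :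
    ∃ p ∈ Subgroup.closure (g '' Set.Ico 1 (k + 1)), ∃ j, 1 ≤ j ∧ j ≤ k + 2 ∧
      x = p * downProd g j (k + 2 - j) := by
  have hmem : ∀ i, 1 ≤ i → i < k + 1 → g i ∈ Subgroup.closure (g '' Set.Ico 1 (k + 1)) :=
    fun i h1 h2 => Subgroup.subset_closure ⟨i, ⟨h1, h2⟩, rfl⟩
  have step : ∀ x i, 1 ≤ i → i < k + 2 →
      (∃ p ∈ Subgroup.closure (g '' Set.Ico 1 (k + 1)), ∃ j, 1 ≤ j ∧ j ≤ k + 2 ∧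
        x = p * downProd g j (k + 2 - j)) →
      ∃ p ∈ Subgroup.closure (g '' Set.Ico 1 (k + 1)), ∃ j, 1 ≤ j ∧ j ≤ k + 2 ∧
        x * g i = p * downProd g j (k + 2 - j) := by
    rintro _ i hi hik ⟨p, hp, j, hj, hjk, rfl⟩
    -- In turn: `g_i` commutes into the subgroup, lengthens the tail, shortens it, or passes through
    -- it with its index lowered by one.
    obtain h | h | h | h : i + 1 < j ∨ i + 1 = j ∨ i = j ∨ j < i := by omega
    · have hc : Commute (g i) (downProd g j (k + 2 - j)) := commute_downProd fun m h1 h2 =>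
        hg.comm i m hi (by omega) (by omega)
      exact ⟨p * g i, mul_mem hp (hmem i hi (by omega)), j, hj, hjk, by
        rw [mul_assoc, mul_assoc, hc.eq]⟩
    · refine ⟨p, hp, i, hi, by omega, ?_⟩
      rw [mul_assoc, ← h, ← downProd_succ']
      congr 2
      omega
    · refine ⟨p, hp, i + 1, by omega, by omega, ?_⟩
      rw [← h, show k + 2 - i = k + 2 - (i + 1) + 1 by omega, downProd_succ', mul_assoc, mul_assoc,
        hsq i hi (by omega), mul_one]
    · obtain ⟨i, rfl⟩ : ∃ i', i = i' + 1 := ⟨i - 1, by omega⟩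
      refine ⟨p * g i, mul_mem hp (hmem i (by omega) (by omega)), j, hj, hjk, ?_⟩
      rw [mul_assoc, hg.downProd_mul hj (by omega) (by omega) (by omega), mul_assoc]
  induction hx using Subgroup.closure_induction_right with
  | one => exact ⟨1, one_mem _, k + 2, by omega, le_rfl, by simp⟩
  | mul_right x _ y hy ih =>
    obtain ⟨i, ⟨h1, h2⟩, rfl⟩ := hy
    exact step x i h1 h2 ih
  | mul_inv_cancel x _ y hy ih =>
    obtain ⟨i, ⟨h1, h2⟩, rfl⟩ := hy
    rw [inv_eq_of_mul_eq_one_left (hsq i h1 (by omega))]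
    exact step x i h1 h2 ih

variable (θ : Γ →* Equiv.Perm (ZMod n))

theorem downProd_perm_apply
    (hθ : ∀ k, 1 ≤ k → k < n → θ (g k) = Equiv.swap (k : ZMod n) ((k : ZMod n) + 1)) {j m : ℕ}
    (hj : 1 ≤ j) (hjm : j + m ≤ n) :
    θ (downProd g j m) (j : ZMod n) = ((j + m : ℕ) : ZMod n) := by
  induction m with
  | zero => simp
  | succ m ih =>
    rw [downProd_succ, map_mul, Equiv.Perm.mul_apply, ih (by omega), hθ _ (by omega) (by omega),
      Equiv.swap_apply_left]
    push_cast
    ring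

theorem natCast_ne_of_lt {a b : ℕ} (ha : 1 ≤ a) (hab : a < b) (hb : b ≤ n) :
    (a : ZMod n) ≠ (b : ZMod n) := by
  intro h
  rw [ZMod.natCast_eq_natCast_iff, Nat.modEq_iff_dvd' hab.le] at h
  have := Nat.le_of_dvd (by omega) h
  omega

theorem closure_perm_apply
    (hθ : ∀ k, 1 ≤ k → k < n → θ (g k) = Equiv.swap (k : ZMod n) ((k : ZMod n) + 1)) {k : ℕ}
    (hk : k + 1 < n) {x : Γ} (hx : x ∈ Subgroup.closure (g '' Set.Ico 1 (k + 1))) :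
    θ x ((k + 2 : ℕ) : ZMod n) = ((k + 2 : ℕ) : ZMod n) := by
  suffices h : Subgroup.closure (g '' Set.Ico 1 (k + 1)) ≤
      (MulAction.stabilizer (Equiv.Perm (ZMod n)) ((k + 2 : ℕ) : ZMod n)).comap θ from h hx
  rw [Subgroup.closure_le]
  rintro _ ⟨i, ⟨h1, h2⟩, rfl⟩
  change θ (g i) ((k + 2 : ℕ) : ZMod n) = _
  rw [hθ i h1 (by omega), Equiv.swap_apply_of_ne_of_ne]
  · exact (natCast_ne_of_lt h1 (by omega) (by omega)).symm
  · have := natCast_ne_of_lt (n := n) (a := i + 1) (b := k + 2) (by omega) (by omega) (by omega)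
    push_cast at this ⊢
    exact this.symm

/-- The descending tail moves `j` to `k + 2`, a point fixed by the remaining factor. A trivial
permutation therefore forces `j = k + 2`, an empty tail, and induction applies. -/
theorem IsBraidSeq.eq_one_of_perm_eq_one (hg : IsBraidSeq n g)
    (hsq : ∀ i, 1 ≤ i → i < n → g i * g i = 1)
    (hθ : ∀ k, 1 ≤ k → k < n → θ (g k) = Equiv.swap (k : ZMod n) ((k : ZMod n) + 1)) {k : ℕ}
    (hk : k < n) {x : Γ} (hx : x ∈ Subgroup.closure (g '' Set.Ico 1 (k + 1))) (hx1 : θ x = 1) :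
    x = 1 := by
  induction k generalizing x with
  | zero => simpa using hx
  | succ k ih =>
    obtain ⟨p, hp, j, hj, hjk, rfl⟩ := hg.exists_eq_mul_downProd hsq hk hx
    have h1 : θ (p * downProd g j (k + 2 - j)) (j : ZMod n) = (j : ZMod n) := by rw [hx1]; rfl
    rw [map_mul, Equiv.Perm.mul_apply, downProd_perm_apply θ hθ hj (by omega),
      show j + (k + 2 - j) = k + 2 by omega, closure_perm_apply θ hθ hk hp] at h1
    obtain rfl : j = k + 2 := by
      by_contra hne
      exact natCast_ne_of_lt hj (by omega) (by omega) h1.symm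
    rw [Nat.sub_self, downProd_zero, mul_one] at hx1 ⊢
    exact ih (by omega) hp hx1

theorem IsBraidSeq.closure_finite (hg : IsBraidSeq n g) (hn : 1 ≤ n)
    (hsq : ∀ i, 1 ≤ i → i < n → g i * g i = 1)
    (hθ : ∀ k, 1 ≤ k → k < n → θ (g k) = Equiv.swap (k : ZMod n) ((k : ZMod n) + 1)) :
    Finite (Subgroup.closure (g '' Set.Ico 1 n)) := by
  have : NeZero n := ⟨by omega⟩
  refine Finite.of_injective (θ.comp (Subgroup.closure (g '' Set.Ico 1 n)).subtype)
    ((injective_iff_map_eq_one _).2 fun x hx => Subtype.ext ?_)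
  refine hg.eq_one_of_perm_eq_one θ hsq hθ (k := n - 1) (by omega) ?_ hx
  rw [Nat.sub_add_cancel hn]
  exact x.2

/-- The normal closure of `X` acts trivially on residues while the finite part acts faithfully, so
they meet trivially; together they contain all generators. -/
theorem IsBraidX.isComplement' (hX : IsBraidX n g X) (hn : 1 ≤ n)
    (hsq : ∀ i, 1 ≤ i → i < n → g i * g i = 1)
    (htop : Subgroup.closure (insert X (g '' Set.Ico 1 n)) = ⊤)
    (hθ : ∀ k, 1 ≤ k → k < n → θ (g k) = Equiv.swap (k : ZMod n) ((k : ZMod n) + 1))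
    (hθX : θ X = 1) :
    Subgroup.IsComplement' (translations n g X) (Subgroup.closure (g '' Set.Ico 1 n)) := by
  have hnorm := hX.translations_normal hn hsq htop
  refine Subgroup.isComplement'_of_disjoint_and_mul_eq_univ ?_ ?_
  · rw [Subgroup.disjoint_def]
    intro x hx hx'
    refine hX.eq_one_of_perm_eq_one θ hsq hθ (k := n - 1) (by omega) ?_ ?_
    · rwa [Nat.sub_add_cancel hn]
    · rw [← hX.normalClosure_X hn hsq htop] at hx
      have : Subgroup.normalClosure {X} ≤ θ.ker :=
        Subgroup.normalClosure_le_normal (Set.singleton_subset_iff.2 hθX)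
      exact this hx
  · rw [← Subgroup.normal_mul, ← Subgroup.coe_top, ← htop]
    refine congrArg _ (le_antisymm (htop ▸ le_top) ?_)
    rw [Subgroup.closure_le]
    rintro _ (rfl | h)
    · exact Subgroup.mem_sup_left (Subgroup.subset_closure ⟨0, hn, rfl⟩)
    · exact Subgroup.mem_sup_right (Subgroup.subset_closure h)

end TranslationSubgroup

end AffineYokonuma

namespace AffineYokonuma

/-! ### The Coxeter matrix is of affine type -/

section AffineType

variable {n : ℕ}

/-- For `n = 2` the two neighbours of an index coincide, so the two halves add up to the entry `-1`
of the infinite bond. -/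
theorem coxeterForm_affineA (i j : AffIdx n) : ProPIwahori.coxeterForm (affineA n) i j =
    (if i = j then 1 else 0) -
      ((if j = i.succ then 1 else 0) + (if i = j.succ then 1 else 0)) / 2 := by
  rw [ProPIwahori.coxeterForm, affineA_apply]
  have h1 : i ≠ i.succ := fun h => AffIdx.add_one_ne i (congrArg Subtype.val h).symm
  have hs : i.1 - j.1 = 1 ↔ i = j.succ := by
    rw [sub_eq_iff_eq_add, AffIdx.ext_iff, AffIdx.succ_val, add_comm]
  have hs' : i.1 - j.1 = -1 ↔ j = i.succ := by
    rw [← neg_sub, neg_inj, sub_eq_iff_eq_add, AffIdx.ext_iff, AffIdx.succ_val, add_comm]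
  by_cases hij : i = j
  · subst hij
    simp [h1]
  simp only [if_neg hij, hs, hs']
  obtain hn | hn : n = 2 ∨ 3 ≤ n := by have := i.2; omega
  · subst hn
    have h2 : ∀ a b : ZMod 2, a ≠ b → b = a + 1 ∧ a = b + 1 := by decide
    obtain ⟨h3, h4⟩ := h2 i.1 j.1 fun h => hij (AffIdx.ext h)
    rw [if_pos (AffIdx.ext h3), if_pos (AffIdx.ext h4)]
    simp
  · rw [if_neg (by omega : n ≠ 2)]
    by_cases h3 : i = j.succ
    · have h4 : j ≠ i.succ := fun h => by
        rw [h] at h3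
        have := congrArg Subtype.val h3
        simp only [AffIdx.succ_val, add_assoc, left_eq_add] at this
        exact two_ne_zero_of_three_le hn (by rw [← this]; norm_num)
      rw [if_pos (Or.inl h3), if_pos h3, if_neg h4]
      norm_num [Real.cos_pi_div_three]
    · by_cases h4 : j = i.succ
      · rw [if_pos (Or.inr h4), if_pos h4, if_neg h3]
        norm_num [Real.cos_pi_div_three]
      · rw [if_neg (by tauto), if_neg h3, if_neg h4]
        norm_num [Real.cos_pi_div_two]

/-- The matrix of `x ↦ (x_i - x_{i+1})_i`. -/
def cyclicDiff (n : ℕ) : Matrix (AffIdx n) (AffIdx n) ℝ :=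
  fun i j => (if i = j then 1 else 0) - if i = j.pred then 1 else 0

variable [NeZero n]

/-- The quadratic form is `½ ∑ (x_i - x_{i+1})²`, which shows positivity and puts the constant
vectors in the radical. -/
theorem coxeterForm_affineA_eq : ProPIwahori.coxeterForm (affineA n) =
    (1 / 2 : ℝ) • ((cyclicDiff n).conjTranspose * cyclicDiff n) := by
  ext i j
  have h1 : (i.pred = j.pred) ↔ i = j :=
    ⟨fun h => by rw [← AffIdx.succ_pred i, h, AffIdx.succ_pred], fun h => by rw [h]⟩
  have h2 : i.pred = j ↔ i = j.succ :=
    ⟨fun h => by rw [← h, AffIdx.succ_pred], fun h => by rw [h, AffIdx.pred_succ]⟩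
  have h3 : i = j.pred ↔ j = i.succ :=
    ⟨fun h => by rw [h, AffIdx.succ_pred], fun h => by rw [h, AffIdx.pred_succ]⟩
  rw [coxeterForm_affineA]
  simp only [Matrix.smul_apply, Matrix.mul_apply, Matrix.conjTranspose_apply, cyclicDiff,
    star_trivial, sub_mul, mul_sub, ite_mul, one_mul, zero_mul, Finset.sum_sub_distrib,
    Finset.sum_ite_eq', Finset.mem_univ, if_true, h1, h2, h3, smul_eq_mul]
  ring

theorem isAffine_affineA : ProPIwahori.IsAffine (affineA n) := by
  rw [ProPIwahori.IsAffine, coxeterForm_affineA_eq]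
  refine ⟨(Matrix.posSemidef_conjTranspose_mul_self _).smul (by norm_num), fun _ => 1,
    fun _ => one_pos, ?_⟩
  have h : (cyclicDiff n).mulVec (fun _ => 1) = 0 := by
    ext i
    have : ∀ j : AffIdx n, i = j.pred ↔ i.succ = j := fun j =>
      ⟨fun h => by rw [h, AffIdx.succ_pred], fun h => by rw [← h, AffIdx.pred_succ]⟩
    simp [Matrix.mulVec, dotProduct, cyclicDiff, this]
  rw [Matrix.smul_mulVec, ← Matrix.mulVec_mulVec, h, Matrix.mulVec_zero, smul_zero]

end AffineType

/-! ### Natural number indices and permutations of residues -/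

section NaturalIndices

variable {r n : ℕ}

theorem natCast_ne_zero_of_lt {k : ℕ} (h1 : 1 ≤ k) (h2 : k < n) : (k : ZMod n) ≠ 0 := by
  simpa using natCast_ne_of_lt (n := n) h1 h2 le_rfl

theorem ws_of_two_le (hn : 2 ≤ n) (k : ℕ) : ws r n k = w r (.s ⟨(k : ZMod n), hn⟩) := by
  rw [ws, dif_pos hn]

theorem ws_natCast_mul_self (k : ℕ) : ws r n k * ws r n k = 1 := by
  rw [ws]
  split_ifs
  exacts [ws_mul_self _, one_mul 1]

theorem IsAffineBraid.isBraidSeq {A : Type*} [Monoid A] {f : AffIdx n → A} (hf : IsAffineBraid f)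
    (hn : 2 ≤ n) : IsBraidSeq n fun k => f ⟨(k : ZMod n), hn⟩ where
  comm i j h1 h2 h3 := by
    refine hf.comm _ _ (fun h => ?_) fun h => ?_
    · have := natCast_ne_of_lt (n := n) (a := i) (b := j + 1) h1 (by omega) (by omega)
      push_cast at this
      exact this (by rw [← sub_eq_iff_eq_add'.1 h])
    · have := natCast_ne_of_lt (n := n) (a := i + 1) (b := j) (by omega) (by omega) (by omega)
      push_cast at this
      exact this (by linear_combination (exp := 1) h)
  braid i h1 h2 := by
    have := hf.braid (by omega) ⟨(i : ZMod n), hn⟩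
    simpa only [AffIdx.succ, Nat.cast_add, Nat.cast_one] using this

theorem wX_eq : wX r n = (downProd (ws r n) 1 (n - 1))⁻¹ * w r .rho := by
  have : ∀ k, upProd (ws r n) 1 k = (downProd (ws r n) 1 k)⁻¹ := by
    intro k
    induction k with
    | zero => simp
    | succ k ih =>
      rw [upProd_succ, downProd_succ, mul_inv_rev, ih, inv_eq_of_mul_eq_one_left
        (ws_natCast_mul_self _)]
  rw [← this]
  rfl

theorem pred_natCast_succ (hn : 2 ≤ n) (i : ℕ) :
    AffIdx.pred (⟨((i + 1 : ℕ) : ZMod n), hn⟩ : AffIdx n) = ⟨(i : ZMod n), hn⟩ := by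
  ext
  simp

theorem pred_pred_one (hn : 2 ≤ n) : (AffIdx.pred (⟨((1 : ℕ) : ZMod n), hn⟩ : AffIdx n)).pred =
    ⟨((n - 1 : ℕ) : ZMod n), hn⟩ := by
  ext
  simp [Nat.cast_sub (show 1 ≤ n by omega)]

end NaturalIndices

section Perm

variable {Γ : Type*} [Group Γ] {n : ℕ} {g : ℕ → Γ} (θ : Γ →* Equiv.Perm (ZMod n))

theorem perm_downProd_apply
    (hθ : ∀ k, 1 ≤ k → k < n → θ (g k) = Equiv.swap (k : ZMod n) ((k : ZMod n) + 1)) {j k : ℕ}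
    (h1 : 1 ≤ j) (hj : j < n) (hk : k < n) :
    θ (downProd g 1 k) ((j + 1 : ℕ) : ZMod n) = ((if j ≤ k then j else j + 1 : ℕ) : ZMod n) := by
  have hne : ∀ a b : ℕ, 1 ≤ a → 1 ≤ b → a ≤ n → b ≤ n → a ≠ b → (a : ZMod n) ≠ (b : ZMod n) := by
    intro a b ha hb han hbn hab
    obtain h | h := Nat.lt_or_gt_of_ne hab
    · exact natCast_ne_of_lt ha h hbn
    · exact (natCast_ne_of_lt hb h han).symm
  induction k with
  | zero => simp [show ¬ j ≤ 0 by omega]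
  | succ k ih =>
    have hθ' := hθ (1 + k) (by omega) (by omega)
    rw [downProd_succ, map_mul, Equiv.Perm.mul_apply, ih (by omega), hθ']
    have hcast : ((1 + k : ℕ) : ZMod n) + 1 = ((1 + k + 1 : ℕ) : ZMod n) := by push_cast; rfl
    rw [hcast]
    obtain h | h | h : j ≤ k ∨ j = k + 1 ∨ k + 1 < j := by omega
    · rw [if_pos h, if_pos (by omega), Equiv.swap_apply_of_ne_of_ne] <;>
        exact hne _ _ (by omega) (by omega) (by omega) (by omega) (by omega)
    · rw [if_neg (by omega), if_pos (by omega), h, add_comm 1 k, Equiv.swap_apply_right]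
    · rw [if_neg (by omega), if_neg (by omega), Equiv.swap_apply_of_ne_of_ne] <;>
        exact hne _ _ (by omega) (by omega) (by omega) (by omega) (by omega)

/-- The descending product sends `j + 1` to `j` and `1` to `n`: it acts like `ρ`. -/
theorem perm_downProd_eq [NeZero n]
    (hθ : ∀ k, 1 ≤ k → k < n → θ (g k) = Equiv.swap (k : ZMod n) ((k : ZMod n) + 1)) :
    θ (downProd g 1 (n - 1)) = Equiv.subRight 1 := by
  have hn := NeZero.pos n
  ext x
  obtain ⟨j, hj, rfl⟩ : ∃ j < n, x = ((j + 1 : ℕ) : ZMod n) :=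
    ⟨(x - 1).val, ZMod.val_lt _, by simp⟩
  obtain rfl | h1 := Nat.eq_zero_or_pos j
  · have := downProd_perm_apply θ hθ (j := 1) (m := n - 1) le_rfl (by omega)
    rw [zero_add, this, Equiv.subRight_apply]
    simp [show 1 + (n - 1) = n by omega]
  · rw [perm_downProd_apply θ hθ h1 hj (by omega), if_pos (by omega), Equiv.subRight_apply]
    simp

end Perm

/-! ### The group-theoretic datum -/

section Datum

variable (r n : ℕ) [NeZero n]

/-- The extended affine Weyl group as a quotient of `Ŵ_{r,n}`. -/
noncomputable def quotEquiv : ExtAff n ≃* WGroup r n ⧸ torus r n :=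
  ((QuotientGroup.quotientMulEquivOfEq (ker_wproj (r := r) (n := n)).symm).trans
    (QuotientGroup.quotientKerEquivOfSurjective _ wproj_surjective)).symm

variable {r n}

theorem quotEquiv_symm_mk (g : WGroup r n) : (quotEquiv r n).symm g = wproj r n g := rfl

theorem quotEquiv_wproj (g : WGroup r n) : quotEquiv r n (wproj r n g) = g := by
  rw [← quotEquiv_symm_mk, MulEquiv.apply_symm_apply]

theorem quotEquiv_es (i : AffIdx n) : quotEquiv r n (es i) = (w r (.s i) : WGroup r n) := by
  rw [← wproj_s (r := r), quotEquiv_wproj]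

theorem quotEquiv_eρ : quotEquiv r n (eρ n) = (w r .rho : WGroup r n) := by
  rw [← wproj_rho (r := r), quotEquiv_wproj]

variable (r n)

/-- The embedding of the affine Weyl group in the quotient of `Ŵ_{r,n}`. -/
noncomputable def coxHom : Cox n →* WGroup r n ⧸ torus r n :=
  (quotEquiv r n).toMonoidHom.comp SemidirectProduct.inl

variable {r n}

theorem coxHom_injective : Function.Injective (coxHom r n) :=
  (quotEquiv r n).injective.comp SemidirectProduct.inl_injective

instance coxHom_range_normal : (coxHom r n).range.Normal := by
  rw [coxHom, MonoidHom.range_comp, SemidirectProduct.range_inl_eq_ker_rightHom]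
  exact Subgroup.Normal.map inferInstance _ (quotEquiv r n).surjective

theorem isComplement'_coxHom_range :
    Subgroup.IsComplement' (coxHom r n).range
      (Subgroup.zpowers ((w r .rho : WGroup r n) : WGroup r n ⧸ torus r n)) := by
  refine Subgroup.isComplement'_of_disjoint_and_mul_eq_univ ?_ ?_
  · rw [Subgroup.disjoint_def]
    rintro _ ⟨x, rfl⟩ ⟨k, hk⟩
    simp only [← quotEquiv_eρ, ← map_zpow, coxHom, MonoidHom.comp_apply] at hk
    have := congrArg SemidirectProduct.right ((quotEquiv r n).injective hk)
    rw [eρ_zpow, SemidirectProduct.right_inr, SemidirectProduct.right_inl] at this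
    rw [eρ_zpow, this, map_one] at hk
    exact hk.symm.trans (map_one _)
  · refine Set.eq_univ_of_forall fun x => ?_
    obtain ⟨x, rfl⟩ := (quotEquiv r n).surjective x
    refine ⟨coxHom r n x.left, ⟨x.left, rfl⟩, quotEquiv r n (SemidirectProduct.inr x.right),
      ⟨x.right.toAdd, ?_⟩, ?_⟩
    · simp only [← quotEquiv_eρ, ← map_zpow, eρ_zpow, ofAdd_toAdd]
    · change quotEquiv r n (SemidirectProduct.inl x.left) * _ = _
      rw [← map_mul, SemidirectProduct.inl_left_mul_inr_right]

variable (r n)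

/-- The affine Weyl group, as a subgroup of the quotient of `Ŵ_{r,n}`, is a Coxeter group. -/
noncomputable def affineCoxeterSystem : CoxeterSystem (affineA n) (coxHom r n).range :=
  (cox n).map (MonoidHom.ofInjective coxHom_injective)

variable {r n}

theorem affineCoxeterSystem_simple (i : AffIdx n) :
    ((affineCoxeterSystem r n).simple i : WGroup r n ⧸ torus r n) = (w r (.s i) : WGroup r n) := by
  rw [affineCoxeterSystem, CoxeterSystem.map_simple, ← quotEquiv_es]
  rfl

theorem image_simple_eq :
    (fun i => ((affineCoxeterSystem r n).simple i : WGroup r n ⧸ torus r n)) '' {i | i.1 ≠ 0} =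
      (fun k => (ws r n k : WGroup r n ⧸ torus r n)) '' Set.Ico 1 n := by
  ext x
  constructor
  · rintro ⟨i, hi, rfl⟩
    refine ⟨i.1.val, ⟨Nat.one_le_iff_ne_zero.2 ((ZMod.val_ne_zero _).2 hi), ZMod.val_lt _⟩, ?_⟩
    simp only [ws, dif_pos i.2, affineCoxeterSystem_simple, ZMod.natCast_val, ZMod.cast_id', id]
  · rintro ⟨k, ⟨h1, h2⟩, rfl⟩
    have hn : 2 ≤ n := by omega
    exact ⟨⟨k, hn⟩, natCast_ne_zero_of_lt h1 h2, by
      simp only [ws, dif_pos hn, affineCoxeterSystem_simple]⟩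

theorem isBraidX_ws : IsBraidX n (ws r n) (wX r n) := by
  rw [wX_eq]
  obtain hn | hn := lt_or_ge n 2
  · have : n = 1 := by have := NeZero.ne n; omega
    subst this
    exact ⟨⟨fun _ _ _ _ _ => by omega, fun _ _ _ => by omega⟩, fun _ => by omega,
      fun _ _ _ => by omega⟩
  · have hw : ws r n = fun k : ℕ => w r (.s ⟨(k : ZMod n), hn⟩) := funext (ws_of_two_le hn)
    rw [hw]
    refine (isAffineBraid_ws.isBraidSeq hn).isBraidX (fun i h1 h2 => ?_) fun _ => ?_
    · rw [wrho_mul_ws, pred_natCast_succ]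
    · rw [mul_assoc, wrho_mul_ws, ← mul_assoc, wrho_mul_ws, pred_pred_one, mul_assoc]

/-- One recovers `ρ` as `s_{n-1} ⋯ s_1 X_1`, then `s_0` as `ρ s_1 ρ⁻¹`; the torus is trivial in the
quotient. -/
theorem closure_insert_mk :
    Subgroup.closure (insert (wX r n : WGroup r n ⧸ torus r n)
      ((fun k => (ws r n k : WGroup r n ⧸ torus r n)) '' Set.Ico 1 n)) = ⊤ := by
  set K := Subgroup.closure (insert (wX r n : WGroup r n ⧸ torus r n)
    ((fun k => (ws r n k : WGroup r n ⧸ torus r n)) '' Set.Ico 1 n))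
  have hg : ∀ k, 1 ≤ k → k < n → ((ws r n k : WGroup r n) : WGroup r n ⧸ torus r n) ∈ K :=
    fun k h1 h2 => Subgroup.subset_closure (Or.inr ⟨k, ⟨h1, h2⟩, rfl⟩)
  have hX : (wX r n : WGroup r n ⧸ torus r n) ∈ K := Subgroup.subset_closure (Or.inl rfl)
  have hρ : ((w r .rho : WGroup r n) : WGroup r n ⧸ torus r n) ∈ K := by
    have hD : ∀ k, k < n →
        ((downProd (ws r n) 1 k : WGroup r n) : WGroup r n ⧸ torus r n) ∈ K := by
      intro k hk
      induction k with
      | zero => exact K.one_mem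
      | succ k ih =>
        rw [downProd_succ, QuotientGroup.mk_mul]
        exact mul_mem (hg _ (by omega) (by omega)) (ih (by omega))
    have h := mul_mem (hD (n - 1) (Nat.sub_lt (NeZero.pos n) one_pos)) hX
    rwa [wX_eq, ← QuotientGroup.mk_mul, mul_inv_cancel_left] at h
  have hs : ∀ i : AffIdx n, i.1 ≠ 0 →
      ((w r (.s i) : WGroup r n) : WGroup r n ⧸ torus r n) ∈ K := by
    intro i hi
    have := hg i.1.val (Nat.one_le_iff_ne_zero.2 ((ZMod.val_ne_zero _).2 hi)) (ZMod.val_lt _)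
    rwa [ws_of_two_le i.2, show (⟨((i.1.val : ℕ) : ZMod n), i.2⟩ : AffIdx n) = i from
      AffIdx.ext (by simp)] at this
  refine eq_top_iff.2 fun x _ => ?_
  obtain ⟨x, rfl⟩ := QuotientGroup.mk_surjective x
  induction x using wgroup_induction with
  | one => exact K.one_mem
  | mul a b ha hb => exact mul_mem (ha trivial) (hb trivial)
  | inv a ha => exact inv_mem (ha trivial)
  | hgen x =>
    cases x with
    | t j =>
      rw [(QuotientGroup.eq_one_iff _).2 (wt_mem_torus j)]
      exact K.one_mem
    | rho => exact hρ
    | s i =>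
      by_cases hi : i.1 = 0
      · have hi' : i.succ.1 ≠ 0 := by
          rw [AffIdx.succ_val, hi, zero_add]
          exact one_ne_zero_of_two_le i.2
        have h : w r (.s i) = w r .rho * w r (.s i.succ) * (w r .rho)⁻¹ := by
          rw [wrho_mul_ws, AffIdx.pred_succ, mul_inv_cancel_right]
        rw [h, QuotientGroup.mk_mul, QuotientGroup.mk_mul, QuotientGroup.mk_inv]
        exact mul_mem (mul_mem hρ (hs _ hi')) (inv_mem hρ)
      · exact hs i hi

theorem isBraidX_mk : IsBraidX n (fun k => (ws r n k : WGroup r n ⧸ torus r n)) (wX r n) where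
  toIsBraidSeq := isBraidX_ws.toIsBraidSeq.map (QuotientGroup.mk' (torus r n))
  one hn := congrArg (QuotientGroup.mk' (torus r n)) (isBraidX_ws.one hn)
  comm_X i h1 h2 := congrArg (QuotientGroup.mk' (torus r n)) (isBraidX_ws.comm_X i h1 h2)

theorem ws_sq_mk (k : ℕ) (_ : 1 ≤ k) (_ : k < n) :
    (ws r n k : WGroup r n ⧸ torus r n) * (ws r n k : WGroup r n) = 1 :=
  congrArg (QuotientGroup.mk' (torus r n)) (ws_natCast_mul_self k)

variable (r n)

/-- The action of the quotient of `Ŵ_{r,n}` on residues modulo `n`. -/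
noncomputable def quotPerm : WGroup r n ⧸ torus r n →* Equiv.Perm (ZMod n) :=
  (extPerm n).comp (quotEquiv r n).symm.toMonoidHom

variable {r n}

theorem quotPerm_mk (g : WGroup r n) :
    quotPerm r n (g : WGroup r n ⧸ torus r n) = extPerm n (wproj r n g) := rfl

theorem quotPerm_ws {k : ℕ} (h1 : 1 ≤ k) (h2 : k < n) :
    quotPerm r n (ws r n k) = Equiv.swap (k : ZMod n) ((k : ZMod n) + 1) := by
  rw [quotPerm_mk, ws_of_two_le (by omega), wproj_s, extPerm_es]

theorem quotPerm_wX : quotPerm r n (wX r n) = 1 := by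
  rw [wX_eq, QuotientGroup.mk_mul, QuotientGroup.mk_inv, map_mul, map_inv, inv_mul_eq_one]
  have h := perm_downProd_eq (quotPerm r n) (g := fun k => (ws r n k : WGroup r n ⧸ torus r n))
    (fun k h1 h2 => quotPerm_ws h1 h2)
  have h' := map_downProd (g := ws r n) (QuotientGroup.mk' (torus r n)) 1 (n - 1)
  simp only [QuotientGroup.mk'_apply] at h'
  rw [h', h, quotPerm_mk, wproj_rho, extPerm_eρ]

theorem exists_conj_zpow_simple (k : ℤ) (i : AffIdx n) :
    ∃ j, ((w r .rho : WGroup r n) : WGroup r n ⧸ torus r n) ^ k *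
      ((affineCoxeterSystem r n).simple i : WGroup r n ⧸ torus r n) *
      (((w r .rho : WGroup r n) : WGroup r n ⧸ torus r n) ^ k)⁻¹ =
        (affineCoxeterSystem r n).simple j := by
  obtain ⟨j, hj⟩ := rot_zpow_simple (n := n) k i
  refine ⟨j, ?_⟩
  have h : eρ n ^ k * es i * (eρ n ^ k)⁻¹ = es j := by
    rw [eρ_zpow, ← map_inv, es, ← SemidirectProduct.inl_aut, es, ← hj, zpowersHom_apply,
      toAdd_ofAdd]
  simp only [affineCoxeterSystem_simple, ← quotEquiv_es, ← quotEquiv_eρ, ← map_zpow, ← map_inv,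
    ← map_mul, h]

theorem affineCoxeterSystem_length (x : Cox n) :
    (affineCoxeterSystem r n).length (MonoidHom.ofInjective coxHom_injective x) =
      (cox n).length x := by
  have h : ∀ l : List (AffIdx n), (affineCoxeterSystem r n).wordProd l =
      MonoidHom.ofInjective coxHom_injective ((cox n).wordProd l) := by
    intro l
    rw [affineCoxeterSystem, CoxeterSystem.wordProd, CoxeterSystem.wordProd, map_list_prod,
      List.map_map]
    rfl
  refine le_antisymm ?_ ?_
  · obtain ⟨l, hl, rfl⟩ := (cox n).exists_isReduced x
    rw [← h, hl.eq]
    exact CoxeterSystem.length_wordProd_le _ _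
  · obtain ⟨l, hl, hx⟩ := (affineCoxeterSystem r n).exists_isReduced
      (MonoidHom.ofInjective coxHom_injective x)
    rw [hx, hl.eq]
    rw [h, (MonoidHom.ofInjective coxHom_injective).injective.eq_iff] at hx
    rw [hx]
    exact CoxeterSystem.length_wordProd_le _ _

variable (r n) in
/-- The group-theoretic data of the pro-`p`-Iwahori–Hecke algebra. -/
noncomputable def datum [NeZero r] : ProPIwahori.Datum (WGroup r n) (affineA n) where
  affine := isAffine_affineA
  Z := torus r n
  Z_normal := torus_normal
  Z_finite := torus_finite
  Z_comm _ hx _ hy := torus_comm hx hy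
  Waff := (coxHom r n).range
  Waff_normal := coxHom_range_normal
  cs := affineCoxeterSystem r n
  Ω := Subgroup.zpowers ((w r .rho : WGroup r n) : WGroup r n ⧸ torus r n)
  Ω_comm _ hx _ hy := congrArg Subtype.val (mul_comm' (⟨_, hx⟩ : Subgroup.zpowers _) ⟨_, hy⟩)
  Ω_fg := (Subgroup.fg_iff _).2 ⟨{_}, (Subgroup.zpowers_eq_closure _).symm, Set.finite_singleton _⟩
  Waff_Ω := isComplement'_coxHom_range
  Ω_conj := by
    rintro _ ⟨k, rfl⟩ i
    exact exists_conj_zpow_simple k i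
  I₀ := {i | i.1 ≠ 0}
  Λ := Subgroup.normalClosure {((wX r n : WGroup r n) : WGroup r n ⧸ torus r n)}
  Λ_normal := Subgroup.normalClosure_normal
  Λ_comm := by
    rw [isBraidX_mk.normalClosure_X (NeZero.pos n) ws_sq_mk closure_insert_mk]
    exact isBraidX_mk.translations_comm ws_sq_mk
  Λ_fg := by
    rw [isBraidX_mk.normalClosure_X (NeZero.pos n) ws_sq_mk closure_insert_mk]
    exact translations_fg
  W₀_finite := by
    rw [image_simple_eq]
    exact isBraidX_mk.closure_finite (quotPerm r n) (NeZero.pos n) ws_sq_mk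
      fun _ h1 h2 => quotPerm_ws h1 h2
  Λ_W₀ := by
    rw [image_simple_eq, isBraidX_mk.normalClosure_X (NeZero.pos n) ws_sq_mk closure_insert_mk]
    exact isBraidX_mk.isComplement' (quotPerm r n) (NeZero.pos n) ws_sq_mk closure_insert_mk
      (fun _ h1 h2 => quotPerm_ws h1 h2) quotPerm_wX

/-- Uniqueness of the factorization along `Waff` and `Ω` identifies the abstract affine component
with the one in the semidirect product. -/
theorem datum_length [NeZero r] (g : WGroup r n) : (datum r n).length g = wlen g := by
  have hg : (g : WGroup r n ⧸ torus r n) =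
      (MonoidHom.ofInjective coxHom_injective (wproj r n g).left : (coxHom r n).range) *
        ((w r .rho : WGroup r n) : WGroup r n ⧸ torus r n) ^ (wproj r n g).right.toAdd := by
    rw [← quotEquiv_eρ, ← map_zpow, eρ_zpow, ofAdd_toAdd]
    change _ = quotEquiv r n (SemidirectProduct.inl _) * _
    rw [← map_mul, SemidirectProduct.inl_left_mul_inr_right, quotEquiv_wproj]
  have h := (isComplement'_coxHom_range (r := r) (n := n)).equiv_mul_right_of_mem
    (g := (MonoidHom.ofInjective coxHom_injective (wproj r n g).left : (coxHom r n).range))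
    (Subgroup.zpow_mem_zpowers ((w r .rho : WGroup r n) : WGroup r n ⧸ torus r n)
      (wproj r n g).right.toAdd)
  rw [ProPIwahori.Datum.length]
  have h1 : (Subgroup.IsComplement.equiv (datum r n).Waff_Ω (g : WGroup r n ⧸ torus r n)).1 =
      MonoidHom.ofInjective coxHom_injective (wproj r n g).left := by
    refine Eq.trans ?_ ((congrArg Prod.fst h).trans
      ((isComplement'_coxHom_range (r := r) (n := n)).equiv_fst_eq_self_of_mem_of_one_mem
        (one_mem _) (Subtype.coe_prop _)))
    rw [← hg]
    rfl
  exact (congrArg (affineCoxeterSystem r n).length h1).trans (affineCoxeterSystem_length _)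

end Datum

end AffineYokonuma

namespace AffineYokonuma

variable {r n : ℕ}

/-! ### The parameters -/

section Parameters

/-- The inclusion of the group algebra of the torus in the group algebra of `Ŵ_{r,n}`. -/
noncomputable def torusVal (r n : ℕ) :
    MonoidAlgebra (Ground r) (torus r n) →ₐ[Ground r] WAlg r n :=
  MonoidAlgebra.mapDomainAlgHom (Ground r) (Ground r) (torus r n).subtype

theorem torusVal_apply (c : MonoidAlgebra (Ground r) (torus r n)) :
    torusVal r n c = MonoidAlgebra.mapDomain (Subtype.val : torus r n → WGroup r n) c := rfl

theorem torusVal_of (z : torus r n) :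
    torusVal r n (MonoidAlgebra.of (Ground r) _ z) = δ (z : WGroup r n) := by
  rw [torusVal_apply, MonoidAlgebra.of_apply, MonoidAlgebra.mapDomain_single]
  rfl

theorem torusVal_injective : Function.Injective (torusVal r n) :=
  MonoidAlgebra.mapDomain_injective Subtype.val_injective

theorem torusVal_eq_sum (c : MonoidAlgebra (Ground r) (torus r n)) :
    torusVal r n c = c.coeff.sum fun z a => a • δ (z : WGroup r n) := by
  rw [torusVal_apply, MonoidAlgebra.mapDomain, Finsupp.mapDomain, MonoidAlgebra.ofCoeff_finsuppSum]
  simp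

/-- The element `e_i` of the group algebra of the torus. -/
noncomputable def torusE (r : ℕ) {n : ℕ} (i : AffIdx n) : MonoidAlgebra (Ground r) (torus r n) :=
  rInv r • ∑ s ∈ Finset.range r, MonoidAlgebra.of (Ground r) (torus r n)
    ((⟨w r (.t i.1), wt_mem_torus _⟩ : torus r n) ^ s *
      ((⟨w r (.t (i.1 + 1)), wt_mem_torus _⟩ : torus r n) ^ s)⁻¹)

theorem torusVal_torusE (i : AffIdx n) : torusVal r n (torusE r i) = wE r i := by
  simp only [torusE, wE, map_smul, map_sum, torusVal_of]
  rfl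

open Classical in
/-- The parameter `c_{z s_i} = (q - q⁻¹) z e_i`. -/
noncomputable def cParam (r n : ℕ) (g : WGroup r n) : MonoidAlgebra (Ground r) (torus r n) :=
  if hg : ∃ (z : torus r n) (i : AffIdx n), g = z * w r (.s i) then
    (q r - qInv r) • (MonoidAlgebra.of (Ground r) (torus r n) hg.choose *
      torusE r hg.choose_spec.choose)
  else 0

variable [NeZero n]

/-- This one identity gives the equivariance of the parameters and, for `g = 1`, their independence
of the chosen expression `z s_i`. -/
theorem δ_mul_wE_conj {i j : AffIdx n} {z z' : WGroup r n} (hz : z ∈ torus r n)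
    (hz' : z' ∈ torus r n) {g : WGroup r n}
    (hg : g * (z * w r (.s i)) * g⁻¹ = z' * w r (.s j)) :
    δ g * (δ z * wE r i) = δ z' * wE r j * δ g := by
  have hg' : g * z * w r (.s i) = z' * (w r (.s j) * g) := by
    rw [mul_inv_eq_iff_eq_mul] at hg
    simpa only [mul_assoc] using hg
  have hp : wproj r n (w r (.s j) * g) = wproj r n (g * w r (.s i)) := by
    have := congrArg (wproj r n) hg'
    simp only [map_mul, wproj_of_mem_torus hz, wproj_of_mem_torus hz', mul_one, one_mul] at this
    simp only [map_mul, this]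
  have h1 := δ_mul_wE_of_wproj_eq hp
  -- A factor `s_i` on the right makes `δ_mul_wE_of_wproj_eq` applicable; it is cancelled
  -- afterwards.
  have h2 : δ g * (δ z * wE r i) * δ (w r (.s i)) = δ z' * wE r j * δ g * δ (w r (.s i)) := by
    rw [mul_assoc, mul_assoc (δ z), ← δ_ws_mul_wE, mul_assoc (δ z' * _), ← map_mul,
      mul_assoc (δ z'),
      ← h1, ← mul_assoc, ← mul_assoc, ← mul_assoc, ← map_mul, ← map_mul, ← map_mul, hg']
  have h3 := congrArg (fun x => x * δ (w r (.s i))) h2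
  simpa only [mul_assoc, ← map_mul, ws_mul_self, map_one, mul_one] using h3

theorem torusVal_cParam {z : WGroup r n} (hz : z ∈ torus r n) (i : AffIdx n) :
    torusVal r n (cParam r n (z * w r (.s i))) = (q r - qInv r) • (δ z * wE r i) := by
  have hg : ∃ (z' : torus r n) (j : AffIdx n), z * w r (.s i) = z' * w r (.s j) := ⟨⟨z, hz⟩, i, rfl⟩
  rw [cParam, dif_pos hg, map_smul, map_mul, torusVal_of, torusVal_torusE]
  have := δ_mul_wE_conj (g := 1) hz hg.choose.2
    (by rw [one_mul, inv_one, mul_one]; exact hg.choose_spec.choose_spec)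
  rw [δ, map_one, one_mul, mul_one] at this
  rw [this]

theorem wlen_ws (i : AffIdx n) : wlen (w r (.s i)) = 1 := by
  have := wlen_ws_mul (r := r) i 1
  rw [mul_one, wlen_one] at this
  omega

variable [NeZero r]

theorem mem_Saff1_iff {g : WGroup r n} :
    g ∈ (datum r n).Saff1 ↔ ∃ z ∈ torus r n, ∃ i, g = z * w r (.s i) := by
  have h1 : ∀ i, (((datum r n).cs.simple i : (datum r n).Waff) : WGroup r n ⧸ (datum r n).Z) =
      (w r (.s i) : WGroup r n) := affineCoxeterSystem_simple
  simp only [ProPIwahori.Datum.Saff1, Set.mem_ofPred_eq, h1]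
  constructor
  · rintro ⟨i, hi⟩
    refine ⟨g * (w r (.s i))⁻¹, ?_, i, by rw [inv_mul_cancel_right]⟩
    have := QuotientGroup.eq.1 hi.symm
    have h2 := torus_normal.conj_mem _ this (w r (.s i))
    rwa [mul_inv_cancel_left] at h2
  · rintro ⟨z, hz, i, rfl⟩
    refine ⟨i, ?_⟩
    have : ((z * w r (.s i) : WGroup r n) : WGroup r n ⧸ torus r n) =
        (w r (.s i) : WGroup r n) := by
      rw [QuotientGroup.mk_mul, (QuotientGroup.eq_one_iff z).2 hz, one_mul]
    exact this

/-- All identities are checked in the group algebra of the large group, into which the group algebra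
of the torus embeds. -/
theorem isParameter_cParam :
    (datum r n).IsParameter (fun _ => (1 : Ground r)) (cParam r n) where
  q_mul _ _ _ := rfl
  q_conj _ _ _ _ := rfl
  c_mul s hs t := by
    obtain ⟨z, hz, i, rfl⟩ := mem_Saff1_iff.1 hs
    refine torusVal_injective ?_
    -- Crossing `s_i` replaces `t` by its conjugate, which `e_i` does not distinguish from `t`.
    have h1 : z * w r (.s i) * t = z * (w r (.s i) * t * (w r (.s i))⁻¹) * w r (.s i) := by group
    have h2 : w r (.s i) * t * (w r (.s i))⁻¹ ∈ torus r n := torus_normal.conj_mem _ t.2 _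
    refine Eq.trans ?_ (map_mul (torusVal r n) _ _).symm
    rw [h1, torusVal_cParam (mul_mem hz h2), torusVal_cParam hz]
    refine Eq.trans ?_ (congrArg _ (torusVal_of t).symm)
    rw [smul_mul_assoc, δ, map_mul, mul_assoc, wE_eq_idem, δ_mul_idem_of_mem_torus h2, ← wE_eq_idem,
      wE_mul_δ_conj i t.2, mul_assoc]
  c_conj s hs g hg := by
    obtain ⟨z, hz, i, rfl⟩ := mem_Saff1_iff.1 hs
    obtain ⟨z', hz', j, h⟩ := mem_Saff1_iff.1 hg
    refine torusVal_injective ?_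
    have key : ∀ c : MonoidAlgebra (Ground r) (torus r n),
        torusVal r n (MonoidAlgebra.mapDomain (MulAut.conjNormal g) c) =
          δ g * torusVal r n c * δ g⁻¹ := by
      intro c
      rw [torusVal_eq_sum c, MonoidAlgebra.mapDomain, Finsupp.mapDomain,
        MonoidAlgebra.ofCoeff_finsuppSum, map_finsuppSum, Finsupp.mul_sum, Finsupp.sum_mul]
      refine Finsupp.sum_congr fun z _ => ?_
      rw [mul_smul_comm, smul_mul_assoc, ← map_mul, ← map_mul, torusVal_apply]
      simp
    refine Eq.trans ?_ (key _).symm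
    rw [h, torusVal_cParam hz', torusVal_cParam hz, mul_smul_comm, smul_mul_assoc,
      δ_mul_wE_conj hz hz' h, mul_assoc, ← map_mul, mul_inv_cancel, map_one, mul_one]

end Parameters

/-! ### The Hecke algebra relations in the basis -/

section Hecke

variable [NeZero n] [NeZero r]

theorem act_hBasis_of_mem_torus {z : WGroup r n} (hz : z ∈ torus r n) :
    act r n (hBasis r n z) = Algebra.lmul (Ground r) (WAlg r n) (δ z) := by
  obtain ⟨a, ha⟩ := exists_act_eq_lmul hz
  have : hBasis r n z = a := hAlg_ext (by
    rw [act_hBasis_one, ha, lmul_δ_apply, ← map_mul, mul_one])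
  rw [this, ha]

theorem act_sum_hBasis (c : MonoidAlgebra (Ground r) (torus r n)) (m : WAlg r n) :
    act r n (c.coeff.sum fun z a => a • hBasis r n (z : WGroup r n)) m = torusVal r n c * m := by
  rw [map_finsuppSum, torusVal_eq_sum, Finsupp.sum_mul, Finsupp.sum, Finsupp.sum,
    LinearMap.sum_apply]
  refine Finset.sum_congr rfl fun z _ => ?_
  rw [map_smul, LinearMap.smul_apply, act_hBasis_of_mem_torus z.2, lmul_δ_apply, smul_mul_assoc]

theorem hBasis_ws (i : AffIdx n) : hBasis r n (w r (.s i)) = h r (.s i) := by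
  apply hAlg_ext
  rw [act_hBasis_one, act_s, leftOp_δ_of_lt, mul_one]
  rw [mul_one, wlen_one, wlen_ws]
  exact one_pos

/-- `T_{z s_i}` acts as `leftOp` followed by multiplication by `z`. Applied to `z s_i`, of length
one, it lands in length zero, hence in the branch with the correction term. -/
theorem hBasis_quadratic {z : WGroup r n} (hz : z ∈ torus r n) (i : AffIdx n) :
    hBasis r n (z * w r (.s i)) * hBasis r n (z * w r (.s i)) =
      hBasis r n (z * w r (.s i) * (z * w r (.s i))) +
        ((cParam r n (z * w r (.s i))).coeff.sum fun z a => a • hBasis r n (z : WGroup r n)) *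
          hBasis r n (z * w r (.s i)) := by
  apply hAlg_ext
  have h1 : hBasis r n z * hBasis r n (w r (.s i)) = hBasis r n (z * w r (.s i)) :=
    hBasis_mul _ _ (by
      rw [wlen_mul_of_mem_torus hz, ← mul_one z, wlen_mul_of_mem_torus hz, wlen_one, zero_add])
  have h2 : wlen (z * w r (.s i)) = 1 := by rw [wlen_mul_of_mem_torus hz, wlen_ws]
  have h3 : w r (.s i) * (z * w r (.s i)) = w r (.s i) * z * (w r (.s i))⁻¹ := by
    rw [ws_inv, mul_assoc]
  have h4 : wlen (w r (.s i) * (z * w r (.s i))) = 0 := by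
    rw [h3, ← mul_one (_ * _), wlen_mul_of_mem_torus (torus_normal.conj_mem z hz _), wlen_one]
  rw [map_add, LinearMap.add_apply, map_mul (act r n), map_mul (act r n), Module.End.mul_apply,
    Module.End.mul_apply,
    act_hBasis_one, act_hBasis_one, act_sum_hBasis, torusVal_cParam hz]
  have h5 : ∀ m, act r n (hBasis r n (z * w r (.s i))) m =
      δ z * leftOp r i m := fun m => by
    rw [← h1, map_mul, Module.End.mul_apply, act_hBasis_of_mem_torus hz, lmul_δ_apply, hBasis_ws,
      act_s]
  rw [h5, leftOp_δ, if_pos (by rw [h2, h4]; exact one_pos), mul_add, ← map_mul, mul_smul_comm,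
    smul_mul_assoc, mul_assoc, mul_assoc]

theorem isHeckeAlgebra_hBasis :
    (datum r n).IsHeckeAlgebra (fun _ => (1 : Ground r)) (cParam r n) (hBasis r n) where
  parameter := isParameter_cParam
  braid g g' h := by
    rw [datum_length, datum_length, datum_length] at h
    exact hBasis_mul g g' h
  quadratic s hs := by
    obtain ⟨z, hz, i, rfl⟩ := mem_Saff1_iff.1 hs
    rw [one_smul]
    exact hBasis_quadratic hz i

theorem hBasis_prod (a : List (ZMod n)) (k : ℤ) (l : List (AffIdx n))
    (hl : wlen (l.map fun i => w r (.s i)).prod = l.length) :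
    hBasis r n ((a.map fun j => w r (.t j)).prod * w r .rho ^ k *
        (l.map fun i => w r (.s i)).prod) =
      (a.map fun j => h r (.t j)).prod * ((hRho r n ^ k : (HAlg r n)ˣ) : HAlg r n) *
        (l.map fun i => h r (.s i)).prod := by
  have h1 : ∀ (a : List (ZMod n)) (m : WAlg r n),
      act r n (a.map fun j => h r (.t j)).prod m = δ (a.map fun j => w r (.t j)).prod * m := by
    intro a m
    induction a with
    | nil => rw [List.map_nil, List.prod_nil, List.map_nil, List.prod_nil, map_one,
        Module.End.one_apply, δ,
        map_one, one_mul]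
    | cons j a ih =>
      rw [List.map_cons, List.prod_cons, map_mul, Module.End.mul_apply, ih, act_t_apply,
        List.map_cons, List.prod_cons, ← mul_assoc, ← map_mul]
  apply hAlg_ext
  have h2 := act_prod_apply_δ (r := r) l 1 (by rw [mul_one, hl, wlen_one, add_zero])
  rw [act_hBasis_one, map_mul, Module.End.mul_apply, h2, map_mul, Module.End.mul_apply,
    act_rho_zpow, lmul_δ_apply, h1, mul_one, ← map_mul, ← map_mul, mul_assoc]

end Hecke

end AffineYokonuma

namespace AffineYokonuma

/-! ### Affine braid generators from `X_1` -/

section BraidGroup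

variable {Γ : Type*} [Group Γ] {n : ℕ} {g : ℕ → Γ} {X : Γ}

theorem IsBraidX.sq_mul (hX : IsBraidX n g X) (hn : 2 ≤ n) :
    downProd g 1 (n - 1) * X * (downProd g 1 (n - 1) * X) * g 1 =
      g (n - 1) * (downProd g 1 (n - 1) * X * (downProd g 1 (n - 1) * X)) := by
  rw [IsBraidSeq.downProd_mul_X_sq hn hX.comm_X, ← mul_assoc (g (n - 1)),
    hX.mul_downProd_mul_downProd hn]
  nth_rw 3 [downProd_one_eq hn]
  have := hX.one hn
  simp only [mul_assoc] at this ⊢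
  rw [this]

/-- The formula for the image of `T_{s_0}`. Here `X` commutes with `g_2, …, g_{n-1}` and with `g_1 X
g_1`, hence with `X_n`, which is built from these; so `X⁻¹` can be moved to the other end. -/
theorem IsBraidX.conj_mul_eq (hX : IsBraidX n g X) (hn : 2 ≤ n) :
    downProd g 1 (n - 1) * X * g 1 * (downProd g 1 (n - 1) * X)⁻¹ *
        (downProd g 1 (n - 1) * upProd g 2 (n - 2)) =
      X⁻¹ * (downProd g 1 (n - 1) * X * upProd g 1 (n - 1)) := by
  have hD : Commute X (downProd g 2 (n - 2)) := commute_downProd fun j h1 h2 =>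
    (hX.comm_X j h1 (by omega)).symm
  have hU : Commute X (upProd g 2 (n - 2)) := commute_upProd fun j h1 h2 =>
    (hX.comm_X j h1 (by omega)).symm
  have hg : Commute X (g 1 * X * g 1) := by
    have := hX.one hn
    simp only [Commute, SemiconjBy, mul_assoc] at this ⊢
    exact this.symm
  have hup : upProd g 1 (n - 1) = g 1 * upProd g 2 (n - 2) := by
    rw [← upProd_succ']
    congr 1
    omega
  have hc : Commute X (downProd g 1 (n - 1) * X * upProd g 1 (n - 1)) := by
    have := (hD.mul_right hg).mul_right hU
    rw [downProd_one_eq hn, hup]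
    simpa only [mul_assoc] using this
  rw [hc.inv_left.eq, hup, mul_inv_rev]
  simp only [mul_assoc, inv_mul_cancel_left]
  rw [hU.inv_left.eq]

/-- The affine braid generators of the affine braid group: `g_i` for `i ≠ 0`, and `ρ g_1 ρ⁻¹` for
`i = 0`, where `ρ = g_{n-1} ⋯ g_1 X`. -/
def affineGen (g : ℕ → Γ) (X : Γ) (i : AffIdx n) : Γ :=
  if i.1 = 0 then downProd g 1 (n - 1) * X * g 1 * (downProd g 1 (n - 1) * X)⁻¹ else g i.1.val

theorem affineGen_natCast (hn : 2 ≤ n) {k : ℕ} (h1 : 1 ≤ k) (h2 : k < n) :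
    affineGen g X (⟨(k : ZMod n), hn⟩ : AffIdx n) = g k := by
  rw [affineGen, if_neg (natCast_ne_zero_of_lt h1 h2), ZMod.val_natCast_of_lt h2]

theorem affineGen_zero (i : AffIdx n) (hi : i.1 = 0) : affineGen g X i =
    downProd g 1 (n - 1) * X * g 1 * (downProd g 1 (n - 1) * X)⁻¹ := if_pos hi

variable [NeZero n]

/-- For `i = 1` this is the choice of the zeroth generator, for `i = 0` it is the `ρ²` relation
`sq_mul`, and for the other indices it is sliding through the descending product. -/
theorem IsBraidX.mul_affineGen (hX : IsBraidX n g X) (i : AffIdx n) :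
    downProd g 1 (n - 1) * X * affineGen g X i =
      affineGen g X i.pred * (downProd g 1 (n - 1) * X) := by
  obtain ⟨i, hn⟩ := i
  obtain ⟨k, hk, rfl⟩ : ∃ k < n, i = ((k : ℕ) : ZMod n) := ⟨i.val, ZMod.val_lt _, by simp⟩
  obtain rfl | rfl | ⟨k, rfl⟩ : k = 0 ∨ k = 1 ∨ ∃ k', k = k' + 1 + 1 := by
    obtain _ | _ | k := k
    exacts [Or.inl rfl, Or.inr (Or.inl rfl), Or.inr (Or.inr ⟨k, rfl⟩)]
  · have hp : AffIdx.pred (⟨((0 : ℕ) : ZMod n), hn⟩ : AffIdx n) = ⟨((n - 1 : ℕ) : ZMod n), hn⟩ := by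
      ext
      simp [Nat.cast_sub (show 1 ≤ n by omega)]
    rw [affineGen_zero _ Nat.cast_zero, hp, affineGen_natCast hn (by omega) (by omega), ← mul_assoc,
      mul_inv_eq_iff_eq_mul, ← mul_assoc, hX.sq_mul hn]
    simp only [mul_assoc]
  · rw [affineGen_natCast hn le_rfl (by omega), affineGen_zero, inv_mul_cancel_right]
    simp
  · rw [pred_natCast_succ, affineGen_natCast hn (by omega) hk,
      affineGen_natCast hn (by omega) (by omega),
      hX.downProd_mul_X_mul hX.comm_X (by omega) hk]

theorem IsBraidX.affineGen_eq_conj (hX : IsBraidX n g X) (i : AffIdx n) :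
    affineGen g X i =
      MulAut.conj (downProd g 1 (n - 1) * X) (affineGen g X i.succ) := by
  rw [MulAut.conj_apply, hX.mul_affineGen, AffIdx.pred_succ, mul_inv_cancel_right]

/-- Conjugation by `ρ` rotates the generators, so a relation that meets the index `0` is obtained
from one among `g_1, …, g_{n-1}`. -/
theorem IsBraidX.isAffineBraid (hX : IsBraidX n g X) :
    IsAffineBraid (affineGen g X : AffIdx n → Γ) := by
  have hcomm : ∀ i j : AffIdx n, i.1 ≠ 0 → j.1 ≠ 0 → i.1 - j.1 ≠ 1 → i.1 - j.1 ≠ -1 →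
      affineGen g X i * affineGen g X j = affineGen g X j * affineGen g X i := by
    rintro ⟨i, hn⟩ ⟨j, _⟩ hi hj h h'
    obtain ⟨a, ha, rfl⟩ : ∃ a < n, i = ((a : ℕ) : ZMod n) := ⟨i.val, ZMod.val_lt _, by simp⟩
    obtain ⟨b, hb, rfl⟩ : ∃ b < n, j = ((b : ℕ) : ZMod n) := ⟨j.val, ZMod.val_lt _, by simp⟩
    have ha0 : a ≠ 0 := by rintro rfl; exact hi Nat.cast_zero
    have hb0 : b ≠ 0 := by rintro rfl; exact hj Nat.cast_zero
    have h1 : a ≠ b + 1 := by rintro rfl; simp at h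
    have h2 : b ≠ a + 1 := by rintro rfl; simp at h'
    rw [affineGen_natCast hn (by omega) ha, affineGen_natCast hn (by omega) hb]
    obtain h3 | rfl | h3 := lt_trichotomy a b
    · exact hX.comm a b (by omega) (by omega) hb
    · rfl
    · exact (hX.comm b a (by omega) (by omega) ha).symm
  refine ⟨fun i j h h' => ?_, fun hn i => ?_⟩
  · by_cases hi : i.1 = 0
    · by_cases hj : j.1 = 0
      · rw [AffIdx.ext (hi.trans hj.symm)]
      · rw [hX.affineGen_eq_conj i, hX.affineGen_eq_conj j, ← map_mul, ← map_mul, hcomm]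
        · rw [AffIdx.succ_val, hi, zero_add]
          exact one_ne_zero_of_two_le i.2
        · intro h0
          rw [AffIdx.succ_val] at h0
          exact h (by rw [hi, zero_sub, neg_eq_iff_add_eq_zero]; exact h0)
        · simpa using h
        · simpa using h'
    · by_cases hj : j.1 = 0
      · rw [hX.affineGen_eq_conj i, hX.affineGen_eq_conj j, ← map_mul, ← map_mul, hcomm]
        · intro h0
          rw [AffIdx.succ_val] at h0
          exact h' (by rw [hj, sub_zero, eq_neg_iff_add_eq_zero]; exact h0)
        · rw [AffIdx.succ_val, hj, zero_add]
          exact one_ne_zero_of_two_le i.2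
        · simpa using h
        · simpa using h'
      · exact hcomm i j hi hj h h'
  · have hshift : ∀ i : AffIdx n,
        affineGen g X i.succ * affineGen g X i.succ.succ * affineGen g X i.succ =
          affineGen g X i.succ.succ * affineGen g X i.succ * affineGen g X i.succ.succ →
        affineGen g X i * affineGen g X i.succ * affineGen g X i =
          affineGen g X i.succ * affineGen g X i * affineGen g X i.succ := by
      intro i h
      have h1 := hX.affineGen_eq_conj i
      have h2 := hX.affineGen_eq_conj i.succ
      generalize MulAut.conj (downProd g 1 (n - 1) * X) = φ at h1 h2
      have h3 := congrArg φ h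
      rwa [map_mul, map_mul, map_mul, map_mul, ← h1, ← h2] at h3
    have hgen : ∀ k : ℕ, 1 ≤ k → k + 1 < n → ∀ i : AffIdx n, i.1 = (k : ZMod n) →
        affineGen g X i * affineGen g X i.succ * affineGen g X i =
          affineGen g X i.succ * affineGen g X i * affineGen g X i.succ := by
      rintro k h1 h2 ⟨_, hn⟩ rfl
      have : AffIdx.succ (⟨(k : ZMod n), hn⟩ : AffIdx n) = ⟨((k + 1 : ℕ) : ZMod n), hn⟩ := by
        ext
        simp
      rw [this, affineGen_natCast hn h1 (by omega), affineGen_natCast hn (by omega) h2,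
        hX.braid k h1 h2]
    have h0 : ∀ i : AffIdx n, i.1 = 0 →
        affineGen g X i * affineGen g X i.succ * affineGen g X i =
          affineGen g X i.succ * affineGen g X i * affineGen g X i.succ := fun i hi =>
      hshift i (hgen 1 le_rfl (by omega) _ (by simp [hi]))
    by_cases hi : i.1.val = 0
    · exact h0 i ((ZMod.val_eq_zero _).1 hi)
    · by_cases hi' : i.1.val + 1 < n
      · exact hgen i.1.val (by omega) hi' i (by simp)
      -- For `i = n - 1` the relation involves `n - 1` and `0`; one shift brings it to `0` and `1`,
      -- already treated.
      · refine hshift i (h0 _ ?_)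
        have h1 : i.1.val + 1 = n := by have := ZMod.val_lt i.1; omega
        have h2 := congrArg (Nat.cast : ℕ → ZMod n) h1
        simpa using h2

end BraidGroup

/-! ### Torus elements and quadratic units in a general algebra -/

section TorusAction

variable {r n : ℕ} {A : Type*} [Ring A] [Algebra (Ground r) A]

/-- The element `(1/r) ∑_{s=0}^{r-1} t_a^s t_b^{r-s}`. -/
noncomputable def idemOf (r : ℕ) {n : ℕ} {A : Type*} [Ring A] [Algebra (Ground r) A]
    (t : ZMod n → A) (a b : ZMod n) : A :=
  rInv r • ∑ s ∈ Finset.range r, t a ^ s * t b ^ (r - s)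

/-- Summed up to `s = r` inclusive the expression is symmetric in `a` and `b`, and the additional
term equals `1` on both sides. -/
theorem idemOf_comm {t : ZMod n → A} (hpow : ∀ j, t j ^ r = 1) (hcomm : ∀ i j, Commute (t i) (t j))
    (a b : ZMod n) : idemOf r t a b = idemOf r t b a := by
  have h1 := Finset.sum_range_succ (fun s => t a ^ s * t b ^ (r - s)) r
  have h2 := Finset.sum_range_succ (fun s => t b ^ s * t a ^ (r - s)) r
  rw [← Finset.sum_range_reflect] at h1
  have h3 : ∑ j ∈ Finset.range (r + 1), t a ^ (r + 1 - 1 - j) * t b ^ (r - (r + 1 - 1 - j)) =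
      ∑ s ∈ Finset.range (r + 1), t b ^ s * t a ^ (r - s) := by
    refine Finset.sum_congr rfl fun s hs => ?_
    rw [Finset.mem_range] at hs
    rw [((hcomm a b).pow_pow _ _).eq]
    congr 2
    omega
  rw [h3, h2, hpow, hpow, Nat.sub_self, pow_zero, pow_zero] at h1
  rw [idemOf, idemOf, add_right_cancel h1]

theorem mul_idemOf {t : ZMod n → A} {x : A} {σ : ZMod n → ZMod n}
    (hx : ∀ j, x * t j = t (σ j) * x) (a b : ZMod n) :
    x * idemOf r t a b = idemOf r t (σ a) (σ b) * x := by
  have h : ∀ j, SemiconjBy x (t j) (t (σ j)) := hx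
  simp only [idemOf, mul_smul_comm, smul_mul_assoc, Finset.mul_sum, Finset.sum_mul]
  congr 1
  exact Finset.sum_congr rfl fun s _ => (((h a).pow_right s).mul_right ((h b).pow_right _)).eq

/-- A solution of `x² = 1 + c e x` with `e` commuting with `x` is a unit. -/
noncomputable def quadraticUnit (x e : A) (c : Ground r) (hex : e * x = x * e)
    (hx : x * x = 1 + c • (e * x)) : Aˣ where
  val := x
  inv := x - c • e
  val_inv := by rw [mul_sub, hx, mul_smul_comm, hex, add_sub_cancel_right]
  inv_val := by rw [sub_mul, hx, smul_mul_assoc, add_sub_cancel_right]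

theorem downProd_mul_torus [NeZero n] {t : ZMod n → A} {g : ℕ → Aˣ}
    (hg : ∀ k, 1 ≤ k → k < n → ∀ j, (g k : A) * t j =
      t (Equiv.swap (k : ZMod n) ((k : ZMod n) + 1) j) * (g k : A)) (j : ZMod n) :
    ((downProd g 1 (n - 1) : Aˣ) : A) * t j = t (j - 1) * ((downProd g 1 (n - 1) : Aˣ) : A) := by
  -- Pairing each unit with its transposition carries the permutation along the product, where it is
  -- already known to be the shift.
  let G : ℕ → Aˣ × Equiv.Perm (ZMod n) := fun k => (g k, Equiv.swap (k : ZMod n) ((k : ZMod n) + 1))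
  have h1 := perm_downProd_eq (g := G) (MonoidHom.snd Aˣ (Equiv.Perm (ZMod n))) fun _ _ _ => rfl
  have h2 := map_downProd (MonoidHom.fst Aˣ (Equiv.Perm (ZMod n))) (g := G) 1 (n - 1)
  have h3 : ∀ k, k < n → ∀ j, ((downProd G 1 k).1 : A) * t j =
      t ((downProd G 1 k).2 j) * ((downProd G 1 k).1 : A) := by
    intro k hk
    induction k with
    | zero => simp
    | succ k ih =>
      intro j
      rw [downProd_succ, Prod.fst_mul, Prod.snd_mul, Units.val_mul, mul_assoc, ih (by omega),
        ← mul_assoc, Equiv.Perm.mul_apply, hg _ (by omega) (by omega), mul_assoc]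
  have h4 := h3 (n - 1) (Nat.sub_lt (NeZero.pos n) one_pos) j
  rw [MonoidHom.coe_fst] at h2
  rw [MonoidHom.coe_snd] at h1
  rw [h1, h2, Equiv.subRight_apply] at h4
  exact h4

end TorusAction

end AffineYokonuma

namespace AffineYokonuma

variable {r n : ℕ}

/-! ### Units and relations in the affine Yokonuma–Hecke algebra -/

section YokonumaRelations

theorem y_rel {a b : YFree r n} (hab : YRel r n a b) :
    RingQuot.mkAlgHom (Ground r) (YRel r n) a = RingQuot.mkAlgHom (Ground r) (YRel r n) b :=
  RingQuot.mkAlgHom_rel (Ground r) hab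

theorem mkAlgHom_yf (x : YGen n) :
    RingQuot.mkAlgHom (Ground r) (YRel r n) (yf r x) = y r x := rfl

theorem yt_pow (j : ZMod n) : y r (.t j) ^ r = 1 := by
  simpa only [map_pow, map_one, mkAlgHom_yf] using y_rel (r := r) (YRel.t_pow j)

theorem yt_comm (i j : ZMod n) : y r (.t i) * y r (.t j) = y r (.t j) * y r (.t i) := by
  simpa only [map_mul, mkAlgHom_yf] using y_rel (r := r) (YRel.t_comm i j)

theorem yg_mul_yt (i : FinIdx n) (j : ZMod n) :
    y r (.g i) * y r (.t j) = y r (.t (Equiv.swap i.1 (i.1 + 1) j)) * y r (.g i) := by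
  simpa only [map_mul, mkAlgHom_yf] using y_rel (r := r) (YRel.g_t i j)

theorem yg_comm (i j : FinIdx n) (h : 2 ≤ |((i.1.val : ℤ) - (j.1.val : ℤ))|) :
    y r (.g i) * y r (.g j) = y r (.g j) * y r (.g i) := by
  simpa only [map_mul, mkAlgHom_yf] using y_rel (r := r) (YRel.g_comm i j h)

theorem yg_braid (i j : FinIdx n) (h : j.1 = i.1 + 1) :
    y r (.g i) * y r (.g j) * y r (.g i) = y r (.g j) * y r (.g i) * y r (.g j) := by
  simpa only [map_mul, mkAlgHom_yf] using y_rel (r := r) (YRel.g_braid i j h)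

theorem yg_mul_yX_mul (i : FinIdx n) (h : i.1 = 1) :
    y r (.g i) * y r .X * y r (.g i) * y r .X = y r .X * y r (.g i) * y r .X * y r (.g i) := by
  simpa only [map_mul, mkAlgHom_yf] using y_rel (r := r) (YRel.g_X_g_X i h)

theorem yg_mul_yX (i : FinIdx n) (h : i.1 ≠ 1) : y r (.g i) * y r .X = y r .X * y r (.g i) := by
  simpa only [map_mul, mkAlgHom_yf] using y_rel (r := r) (YRel.g_X i h)

theorem yt_mul_yX (j : ZMod n) : y r (.t j) * y r .X = y r .X * y r (.t j) := by
  simpa only [map_mul, mkAlgHom_yf] using y_rel (r := r) (YRel.t_X j)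

theorem mkAlgHom_yE (i : FinIdx n) : RingQuot.mkAlgHom (Ground r) (YRel r n) (yE r i) =
    idemOf r (fun j => y r (.t j)) i.1 (i.1 + 1) := by
  simp only [yE, idemOf, map_smul, map_sum, map_mul, map_pow, y]

theorem yg_mul_self (i : FinIdx n) : y r (.g i) * y r (.g i) =
    1 + (q r - qInv r) • (idemOf r (fun j => y r (.t j)) i.1 (i.1 + 1) * y r (.g i)) := by
  have := y_rel (r := r) (YRel.g_sq i)
  rwa [map_pow, map_add, map_smul, map_mul, mkAlgHom_yE, sq, map_one] at this

theorem idemOf_mul_yg (i : FinIdx n) : idemOf r (fun j => y r (.t j)) i.1 (i.1 + 1) * y r (.g i) =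
    y r (.g i) * idemOf r (fun j => y r (.t j)) i.1 (i.1 + 1) := by
  rw [mul_idemOf (yg_mul_yt i), Equiv.swap_apply_left, Equiv.swap_apply_right,
    idemOf_comm yt_pow yt_comm]

variable (r n)

/-- The invertible element `X_1`. -/
noncomputable def yXUnit : (YAlg r n)ˣ where
  val := y r .X
  inv := y r .Xinv
  val_inv := by simpa only [map_mul, map_one, mkAlgHom_yf] using y_rel (r := r) (n := n) YRel.X_Xinv
  inv_val := by simpa only [map_mul, map_one, mkAlgHom_yf] using y_rel (r := r) (n := n) YRel.Xinv_X

/-- The invertible element `g_k`, for a natural number `1 ≤ k ≤ n-1`. -/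
noncomputable def ygUnit (k : ℕ) : (YAlg r n)ˣ :=
  if h : (k : ZMod n) ≠ 0 then
    quadraticUnit (y r (.g ⟨k, h⟩)) _ _ (idemOf_mul_yg _) (yg_mul_self _)
  else 1

variable {r n}

theorem val_ygUnit (k : ℕ) : (ygUnit r n k : YAlg r n) = yg r n k := by
  rw [ygUnit, yg]
  split_ifs <;> rfl

theorem val_ygUnit_of_ne {k : ℕ} (hk : (k : ZMod n) ≠ 0) :
    (ygUnit r n k : YAlg r n) = y r (.g ⟨k, hk⟩) := by
  rw [val_ygUnit, yg, dif_pos hk]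

theorem val_downProd_ygUnit (a k : ℕ) :
    ((downProd (ygUnit r n) a k : (YAlg r n)ˣ) : YAlg r n) = downProd (yg r n) a k := by
  have := map_downProd (Units.coeHom (YAlg r n)) (g := ygUnit r n) a k
  simpa only [Units.coeHom_apply, val_ygUnit] using this

theorem val_upProd_ygUnit (a k : ℕ) :
    ((upProd (ygUnit r n) a k : (YAlg r n)ˣ) : YAlg r n) = upProd (yg r n) a k := by
  have := map_upProd (Units.coeHom (YAlg r n)) (g := ygUnit r n) a k
  simpa only [Units.coeHom_apply, val_ygUnit] using this

variable (r n)

/-- The image `g_{n-1} ⋯ g_1 X_1` of `T_ρ`. -/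
noncomputable def yRho : (YAlg r n)ˣ := downProd (ygUnit r n) 1 (n - 1) * yXUnit r n

variable {r n}

theorem val_yRho : (yRho r n : YAlg r n) = gDown r n * y r .X := by
  rw [yRho, Units.val_mul, val_downProd_ygUnit]
  rfl

theorem ygUnit_comm {i j : ℕ} (h1 : 1 ≤ i) (h2 : i + 2 ≤ j) (h3 : j < n) :
    ygUnit r n i * ygUnit r n j = ygUnit r n j * ygUnit r n i := by
  have hi := natCast_ne_zero_of_lt h1 (by omega : i < n)
  have hj := natCast_ne_zero_of_lt (by omega : 1 ≤ j) h3
  refine Units.ext ?_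
  rw [Units.val_mul, Units.val_mul, val_ygUnit_of_ne hi, val_ygUnit_of_ne hj, yg_comm]
  rw [ZMod.val_natCast_of_lt (by omega), ZMod.val_natCast_of_lt h3, abs_sub_comm]
  exact le_trans (by omega) (le_abs_self _)

theorem ygUnit_braid {i : ℕ} (h1 : 1 ≤ i) (h2 : i + 1 < n) :
    ygUnit r n i * ygUnit r n (i + 1) * ygUnit r n i =
      ygUnit r n (i + 1) * ygUnit r n i * ygUnit r n (i + 1) := by
  have hi := natCast_ne_zero_of_lt h1 (by omega : i < n)
  have hj := natCast_ne_zero_of_lt (by omega : 1 ≤ i + 1) h2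
  refine Units.ext ?_
  rw [Units.val_mul, Units.val_mul, Units.val_mul, Units.val_mul, val_ygUnit_of_ne hi,
    val_ygUnit_of_ne hj, yg_braid]
  exact Nat.cast_succ i

theorem ygUnit_mul_yXUnit_mul (hn : 2 ≤ n) :
    ygUnit r n 1 * yXUnit r n * ygUnit r n 1 * yXUnit r n =
      yXUnit r n * ygUnit r n 1 * yXUnit r n * ygUnit r n 1 := by
  have h1 := natCast_ne_zero_of_lt le_rfl (by omega : 1 < n)
  refine Units.ext ?_
  simp only [Units.val_mul]
  rw [val_ygUnit_of_ne h1]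
  exact yg_mul_yX_mul _ Nat.cast_one

theorem ygUnit_mul_yXUnit {i : ℕ} (h1 : 2 ≤ i) (h2 : i < n) :
    ygUnit r n i * yXUnit r n = yXUnit r n * ygUnit r n i := by
  have hi := natCast_ne_zero_of_lt (by omega : 1 ≤ i) h2
  have h := (natCast_ne_of_lt (n := n) le_rfl (by omega : 1 < i) h2.le).symm
  rw [Nat.cast_one] at h
  refine Units.ext ?_
  rw [Units.val_mul, Units.val_mul, val_ygUnit_of_ne hi]
  exact yg_mul_yX _ h

theorem isBraidX_ygUnit : IsBraidX n (ygUnit r n) (yXUnit r n) where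
  comm _ _ := ygUnit_comm
  braid _ := ygUnit_braid
  one := ygUnit_mul_yXUnit_mul
  comm_X _ := ygUnit_mul_yXUnit

variable [NeZero n]

theorem yRho_mul_yt (j : ZMod n) : (yRho r n : YAlg r n) * y r (.t j) =
    y r (.t (j - 1)) * (yRho r n : YAlg r n) := by
  have h1 : (yXUnit r n : YAlg r n) * y r (.t j) = y r (.t j) * (yXUnit r n : YAlg r n) :=
    (yt_mul_yX j).symm
  rw [yRho, Units.val_mul, mul_assoc, h1, ← mul_assoc,
    downProd_mul_torus (t := fun j => y r (.t j)), mul_assoc]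
  intro k h1 h2 j
  rw [val_ygUnit_of_ne (natCast_ne_zero_of_lt h1 h2), yg_mul_yt]

variable (r) in
/-- The image of `T_{s_i}`. -/
noncomputable def yS (i : AffIdx n) : (YAlg r n)ˣ := affineGen (ygUnit r n) (yXUnit r n) i

theorem val_yS_of_ne (i : AffIdx n) (hi : i.1 ≠ 0) : (yS r i : YAlg r n) = y r (.g ⟨i.1, hi⟩) := by
  obtain ⟨i, hn⟩ := i
  obtain ⟨k, hk, rfl⟩ : ∃ k < n, i = ((k : ℕ) : ZMod n) := ⟨i.val, ZMod.val_lt _, by simp⟩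
  have hk0 : k ≠ 0 := by rintro rfl; exact hi Nat.cast_zero
  rw [yS, affineGen_natCast hn (by omega) hk, val_ygUnit_of_ne]

theorem yRho_mul_yS (i : AffIdx n) : yRho r n * yS r i = yS r i.pred * yRho r n :=
  isBraidX_ygUnit.mul_affineGen i

/-- For `i = 0` the relation for `g_1` is conjugated by the image of `T_ρ`, which shifts the torus
indices and so carries `e_1` to `e_0`. -/
theorem yS_mul_self (i : AffIdx n) : (yS r i * yS r i : YAlg r n) =
    1 + (q r - qInv r) • (idemOf r (fun j => y r (.t j)) i.1 (i.1 + 1) * (yS r i : YAlg r n)) := by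
  by_cases hi : i.1 = 0
  · have hi' : i.succ.1 ≠ 0 := by
      rw [AffIdx.succ_val, hi, zero_add]
      exact one_ne_zero_of_two_le i.2
    have h1 : (yS r i : YAlg r n) = yRho r n * yS r i.succ * ((yRho r n)⁻¹ : (YAlg r n)ˣ) := by
      rw [← Units.val_mul, ← Units.val_mul, yRho_mul_yS, AffIdx.pred_succ, mul_inv_cancel_right]
    have h2 := yg_mul_self (r := r) ⟨i.succ.1, hi'⟩
    rw [← val_yS_of_ne] at h2
    have h3 := mul_idemOf (r := r) (yRho_mul_yt (r := r) (n := n)) i.succ.1 (i.succ.1 + 1)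
    simp only [AffIdx.succ_val, add_sub_cancel_right] at h2 h3
    have h4 : (yS r i * yS r i : YAlg r n) =
        yRho r n * (yS r i.succ * yS r i.succ) * ((yRho r n)⁻¹ : (YAlg r n)ˣ) := by
      rw [h1]
      simp only [mul_assoc, Units.inv_mul_cancel_left]
    rw [h4, h2, mul_add, add_mul, mul_one, Units.mul_inv, mul_smul_comm, smul_mul_assoc,
      ← mul_assoc, h3, h1]
    simp only [mul_assoc]
  · rw [val_yS_of_ne i hi, yg_mul_self]

end YokonumaRelations

end AffineYokonuma

namespace AffineYokonuma

variable {r n : ℕ}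

/-! ### The element `X_1` in the Iwahori–Matsumoto algebra -/

section IwahoriUnits

theorem hIdem_eq (i : AffIdx n) :
    hIdem r i = idemOf r (fun j => h r (.t j)) i.1 (i.1 + 1) := rfl

theorem hIdem_mul_hs (i : AffIdx n) : hIdem r i * h r (.s i) = h r (.s i) * hIdem r i := by
  rw [hIdem_eq, mul_idemOf (hs_mul_ht i), Equiv.swap_apply_left, Equiv.swap_apply_right,
    idemOf_comm ht_pow ht_comm]

/-- The invertible element `T_{s_i}`. -/
noncomputable def hsUnit (r : ℕ) {n : ℕ} (i : AffIdx n) : (HAlg r n)ˣ :=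
  quadraticUnit (h r (.s i)) _ _ (hIdem_mul_hs i) (hs_mul_self i)

@[simp] theorem val_hsUnit (i : AffIdx n) : (hsUnit r i : HAlg r n) = h r (.s i) := rfl

theorem isAffineBraid_hsUnit : IsAffineBraid fun i : AffIdx n => hsUnit r i where
  comm i j h h' := Units.ext (isAffineBraid_hs.comm i j h h')
  braid hn i := Units.ext (isAffineBraid_hs.braid hn i)

theorem hRho_mul_hsUnit (i : AffIdx n) : hRho r n * hsUnit r i = hsUnit r i.pred * hRho r n :=
  Units.ext (hrho_mul_hs i)

/-- The element `T_{s_k}`, for a natural number `k` (if `n ≥ 2`). -/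
noncomputable def hgUnit (r n k : ℕ) : (HAlg r n)ˣ :=
  if hn : 2 ≤ n then hsUnit r ⟨(k : ZMod n), hn⟩ else 1

theorem hgUnit_of_two_le (hn : 2 ≤ n) (k : ℕ) :
    hgUnit r n k = hsUnit r ⟨(k : ZMod n), hn⟩ := by
  rw [hgUnit, dif_pos hn]

/-- The image of `X_1` in `Ĥ_{r,n}`. -/
noncomputable def hX (r n : ℕ) : (HAlg r n)ˣ := (downProd (hgUnit r n) 1 (n - 1))⁻¹ * hRho r n

theorem hRho_eq : hRho r n = downProd (hgUnit r n) 1 (n - 1) * hX r n := by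
  rw [hX, mul_inv_cancel_left]

theorem isBraidX_hgUnit [NeZero n] : IsBraidX n (hgUnit r n) (hX r n) := by
  obtain hn | hn := lt_or_ge n 2
  · have : n = 1 := by have := NeZero.ne n; omega
    subst this
    exact ⟨⟨fun _ _ _ _ _ => by omega, fun _ _ _ => by omega⟩, fun _ => by omega,
      fun _ _ _ => by omega⟩
  · have hw : hgUnit r n = fun k : ℕ => hsUnit r ⟨(k : ZMod n), hn⟩ :=
      funext (hgUnit_of_two_le hn)
    rw [hX, hw]
    refine (isAffineBraid_hsUnit.isBraidSeq hn).isBraidX (fun i h1 h2 => ?_) fun _ => ?_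
    · rw [hRho_mul_hsUnit, pred_natCast_succ]
    · rw [mul_assoc, hRho_mul_hsUnit, ← mul_assoc, hRho_mul_hsUnit, pred_pred_one, mul_assoc]

/-- The descending product and `T_ρ` shift the torus indices in the same way, so their quotient
commutes with the torus. -/
theorem hX_mul_ht [NeZero n] (j : ZMod n) :
    (hX r n : HAlg r n) * h r (.t j) = h r (.t j) * (hX r n : HAlg r n) := by
  have h1 := downProd_mul_torus (t := fun j : ZMod n => h r (.t j)) (g := hgUnit r n)
    (fun k h1 h2 j => by
      rw [hgUnit_of_two_le (by omega), val_hsUnit, hs_mul_ht]) j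
  rw [hX, Units.val_mul, mul_assoc, val_hRho, hrho_mul_ht, Units.inv_mul_eq_iff_eq_mul,
    ← mul_assoc, ← mul_assoc, h1, mul_assoc (h r (.t (j - 1))), Units.mul_inv, mul_one]

theorem two_le_of_ne_zero [NeZero n] {i : ZMod n} (hi : i ≠ 0) : 2 ≤ n := by
  by_contra h
  have : n = 1 := by have := NeZero.ne n; omega
  subst this
  exact hi (Subsingleton.elim _ _)

end IwahoriUnits

/-! ### The isomorphism of the two algebras -/

section Homs

theorem FinIdx.one_le_val (i : FinIdx n) : 1 ≤ i.1.val :=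
  Nat.one_le_iff_ne_zero.2 ((ZMod.val_ne_zero _).2 i.2)

variable [NeZero n]

/-- The images in `Ŷ_{r,n}` of the generators of `Ĥ_{r,n}`. -/
noncomputable def toYokonumaGen (r : ℕ) {n : ℕ} : HGen n → YAlg r n
  | .t j => y r (.t j)
  | .s i => yS r i
  | .rho => yRho r n
  | .rhoInv => ((yRho r n)⁻¹ : (YAlg r n)ˣ)

theorem toYokonumaGen_rel {a b : HFree r n} (hab : HRel r n a b) :
    FreeAlgebra.lift (Ground r) (toYokonumaGen r) a =
      FreeAlgebra.lift (Ground r) (toYokonumaGen r) b := by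
  have hs : IsAffineBraid fun i : AffIdx n => (yS r i : YAlg r n) :=
    (isBraidX_ygUnit (r := r)).isAffineBraid.map (Units.coeHom _)
  obtain ⟨i⟩ | ⟨i, j⟩ | ⟨i, hi, j⟩ | ⟨j⟩ | ⟨i⟩ | ⟨i, j, h, h'⟩ | ⟨h, i⟩ | ⟨i⟩ | _ | _ := hab <;>
    simp only [map_mul, map_pow, map_one, map_add, map_smul, FreeAlgebra.lift_ι_apply,
      toYokonumaGen]
  · exact yt_pow i
  · exact yt_comm i j
  · rw [val_yS_of_ne i hi, yg_mul_yt]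
  · exact yRho_mul_yt j
  · rw [← Units.val_mul, yRho_mul_yS, Units.val_mul]
  · exact hs.comm i j h h'
  · exact hs.braid h i
  · have : (FreeAlgebra.lift (Ground r)) (toYokonumaGen r) (hE r i) =
        idemOf r (fun j => y r (.t j)) i.1 (i.1 + 1) := by
      simp only [hE, idemOf, map_mul, map_pow, map_smul, map_sum, FreeAlgebra.lift_ι_apply,
        toYokonumaGen]
    rw [this, sq, yS_mul_self]
  · exact Units.mul_inv _
  · exact Units.inv_mul _

/-- The homomorphism `Ĥ_{r,n} → Ŷ_{r,n}`. -/
noncomputable def toYokonuma (r n : ℕ) [NeZero n] : HAlg r n →ₐ[Ground r] YAlg r n :=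
  RingQuot.liftAlgHom (Ground r)
    ⟨FreeAlgebra.lift (Ground r) (toYokonumaGen r), fun _ _ => toYokonumaGen_rel⟩

theorem toYokonuma_h (x : HGen n) : toYokonuma r n (h r x) = toYokonumaGen r x := by
  rw [toYokonuma, h, RingQuot.liftAlgHom_mkAlgHom_apply, FreeAlgebra.lift_ι_apply]

/-- The images in `Ĥ_{r,n}` of the generators of `Ŷ_{r,n}`. -/
noncomputable def ofYokonumaGen (r : ℕ) {n : ℕ} [NeZero n] : YGen n → HAlg r n
  | .t j => h r (.t j)
  | .g i => h r (.s ⟨i.1, two_le_of_ne_zero i.2⟩)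
  | .X => hX r n
  | .Xinv => ((hX r n)⁻¹ : (HAlg r n)ˣ)

theorem ofYokonumaGen_g (i : FinIdx n) :
    ofYokonumaGen r (.g i) = (hgUnit r n i.1.val : HAlg r n) := by
  rw [hgUnit_of_two_le (two_le_of_ne_zero i.2), val_hsUnit, ofYokonumaGen]
  congr 3
  simp

/-- Since `j` is a nonzero residue, adding one to `i` does not wrap around. -/
theorem FinIdx.val_succ {i j : FinIdx n} (hij : j.1 = i.1 + 1) : j.1.val = i.1.val + 1 := by
  have h1 := ZMod.val_lt i.1
  have h2 : i.1 + 1 = ((i.1.val + 1 : ℕ) : ZMod n) := by simp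
  have h3 : i.1.val + 1 ≠ n := fun h => j.2 (by rw [hij, h2, h, ZMod.natCast_self])
  rw [hij, h2, ZMod.val_natCast_of_lt (by omega)]

theorem ofYokonumaGen_rel {a b : YFree r n} (hab : YRel r n a b) :
    FreeAlgebra.lift (Ground r) (ofYokonumaGen r) a =
      FreeAlgebra.lift (Ground r) (ofYokonumaGen r) b := by
  have hX := isBraidX_hgUnit (r := r) (n := n)
  obtain ⟨i, j, hij⟩ | ⟨i, j, hij⟩ | ⟨i, j⟩ | ⟨i, j⟩ | ⟨i⟩ | ⟨i⟩ | _ | _ | ⟨i, hi⟩ | ⟨i, hi⟩ |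
      ⟨j⟩ := hab <;>
    simp only [map_mul, map_pow, map_one, map_add, map_smul, FreeAlgebra.lift_ι_apply]
  · have h1 := FinIdx.one_le_val i
    have h2 := FinIdx.one_le_val j
    have h3 := ZMod.val_lt i.1
    have h4 := ZMod.val_lt j.1
    rw [ofYokonumaGen_g, ofYokonumaGen_g, ← Units.val_mul, ← Units.val_mul]
    obtain h | h := le_abs.1 hij
    · rw [hX.comm _ _ h2 (by omega) h3]
    · rw [hX.comm _ _ h1 (by omega) h4]
  · have h4 := ZMod.val_lt j.1
    have h5 := FinIdx.val_succ hij
    rw [ofYokonumaGen_g, ofYokonumaGen_g, h5]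
    have := hX.braid _ (FinIdx.one_le_val i) (by omega)
    simpa only [Units.val_mul] using congrArg Units.val this
  · exact ht_comm i j
  · exact hs_mul_ht _ j
  · exact ht_pow i
  · have : (FreeAlgebra.lift (Ground r)) (ofYokonumaGen r) (yE r i) =
        hIdem r (⟨i.1, two_le_of_ne_zero i.2⟩ : AffIdx n) := by
      simp only [yE, hIdem, map_mul, map_pow, map_smul, map_sum, FreeAlgebra.lift_ι_apply,
        ofYokonumaGen]
    rw [this, sq]
    exact hs_mul_self _
  · exact Units.mul_inv _
  · exact Units.inv_mul _
  · have hn := two_le_of_ne_zero i.2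
    have h1 : i.1.val = 1 := by
      rw [hi, ← Nat.cast_one, ZMod.val_natCast_of_lt hn]
    rw [ofYokonumaGen_g, h1]
    simpa only [Units.val_mul, ofYokonumaGen] using congrArg Units.val (hX.one hn)
  · have h1 := FinIdx.one_le_val i
    have h2 : i.1.val ≠ 1 := fun h => hi (by rw [← ZMod.natCast_zmod_val i.1, h, Nat.cast_one])
    rw [ofYokonumaGen_g]
    simpa only [Units.val_mul, ofYokonumaGen] using
      congrArg Units.val (hX.comm_X i.1.val (by omega) (ZMod.val_lt _))
  · exact (hX_mul_ht j).symm

/-- The homomorphism `Ŷ_{r,n} → Ĥ_{r,n}`. -/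
noncomputable def ofYokonuma (r n : ℕ) [NeZero n] : YAlg r n →ₐ[Ground r] HAlg r n :=
  RingQuot.liftAlgHom (Ground r)
    ⟨FreeAlgebra.lift (Ground r) (ofYokonumaGen r), fun _ _ => ofYokonumaGen_rel⟩

theorem ofYokonuma_y (x : YGen n) : ofYokonuma r n (y r x) = ofYokonumaGen r x := by
  rw [ofYokonuma, y, RingQuot.liftAlgHom_mkAlgHom_apply, FreeAlgebra.lift_ι_apply]

theorem map_toYokonuma_hgUnit {k : ℕ} (h1 : 1 ≤ k) (h2 : k < n) :
    Units.map (toYokonuma r n : HAlg r n →* YAlg r n) (hgUnit r n k) = ygUnit r n k := by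
  have hk := natCast_ne_zero_of_lt h1 h2
  refine Units.ext ?_
  rw [val_ygUnit_of_ne hk, hgUnit_of_two_le (by omega)]
  exact (toYokonuma_h _).trans (val_yS_of_ne _ hk)

theorem map_ofYokonuma_ygUnit {k : ℕ} (h1 : 1 ≤ k) (h2 : k < n) :
    Units.map (ofYokonuma r n : YAlg r n →* HAlg r n) (ygUnit r n k) = hgUnit r n k := by
  have hk := natCast_ne_zero_of_lt h1 h2
  refine Units.ext ?_
  rw [hgUnit_of_two_le (by omega), Units.coe_map, val_ygUnit_of_ne hk]
  exact ofYokonuma_y _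

theorem map_toYokonuma_hRho :
    Units.map (toYokonuma r n : HAlg r n →* YAlg r n) (hRho r n) = yRho r n :=
  Units.ext (toYokonuma_h .rho)

theorem map_ofYokonuma_yXUnit :
    Units.map (ofYokonuma r n : YAlg r n →* HAlg r n) (yXUnit r n) = hX r n :=
  Units.ext (ofYokonuma_y .X)

theorem map_toYokonuma_hX :
    Units.map (toYokonuma r n : HAlg r n →* YAlg r n) (hX r n) = yXUnit r n := by
  rw [hX, map_mul, map_inv, map_downProd, map_toYokonuma_hRho,
    downProd_congr fun j h1 h2 => map_toYokonuma_hgUnit h1 (by omega), yRho, inv_mul_cancel_left]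

theorem map_ofYokonuma_yRho :
    Units.map (ofYokonuma r n : YAlg r n →* HAlg r n) (yRho r n) = hRho r n := by
  rw [yRho, map_mul, map_downProd, map_ofYokonuma_yXUnit,
    downProd_congr fun j h1 h2 => map_ofYokonuma_ygUnit h1 (by omega), ← hRho_eq]

/-- The case `i = 0` follows from `i = 1`: in both algebras `T_ρ T_{s_1} = T_{s_0} T_ρ`, and `T_ρ`
can be cancelled. -/
theorem map_ofYokonuma_yS (i : AffIdx n) :
    Units.map (ofYokonuma r n : YAlg r n →* HAlg r n) (yS r i) = hsUnit r i := by
  have hne : ∀ i : AffIdx n, i.1 ≠ 0 →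
      Units.map (ofYokonuma r n : YAlg r n →* HAlg r n) (yS r i) = hsUnit r i := fun i hi => by
    refine Units.ext ?_
    rw [Units.coe_map, val_yS_of_ne i hi]
    exact ofYokonuma_y _
  by_cases hi : i.1 = 0
  · have hi' : i.succ.1 ≠ 0 := by
      rw [AffIdx.succ_val, hi, zero_add]
      exact one_ne_zero_of_two_le i.2
    have h1 := yRho_mul_yS (r := r) i.succ
    have h2 := hRho_mul_hsUnit (r := r) i.succ
    rw [AffIdx.pred_succ] at h1 h2
    have h3 := congrArg (Units.map (ofYokonuma r n : YAlg r n →* HAlg r n)) h1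
    rw [map_mul, map_mul, map_ofYokonuma_yRho, hne _ hi', h2] at h3
    exact (mul_right_cancel h3).symm
  · exact hne i hi

theorem ofYokonuma_comp_toYokonuma :
    (ofYokonuma r n).comp (toYokonuma r n) = AlgHom.id (Ground r) (HAlg r n) := by
  refine RingQuot.ringQuot_ext' _ _ _ (FreeAlgebra.hom_ext (funext fun x => ?_))
  change ofYokonuma r n (toYokonuma r n (h r x)) = h r x
  rw [toYokonuma_h]
  cases x with
  | t j => exact ofYokonuma_y _
  | s i => exact congrArg Units.val (map_ofYokonuma_yS i)
  | rho => exact congrArg Units.val map_ofYokonuma_yRho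
  | rhoInv =>
    have := congrArg (fun u => ((u⁻¹ : (HAlg r n)ˣ) : HAlg r n))
      (map_ofYokonuma_yRho (r := r) (n := n))
    rw [← map_inv] at this
    exact this

theorem toYokonuma_comp_ofYokonuma :
    (toYokonuma r n).comp (ofYokonuma r n) = AlgHom.id (Ground r) (YAlg r n) := by
  refine RingQuot.ringQuot_ext' _ _ _ (FreeAlgebra.hom_ext (funext fun x => ?_))
  change toYokonuma r n (ofYokonuma r n (y r x)) = y r x
  rw [ofYokonuma_y]
  cases x with
  | t j => exact toYokonuma_h _
  | g i => exact (toYokonuma_h _).trans (val_yS_of_ne _ i.2)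
  | X => exact congrArg Units.val map_toYokonuma_hX
  | Xinv =>
    have := congrArg (fun u => ((u⁻¹ : (YAlg r n)ˣ) : YAlg r n))
      (map_toYokonuma_hX (r := r) (n := n))
    rw [← map_inv] at this
    exact this

/-- The isomorphism between the two presentations. -/
noncomputable def yokonumaEquiv (r n : ℕ) [NeZero n] : HAlg r n ≃ₐ[Ground r] YAlg r n :=
  AlgEquiv.ofAlgHom (toYokonuma r n) (ofYokonuma r n) toYokonuma_comp_ofYokonuma
    ofYokonuma_comp_toYokonuma

theorem yokonumaEquiv_h (x : HGen n) : yokonumaEquiv r n (h r x) = toYokonumaGen r x :=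
  toYokonuma_h x

theorem yokonumaEquiv_s_zero (i : AffIdx n) (hi : i.1 = 0) :
    yokonumaEquiv r n (h r (.s i)) * (gDown r n * gUp₂ r n) = y r .Xinv * Xn r n := by
  have h1 := congrArg Units.val ((isBraidX_ygUnit (r := r) (n := n)).conj_mul_eq i.2)
  rw [← affineGen_zero i hi, Units.val_mul, Units.val_mul, Units.val_mul, Units.val_mul,
    Units.val_mul, val_downProd_ygUnit, val_upProd_ygUnit, val_upProd_ygUnit] at h1
  rw [yokonumaEquiv_h]
  exact h1

end Homs

end AffineYokonuma

/-- Apart from the conditions on the parameters, the structure consists of algebra identities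
between basis vectors, which an isomorphism transports. -/
theorem ProPIwahori.Datum.IsHeckeAlgebra.map {G : Type} [Group G] {ι : Type} [Fintype ι]
    {M : CoxeterMatrix ι} {D : ProPIwahori.Datum G M} {R : Type} [CommRing R] {q : G → R}
    {c : G → MonoidAlgebra R D.Z} {A B : Type} [Ring A] [Algebra R A] [Ring B] [Algebra R B]
    {T : Module.Basis G R A} (hT : D.IsHeckeAlgebra q c T) (Φ : A ≃ₐ[R] B) :
    D.IsHeckeAlgebra q c (T.map Φ.toLinearEquiv) where
  parameter := hT.parameter
  braid w w' h := by
    simp only [Module.Basis.map_apply, AlgEquiv.toLinearEquiv_apply]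
    rw [← map_mul, hT.braid w w' h]
  quadratic s hs := by
    simp only [Module.Basis.map_apply, AlgEquiv.toLinearEquiv_apply]
    rw [← map_mul, hT.quadratic s hs, map_add, map_smul, map_mul Φ (Finsupp.sum _ _),
      map_finsuppSum]
    simp only [map_smul]

open AffineYokonuma in
theorem corollary2p8 (r n : ℕ) [NeZero r] [NeZero n] :
    ∃ (D : ProPIwahori.Datum (WGroup r n) (affineA n))
      (qpar : WGroup r n → Ground r)
      (cpar : WGroup r n → MonoidAlgebra (Ground r) D.Z)
      (T : Module.Basis (WGroup r n) (Ground r) (HAlg r n))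
      (Φ : HAlg r n ≃ₐ[Ground r] YAlg r n),
      -- the datum
      D.Z = torus r n ∧
      (∀ i : AffIdx n, (D.cs.simple i : WGroup r n ⧸ D.Z) = (w r (.s i) : WGroup r n)) ∧
      D.Ω = Subgroup.zpowers ((w r .rho : WGroup r n) : WGroup r n ⧸ D.Z) ∧
      D.I₀ = {i | i.1 ≠ 0} ∧
      D.Λ = Subgroup.normalClosure {((wX r n : WGroup r n) : WGroup r n ⧸ D.Z)} ∧
      -- the parameters, for the elements `t s_i` of `Saff(1)`
      (∀ t ∈ torus r n, ∀ i : AffIdx n, qpar (t * w r (.s i)) = 1) ∧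
      (∀ t ∈ torus r n, ∀ i : AffIdx n,
        MonoidAlgebra.mapDomain (Subtype.val : D.Z → WGroup r n) (cpar (t * w r (.s i))) =
          (q r - qInv r) • (MonoidAlgebra.of (Ground r) (WGroup r n) t * wE r i)) ∧
      -- the basis `T_w`: for reduced expressions, `T_{t ρ^k s ⋯ s'} = t T_ρ^k T_s ⋯ T_s'`
      (∀ (a : List (ZMod n)) (k : ℤ) (l : List (AffIdx n)),
        D.length (l.map fun i => w r (.s i)).prod = l.length →
        T ((a.map fun j => w r (.t j)).prod * w r .rho ^ k * (l.map fun i => w r (.s i)).prod) =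
          (a.map fun j => h r (.t j)).prod * ((hRho r n ^ k : (HAlg r n)ˣ) : HAlg r n) *
            (l.map fun i => h r (.s i)).prod) ∧
      -- the isomorphism with the affine Yokonuma–Hecke algebra
      (∀ j : ZMod n, Φ (h r (.t j)) = y r (.t j)) ∧
      (∀ (i : AffIdx n) (hi : i.1 ≠ 0), Φ (h r (.s i)) = y r (.g ⟨i.1, hi⟩)) ∧
      (∀ i : AffIdx n, i.1 = 0 →
        Φ (h r (.s i)) * (gDown r n * gUp₂ r n) = y r .Xinv * Xn r n) ∧
      Φ (h r .rho) = gDown r n * y r .X ∧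
      -- both algebras are the pro-p-Iwahori–Hecke algebra of this datum
      D.IsHeckeAlgebra qpar cpar T ∧
      D.IsHeckeAlgebra qpar cpar (T.map Φ.toLinearEquiv) :=
  ⟨datum r n, fun _ => 1, cParam r n, hBasis r n, yokonumaEquiv r n, rfl,
    affineCoxeterSystem_simple, rfl, rfl, rfl, fun _ _ _ => rfl,
    fun _ ht i => torusVal_cParam ht i,
    fun a k l hl => hBasis_prod a k l (by rw [← datum_length]; exact hl),
    fun _ => yokonumaEquiv_h _, fun i hi => (yokonumaEquiv_h _).trans (val_yS_of_ne i hi),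
    yokonumaEquiv_s_zero, (yokonumaEquiv_h _).trans val_yRho,
    isHeckeAlgebra_hBasis, isHeckeAlgebra_hBasis.map _⟩
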